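/- **Circuit model.** A circuit is a sequence of stages; each stage is a set of gates acting on disjoint qubits. The gates are the Hadamard gate, the rotations $R_k=\mathrm{diag}(1,e^{2\pi i/2^k})$, the controlled rotations $R_k$, and the inverses of these. The size is the number of gates, the depth the number of stages. States carry the Euclidean norm. For $\alpha=\sum_{j<2^n}\alpha_j|j\rangle$ let $\hat\alpha=\sum_{x<2^n}\hat\alpha_x|x\rangle$, $\hat\alpha_x=2^{-n/2}\sum_{y}\alpha_y e^{2\pi i xy/2^n}$, be its QFT over $\mathbb Z_{2^n}$, and let $|\hat j\rangle$ be the QFT of $|j\rangle$. Bit $p$ of an $n$-bit number ($0\le p<n$) is the one of weight $2^p$, and qubit $p$ of a register holds bit $p$. A subtraction family is a family of circuits $S_n$ with $|x\rangle|y\rangle|0\rangle\mapsto|x-y \bmod 2^n\rangle|y\rangle|0\rangle$ of size $O(n)$, depth $O(\log n)$ and with $O(n)$ ancilla qubits. **Circuits.** Fix a parameter $k\ge1$. * $\mathrm{AQFS}_{n,k}$ (approximate Fourier state computation, $|j\rangle|0\rangle\mapsto|j\rangle|\hat j\rangle$): Hadamards on the second register, then for $r=1,\dots,k$ one stage of controlled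 $R_r$ from bit $n-r-p$ of $j$ to qubit $p$ of the second register, for all $0\le p\le n-r$; rotations with $r>k$ are omitted. * $\mathrm{COPY}_n$ ($|\hat j\rangle|0\rangle\mapsto|\hat j\rangle|\hat j\rangle$): Hadamards on the second register, then $S_n$ subtracts the second register from the first. * $\mathrm{FPE}_{n,k}$ (Fourier phase estimation, $|j\rangle|\hat j\rangle^3\mapsto|0\rangle|\hat j\rangle^3$): for every $i\ge0$ with $ik<n$, the window of $2k$ consecutive qubits starting at qubit $ik$ (cut off at the end of the register) of the first copy of $|\hat j\rangle$ if $i$ is even, of the second copy if $i$ is odd, undergoes an exact inverse QFT modulo $2^{L}$, where $L\le 2k$ is the window's length, all in parallel; the leading $k$ output bits of each window (all of them if it has fewer) are xored into the corresponding bits of $j$; the window transforms are undone. The third copy is untouched. * $\mathrm{UQFT}_{n,k}$: $\mathrm{AQFS}_{n,k}$, two $\mathrm{COPY}_n$, $\mathrm{FPE}_{n,k}$, the two $\mathrm{COPY}_n$ reversed, and an exchange of registers, $|j\rangle|0\rangle\mapsto|j\rangle|\hat j\rangle\mapsto|j\rangle|\hat j\rangle^3\mapsto|0\rangle|\hat j\rangle^3\mapsto|\hat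 j\rangle|0\rangle$. * $\mathrm{PQFT}_{n,k}$: prepare a uniform superposition of shifts $|s\rangle$ in a further register, replace $j$ by $j+s\bmod 2^n$, apply $\mathrm{UQFT}_{n,k}$, then undo the shift: compute $|\hat s\rangle$ by $\mathrm{AQFS}_{n,k}$, map $|\hat s\rangle|\widehat{j+s}\rangle\mapsto|\hat s\rangle|\hat j\rangle$ by $S_n$ reversed, uncompute $|\hat s\rangle$, and clear the shift register by Hadamards. Let $B=B_{n,k}$ be the set of $j<2^n$ such that, when the $n$ bits of $j$ are divided from the most significant one on into consecutive blocks of $k$ bits, some complete block $b\in[0,2^k)$ has $\min(b,2^k-b)<2^{k/2}$. **Theorem.** Subtraction families exist. Moreover there is an absolute constant $C$ such that the following two items hold for all $n,k\ge1$. 1. $\mathrm{AQFS}_{n,k}$ has size at most $n(k+1)$, depth at most $k+1$, and for every $\alpha$ the image of $\sum_j\alpha_j|j\rangle|0\rangle$ is within $C n2^{-k}\|\alpha\|$ of $\sum_j\alpha_j|j\rangle|\hat j\rangle$. 2. $\mathrm{FPE}_{n,k}$ has size at most $Cnk$, depth at most $8k+1$, and for every $\alpha$ it maps $\sum_j\alpha_j|j\rangle|\hat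 j\rangle^3$ to a state whose squared distance from $\sum_j\alpha_j|0\rangle|\hat j\rangle^3$ is at most $C\big(n2^{-k/2}\|\alpha\|^2+\sum_{j\in B}|\alpha_j|^2\big)$; and $|B|\le C\,n2^{-k/2}\,2^n$. For every subtraction family there is a constant $C$ such that the following two items hold for all $n\ge2$ and $k\ge1$. 3. $\mathrm{COPY}_n$ performs $|\hat j\rangle|0\rangle\mapsto|\hat j\rangle|\hat j\rangle$ exactly (ancillas being returned to $|0\rangle$), in size at most $Cn$ and depth at most $C\log n$. 4. $\mathrm{UQFT}_{n,k}$ and $\mathrm{PQFT}_{n,k}$ have size at most $Cnk$ and depth at most $C(k+\log n)$. For every $\alpha$ the squared distance of the image of $|\alpha\rangle|0\rangle$ from $|\hat\alpha\rangle|0\rangle$ is at most $C\big(n2^{-k/2}\|\alpha\|^2+\sum_{j\in B}|\alpha_j|^2\big)$ for $\mathrm{UQFT}_{n,k}$, and at most $C\,n2^{-k/2}\|\alpha\|^2$ for $\mathrm{PQFT}_{n,k}$. Finally, for every subtraction family: 5. For every $c\in\mathbb N$ there are constants $A\in\mathbb N$ and $C$ such that for all $n\ge2$ the circuit $\mathrm{PQFT}_{n,k}$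 with $k=A\lceil\log_2 n\rceil$ has size at most $Cn\log n$, depth at most $C\log n$, uses at most $Cn$ qubits, and approximates the QFT over $\mathbb Z_{2^n}$ to within $n^{-c}$: for every $\alpha$, the image of $|\alpha\rangle|0\rangle$ is within $n^{-c}\|\alpha\|$ of $|\hat\alpha\rangle|0\rangle$. -/

import Mathlib

namespace QFTCircuit

/-! ### States -/

/-- Pure states (unnormalised) of qubits labelled by `ι`: complex amplitudes on bit assignments,
with the Euclidean norm. -/
abbrev State (ι : Type) : Type := EuclideanSpace ℂ (ι → Bool)

/-- The computational basis state of the bit assignment `x`. -/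
noncomputable def ket {ι : Type} [DecidableEq ι] [Fintype ι] (x : ι → Bool) : State ι :=
  EuclideanSpace.single x 1

/-- The all-zero basis state. -/
noncomputable def zeroKet {ι : Type} [DecidableEq ι] [Fintype ι] : State ι :=
  ket fun _ => false

/-- The tensor product of a state of the qubits `ι` and a state of the qubits `κ`. -/
noncomputable def tensor {ι κ : Type} (ψ : State ι) (φ : State κ) : State (ι ⊕ κ) :=
  WithLp.toLp 2 fun z => ψ (fun i => z (Sum.inl i)) * φ (fun i => z (Sum.inr i))

/-- The integer in `[0, 2 ^ n)` held by an `n`-qubit register; qubit `p` has weight `2 ^ p`. -/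
def val {n : ℕ} (x : Fin n → Bool) : ℕ := ∑ p : Fin n, if x p then 2 ^ (p : ℕ) else 0

/-- The `n` low-order bits of `m`, that is, the register contents representing `m mod 2 ^ n`. -/
def bits (n m : ℕ) : Fin n → Bool := fun p => m.testBit p

/-- The quantum Fourier transform over `ℤ / 2 ^ n`. -/
noncomputable def qft (n : ℕ) (α : State (Fin n)) : State (Fin n) :=
  WithLp.toLp 2 fun x => ((1 / Real.sqrt (2 ^ n) : ℝ) : ℂ) *
    ∑ y, α y * Complex.exp (2 * Real.pi * Complex.I * ((val x * val y : ℕ) : ℂ) / 2 ^ n)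

/-- The Fourier basis state of `j`. -/
noncomputable def fourier {n : ℕ} (j : Fin n → Bool) : State (Fin n) := qft n (ket j)

/-! ### Gates and circuits -/

/-- The gate set: Hadamard, rotations `R k = diag(1, e ^ (2πi / 2 ^ k))`, controlled rotations,
and the inverses of the rotations and of the controlled rotations. -/
inductive Gate (ι : Type) : Type
  | had (w : ι) : Gate ι
  | rot (k : ℕ) (w : ι) : Gate ι
  | rotInv (k : ℕ) (w : ι) : Gate ι
  | crot (k : ℕ) (c t : ι) : Gate ι
  | crotInv (k : ℕ) (c t : ι) : Gate ι

/-- The qubits on which a gate acts. -/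
def Gate.wires {ι : Type} : Gate ι → List ι
  | .had w => [w]
  | .rot _ w => [w]
  | .rotInv _ w => [w]
  | .crot _ c t => [c, t]
  | .crotInv _ c t => [c, t]

/-- The gate run in reverse. -/
def Gate.inv {ι : Type} : Gate ι → Gate ι
  | .had w => .had w
  | .rot k w => .rotInv k w
  | .rotInv k w => .rot k w
  | .crot k c t => .crotInv k c t
  | .crotInv k c t => .crot k c t

/-- The same gate placed on other qubits. -/
def Gate.relabel {ι κ : Type} (f : ι → κ) : Gate ι → Gate κ
  | .had w => .had (f w)
  | .rot k w => .rot k (f w)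
  | .rotInv k w => .rotInv k (f w)
  | .crot k c t => .crot k (f c) (f t)
  | .crotInv k c t => .crotInv k (f c) (f t)

/-- The phase `e ^ (2πi / 2 ^ k)`. -/
noncomputable def phase (k : ℕ) : ℂ := Complex.exp (2 * Real.pi * Complex.I / 2 ^ k)

/-- The action of a gate on states. -/
noncomputable def Gate.act {ι : Type} [DecidableEq ι] : Gate ι → State ι → State ι
  | .had w, ψ => WithLp.toLp 2 fun x =>
      (ψ (Function.update x w false) + (if x w then -1 else 1) * ψ (Function.update x w true)) /
        ((Real.sqrt 2 : ℝ) : ℂ)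
  | .rot k w, ψ => WithLp.toLp 2 fun x => (if x w then phase k else 1) * ψ x
  | .rotInv k w, ψ => WithLp.toLp 2 fun x => (if x w then (phase k)⁻¹ else 1) * ψ x
  | .crot k c t, ψ => WithLp.toLp 2 fun x => (if x c && x t then phase k else 1) * ψ x
  | .crotInv k c t, ψ => WithLp.toLp 2 fun x => (if x c && x t then (phase k)⁻¹ else 1) * ψ x

/-- A circuit is the list of its stages, each stage being a list of gates. -/
abbrev Circuit (ι : Type) : Type := List (List (Gate ι))

namespace Circuit

/-- In every stage each qubit is used at most once (in particular the control and the target of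
a gate are different), so that the gates of a stage can be performed in parallel. -/
def WellFormed {ι : Type} (C : Circuit ι) : Prop :=
  ∀ s ∈ C, (s.flatMap Gate.wires).Nodup

/-- The number of gates. -/
def size {ι : Type} (C : Circuit ι) : ℕ := (C.map List.length).sum

/-- The number of stages. -/
def depth {ι : Type} (C : Circuit ι) : ℕ := C.length

/-- The action of the circuit on states; the first gate of the first stage acts first. -/
noncomputable def run {ι : Type} [DecidableEq ι] (C : Circuit ι) (ψ : State ι) : State ι :=
  C.flatten.foldl (fun φ g => g.act φ) ψ

/-- The circuit run backwards. -/
def reversed {ι : Type} (C : Circuit ι) : Circuit ι :=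
  C.reverse.map fun s => s.reverse.map Gate.inv

/-- The same circuit placed on other qubits. -/
def relabel {ι κ : Type} (f : ι → κ) (C : Circuit ι) : Circuit κ :=
  C.map fun s => s.map (Gate.relabel f)

/-- Two circuits side by side, started at the same stage. -/
def par {ι : Type} : Circuit ι → Circuit ι → Circuit ι
  | [], D => D
  | s :: C, [] => s :: C
  | s :: C, t :: D => (s ++ t) :: par C D

/-- Hadamard gates, in one stage, on the `n` qubits `f 0, …, f (n - 1)`. -/
def hadamards {ι : Type} {n : ℕ} (f : Fin n → ι) : Circuit ι :=
  [(List.finRange n).map fun p => Gate.had (f p)]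

/-- Controlled-nots in parallel, with control `c p` and target `t p` for each `p < n`. -/
def cnots {ι : Type} {n : ℕ} (c t : Fin n → ι) : Circuit ι :=
  hadamards t ++ [(List.finRange n).map fun p => Gate.crot 1 (c p) (t p)] ++ hadamards t

/-- Exchange of the qubits `f p` and `g p` for each `p < n`. -/
def swaps {ι : Type} {n : ℕ} (f g : Fin n → ι) : Circuit ι :=
  cnots f g ++ cnots g f ++ cnots f g

/-- The exact QFT over `ℤ / 2 ^ L` in `2 L - 1` stages: Hadamard on qubit `a` in stage `2 a`,
controlled `R (b - a + 1)` on qubits `a < b` in stage `a + b`. The input has its most significant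
bit in qubit `0`, the output has its least significant bit in qubit `0`. -/
def exactQFT (L : ℕ) : Circuit (Fin L) :=
  (List.range (2 * L - 1)).map fun m =>
    (List.finRange L).flatMap fun (a : Fin L) => (List.finRange L).flatMap fun (b : Fin L) =>
      if (a : ℕ) + b = m then
        if a = b then [Gate.had a]
        else if a < b then [Gate.crot ((b : ℕ) - a + 1) b a]
        else []
      else []

/-! ### The three basic maps -/

/-- Approximate Fourier state computation `|j⟩|0⟩ ↦ |j⟩|ĵ⟩`: Hadamards on the second register,
then, in stages `r = 1, …, k`, controlled `R r` from bit `n - r - p` of `j` on qubit `p` of the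
second register. The rotations `R r` with `r > k` are omitted. -/
def aqfs (n k : ℕ) : Circuit (Fin n ⊕ Fin n) :=
  hadamards (Sum.inr : Fin n → Fin n ⊕ Fin n) ++
    (List.range k).map fun r => (List.finRange n).flatMap fun (p : Fin n) =>
      if h : (r + 1) + (p : ℕ) ≤ n then
        [Gate.crot (r + 1) (Sum.inl ⟨n - (r + 1) - p, by omega⟩) (Sum.inr p)]
      else []

/-- Copying a Fourier basis state, `|ĵ⟩|0⟩ ↦ |ĵ⟩|ĵ⟩`: Hadamards on the second register, then
subtraction (by the circuit `S`, with `a` ancillas) of the second register from the first. -/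
def copy (n a : ℕ) (S : Circuit (Fin n ⊕ (Fin n ⊕ Fin a))) :
    Circuit (Fin n ⊕ (Fin n ⊕ Fin a)) :=
  hadamards (fun p => Sum.inr (Sum.inl p)) ++ S

/-- The qubits of Fourier phase estimation: the register of `j` and three Fourier registers. -/
abbrev FPEWire (n : ℕ) : Type := Fin n ⊕ (Fin n ⊕ (Fin n ⊕ Fin n))

/-- Qubit `p` of the first (`i` even) or of the second (`i` odd) Fourier register. -/
def fpeCopy {n : ℕ} (i : ℕ) (p : Fin n) : FPEWire n :=
  if i % 2 = 0 then Sum.inr (Sum.inl p) else Sum.inr (Sum.inr (Sum.inl p))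

/-- The exact QFTs modulo `2 ^ (2 k)`, in parallel, on the windows of `2 k` consecutive qubits that
start at qubit `i k`, in the first Fourier register for even `i` and in the second one for odd `i`;
windows that reach beyond the register are cut off at its end. -/
def windowQFTs (n k : ℕ) : Circuit (FPEWire n) :=
  ((List.range n).map fun i =>
    (exactQFT (min (2 * k) (n - i * k))).relabel
      fun (q : Fin (min (2 * k) (n - i * k))) => fpeCopy i (⟨i * k + q, by have := q.isLt; omega⟩ : Fin n)).foldr par []

/-- Fourier phase estimation `|j⟩|ĵ⟩|ĵ⟩|ĵ⟩ ↦ |0⟩|ĵ⟩|ĵ⟩|ĵ⟩`: the window QFTs are inverted, the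
leading `k` bits of the estimate obtained from each window are xored into the corresponding bits of
`j`, and the window QFTs are restored. The third Fourier register is not touched. -/
def fpe (n k : ℕ) : Circuit (FPEWire n) :=
  (windowQFTs n k).reversed ++
    cnots (fun p : Fin n => fpeCopy ((p : ℕ) / k) p) (fun p => Sum.inl p.rev) ++
    windowQFTs n k

/-! ### The Fourier transform circuits -/

/-- The qubits of the circuit `uqft`: input/output register, three Fourier registers and
`a` ancillas. -/
abbrev UWire (n a : ℕ) : Type := Fin n ⊕ ((Fin n ⊕ (Fin n ⊕ Fin n)) ⊕ Fin a)

/-- Placement of the registers of `fpe` in `uqft`. -/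
def fpeToU {n a : ℕ} : FPEWire n → UWire n a
  | Sum.inl p => Sum.inl p
  | Sum.inr q => Sum.inr (Sum.inl q)

/-- Three registers (two of `n` qubits, and the ancillas) placed by `f`, `g` and `h`. -/
def place {n a : ℕ} {κ : Type} (f g : Fin n → κ) (h : Fin a → κ) : Fin n ⊕ (Fin n ⊕ Fin a) → κ :=
  Sum.elim f (Sum.elim g h)

/-- The approximate parallel QFT for sufficiently uniform inputs:
`|j⟩|0⟩ ↦ |j⟩|ĵ⟩ ↦ |j⟩|ĵ⟩|ĵ⟩|ĵ⟩ ↦ |0⟩|ĵ⟩|ĵ⟩|ĵ⟩ ↦ |0⟩|ĵ⟩ ↦ |ĵ⟩|0⟩`. -/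
def uqft (n k a : ℕ) (S : Circuit (Fin n ⊕ (Fin n ⊕ Fin a))) : Circuit (UWire n a) :=
  let data : Fin n → UWire n a := Sum.inl
  let f₁ : Fin n → UWire n a := fun p => Sum.inr (Sum.inl (Sum.inl p))
  let f₂ : Fin n → UWire n a := fun p => Sum.inr (Sum.inl (Sum.inr (Sum.inl p)))
  let f₃ : Fin n → UWire n a := fun p => Sum.inr (Sum.inl (Sum.inr (Sum.inr p)))
  let anc : Fin a → UWire n a := fun p => Sum.inr (Sum.inr p)
  let copies : Circuit (UWire n a) :=
    (copy n a S).relabel (place f₁ f₂ anc) ++ (copy n a S).relabel (place f₁ f₃ anc)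
  (aqfs n k).relabel (Sum.elim data f₁) ++ copies ++ (fpe n k).relabel fpeToU ++
    copies.reversed ++ swaps data f₁

/-- The qubits of the circuit `pqft`: input/output register, shift register, three Fourier
registers and `a` ancillas. -/
abbrev PWire (n a : ℕ) : Type := Fin n ⊕ (Fin n ⊕ ((Fin n ⊕ (Fin n ⊕ Fin n)) ⊕ Fin a))

/-- Placement of the qubits of `uqft` in `pqft`. -/
def uToP {n a : ℕ} : UWire n a → PWire n a
  | Sum.inl p => Sum.inl p
  | Sum.inr q => Sum.inr (Sum.inr q)

/-- The approximate parallel QFT for arbitrary inputs. A uniformly random shift `s` is prepared (in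
superposition) and added to the input `j`; then `uqft` is applied, giving the Fourier state of
`j + s`; the shift is undone by computing the Fourier state of `s`, adding the former to the latter,
which turns the former into the Fourier state of `j`, and uncomputing the Fourier state of `s`;
finally the shift register is cleared. Addition is the subtraction circuit run backwards. -/
def pqft (n k a : ℕ) (S : Circuit (Fin n ⊕ (Fin n ⊕ Fin a))) : Circuit (PWire n a) :=
  let data : Fin n → PWire n a := Sum.inl
  let shift : Fin n → PWire n a := fun p => Sum.inr (Sum.inl p)
  let f₁ : Fin n → PWire n a := fun p => Sum.inr (Sum.inr (Sum.inl (Sum.inl p)))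
  let anc : Fin a → PWire n a := fun p => Sum.inr (Sum.inr (Sum.inr p))
  let shiftState : Circuit (PWire n a) := (aqfs n k).relabel (Sum.elim shift f₁)
  hadamards shift ++ S.reversed.relabel (place data shift anc) ++ (uqft n k a S).relabel uToP ++
    shiftState ++ S.reversed.relabel (place f₁ data anc) ++ shiftState.reversed ++ hadamards shift

end Circuit

/-- The circuits `S n` (with `a n` ancillas, clean before and after) compute subtraction modulo
`2 ^ n`, namely `|x⟩|y⟩|0⟩ ↦ |x - y⟩|y⟩|0⟩`, in linear size, logarithmic depth and with linearly
many ancillas, with constant `C`. -/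
def IsSubtractionFamily (C : ℝ) (a : ℕ → ℕ)
    (S : ∀ n : ℕ, Circuit (Fin n ⊕ (Fin n ⊕ Fin (a n)))) : Prop :=
  (∀ n : ℕ, (S n).WellFormed ∧ ∀ x y : Fin n → Bool,
    (S n).run (tensor (ket x) (tensor (ket y) zeroKet)) =
      tensor (ket (bits n (val x + 2 ^ n - val y))) (tensor (ket y) zeroKet)) ∧
  ∀ n : ℕ, 2 ≤ n → (a n : ℝ) ≤ C * n ∧ ((S n).size : ℝ) ≤ C * n ∧
    ((S n).depth : ℝ) ≤ C * Real.log n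

open scoped Classical in
/-- The bad `j`: split the `n` bits of `j`, beginning with the most significant one, into
consecutive blocks of length `k`; some complete block has distance less than `2 ^ (k / 2)` to the
nearest multiple of `2 ^ k`. -/
noncomputable def bad (n k : ℕ) : Finset (Fin n → Bool) :=
  Finset.univ.filter fun j => ∃ i : ℕ, (i + 1) * k ≤ n ∧
    (min (val j / 2 ^ (n - (i + 1) * k) % 2 ^ k)
      (2 ^ k - val j / 2 ^ (n - (i + 1) * k) % 2 ^ k)) ^ 2 < 2 ^ k

end QFTCircuit

/-!
The circuits are analysed through the amplitudes of basis states. A gate is a linear isometry that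
treats functions of the qubits it does not touch as scalars (`Circuit.run_mul`), so a circuit placed
on some of the qubits acts separately on every slice obtained by fixing the others
(`Circuit.slice_run`, `Circuit.run_relabel_apply_of_slice`). This reduces each of the composite
circuits to its parts, and makes errors additive by the triangle inequality.

*Subtraction.* The carries of an addition are found by a parallel prefix computation with Toffoli
gates: neighbouring positions are merged (`carry_merge`), which halves the length and gives linear
size and logarithmic depth (`Circuit.carries`, `Circuit.maps_carries`). The borrows of `x - y` are
the carries of the addition of `y` to the complement of `x`, and also those of the addition of `y`
to `x - y` (`carry_diff`); the second description clears the ancillas after the minuend has been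
overwritten (`subtraction_isSubtractionFamily`).

*Fourier states.* The amplitudes of a Fourier state are products of phases over pairs of bits. The
omitted rotations are phases within `O(2 ^ (-k))` of `1`, in total, for each of the `n` qubits
(`norm_aqfs_sub_le`). As functions of the basis state the amplitudes are characters
(`chi_add_left`), so the subtraction of a uniform superposition from a Fourier state copies it
(`run_copy`).

*Phase estimation.* On a window of consecutive qubits a Fourier state has linear phases
(`exists_fourier_extend`), so the inverse QFT of the window produces geometric sums
(`reversed_exactQFT_run_apply`). With `2 k` qubits, the leading `k` bits are wrong only if the
measured value misses the true phase by at least the distance of the trailing `k` bits from a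
multiple of `2 ^ k`; for a good `j` this is at least `2 ^ (k / 2)`, and the sum of the inverse
squares beyond it is `O(2 ^ (-k / 2))` (`phase_estimation_tail`, `sum_reversed_exactQFT_run_le`).
A union bound over the windows gives the error for one `j` (`norm_fpe_ket_sub_sq_le`). In a
superposition the error vectors for different `j` are orthogonal, because the untouched third copy
is in orthogonal Fourier states, so the squares of the errors add up (`norm_sum_fpe_sub_sq`,
`norm_fpe_sub_sq_le_bad`).

*The transform.* The error of `uqft` is that of `aqfs` and `fpe` (`norm_uqft_sub_sq_le`). After a
random shift every input is uniformly distributed, so the bad set contributes only its density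
(`card_bad_le`), and the shift is a phase after the transform (`qft_shift`), which the last part of
`pqft` cancels (`norm_pqft_sub_sq_le`). For precision `n ^ (-c)` the cut-off parameter is a multiple
of `log n` (`error_le_inv_pow`).
-/

namespace QFTCircuit

open Circuit

/-! ### Gates as linear isometries -/

theorem Gate.inv_inv {ι : Type} (g : Gate ι) : g.inv.inv = g := by cases g <;> rfl

theorem Gate.wires_inv {ι : Type} (g : Gate ι) : g.inv.wires = g.wires := by cases g <;> rfl

theorem Gate.wires_relabel {ι κ : Type} (f : ι → κ) (g : Gate ι) :
    (g.relabel f).wires = g.wires.map f := by cases g <;> rfl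

section Combinatorics

namespace Circuit

variable {ι κ : Type}

theorem reversed_append (C D : Circuit ι) : (C ++ D).reversed = D.reversed ++ C.reversed := by
  simp [reversed]

theorem flatten_reversed (C : Circuit ι) :
    C.reversed.flatten = (C.flatten.map Gate.inv).reverse := by
  induction C with
  | nil => rfl
  | cons s C ih =>
    have : reversed (s :: C) = reversed C ++ reversed [s] := reversed_append [s] C
    rw [this, List.flatten_append, ih]
    simp [reversed]

theorem reversed_reversed (C : Circuit ι) : C.reversed.reversed = C := by
  simp [reversed, Function.comp_def, List.map_map, ← List.map_reverse, Gate.inv_inv]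

end Circuit

end Combinatorics

section Basics

variable {ι κ : Type} [DecidableEq ι] [DecidableEq κ]

theorem norm_phase (k : ℕ) : ‖phase k‖ = 1 := by
  have : (2 * Real.pi * Complex.I / 2 ^ k : ℂ) = ((2 * Real.pi / 2 ^ k : ℝ) : ℂ) * Complex.I := by
    push_cast; ring
  rw [phase, this, Complex.norm_exp_ofReal_mul_I]

theorem phase_ne_zero (k : ℕ) : phase k ≠ 0 := Complex.exp_ne_zero _

theorem had_act_apply (w : ι) (ψ : State ι) (x : ι → Bool) :
    (Gate.had w).act ψ x =
      (ψ (Function.update x w false) + (if x w then -1 else 1) * ψ (Function.update x w true)) /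
        ((Real.sqrt 2 : ℝ) : ℂ) := rfl

/-- Every gate other than a Hadamard gate multiplies the amplitudes by phases that depend only on
the qubits of the gate. -/
theorem Gate.had_or_diagonal (g : Gate ι) : (∃ w, g = Gate.had w) ∨
    ∃ d : (ι → Bool) → ℂ, (∀ ψ x, g.act ψ x = d x * ψ x) ∧ (∀ ψ x, g.inv.act ψ x = (d x)⁻¹ * ψ x) ∧
      (∀ x w b, w ∉ g.wires → d (Function.update x w b) = d x) ∧ ∀ x, ‖d x‖ = 1 := by
  cases g with
  | had w => exact Or.inl ⟨w, rfl⟩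
  | rot k w =>
    refine Or.inr ⟨fun x => if x w then phase k else 1, fun _ _ => rfl, fun ψ x => ?_, ?_, ?_⟩
    · simp only [Gate.inv, Gate.act]; split_ifs <;> simp
    · intro x v b hv
      simp only [Gate.wires, List.mem_singleton] at hv
      simp only [Function.update_of_ne (Ne.symm hv)]
    · intro x; dsimp only; split_ifs <;> simp [norm_phase]
  | rotInv k w =>
    refine Or.inr ⟨fun x => if x w then (phase k)⁻¹ else 1, fun _ _ => rfl, fun ψ x => ?_, ?_, ?_⟩
    · simp only [Gate.inv, Gate.act]; split_ifs <;> simp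
    · intro x v b hv
      simp only [Gate.wires, List.mem_singleton] at hv
      simp only [Function.update_of_ne (Ne.symm hv)]
    · intro x; dsimp only; split_ifs <;> simp [norm_phase]
  | crot k c t =>
    refine Or.inr ⟨fun x => if x c && x t then phase k else 1, fun _ _ => rfl,
      fun ψ x => ?_, ?_, ?_⟩
    · simp only [Gate.inv, Gate.act]; split_ifs <;> simp
    · intro x v b hv
      simp only [Gate.wires, List.mem_cons, List.not_mem_nil, or_false, not_or] at hv
      simp only [Function.update_of_ne (Ne.symm hv.1), Function.update_of_ne (Ne.symm hv.2)]
    · intro x; dsimp only; split_ifs <;> simp [norm_phase]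
  | crotInv k c t =>
    refine Or.inr ⟨fun x => if x c && x t then (phase k)⁻¹ else 1, fun _ _ => rfl,
      fun ψ x => ?_, ?_, ?_⟩
    · simp only [Gate.inv, Gate.act]; split_ifs <;> simp
    · intro x v b hv
      simp only [Gate.wires, List.mem_cons, List.not_mem_nil, or_false, not_or] at hv
      simp only [Function.update_of_ne (Ne.symm hv.1), Function.update_of_ne (Ne.symm hv.2)]
    · intro x; dsimp only; split_ifs <;> simp [norm_phase]

theorem Gate.act_add (g : Gate ι) (ψ φ : State ι) : g.act (ψ + φ) = g.act ψ + g.act φ := by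
  rcases g.had_or_diagonal with ⟨w, rfl⟩ | ⟨d, hd, -, -, -⟩
  · ext x; simp only [had_act_apply, PiLp.add_apply]; ring
  · ext x; simp only [hd, PiLp.add_apply]; ring

theorem Gate.act_smul (g : Gate ι) (c : ℂ) (ψ : State ι) : g.act (c • ψ) = c • g.act ψ := by
  rcases g.had_or_diagonal with ⟨w, rfl⟩ | ⟨d, hd, -, -, -⟩
  · ext x; simp only [had_act_apply, PiLp.smul_apply, smul_eq_mul]; ring
  · ext x; simp only [hd, PiLp.smul_apply, smul_eq_mul]; ring

theorem sqrt_two_sq : ((Real.sqrt 2 : ℝ) : ℂ) * ((Real.sqrt 2 : ℝ) : ℂ) = 2 := by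
  rw [← Complex.ofReal_mul, Real.mul_self_sqrt (by norm_num)]; norm_num

theorem sqrt_two_ne : ((Real.sqrt 2 : ℝ) : ℂ) ≠ 0 := by
  simp

theorem Gate.inv_act (g : Gate ι) (ψ : State ι) : g.inv.act (g.act ψ) = ψ := by
  rcases g.had_or_diagonal with ⟨w, rfl⟩ | ⟨d, hd, hd', -, h1⟩
  · ext x
    have h2 := sqrt_two_sq
    have h3 := sqrt_two_ne
    simp only [Gate.inv, had_act_apply, Function.update_self, Function.update_idem]
    field_simp
    have hx : ∀ b, x w = b → Function.update x w b = x := fun b hb => by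
      rw [← hb, Function.update_eq_self]
    cases hb : x w
    · rw [hx _ hb]; simp; linear_combination (-ψ x) * h2
    · rw [hx _ hb]; simp; linear_combination (-ψ x) * h2
  · ext x
    have : d x ≠ 0 := fun h => by simpa [h] using h1 x
    rw [hd', hd, inv_mul_cancel_left₀ this]

/-- Flipping one bit. -/
def flipEquiv (w : ι) : (ι → Bool) ≃ (ι → Bool) where
  toFun x := Function.update x w (!x w)
  invFun x := Function.update x w (!x w)
  left_inv x := by simp
  right_inv x := by simp

theorem Gate.norm_act [Fintype ι] (g : Gate ι) (ψ : State ι) : ‖g.act ψ‖ = ‖ψ‖ := by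
  rcases g.had_or_diagonal with ⟨w, rfl⟩ | ⟨d, hd, -, -, h1⟩
  · rw [EuclideanSpace.norm_eq, EuclideanSpace.norm_eq]
    congr 1
    have key : ∀ x, ‖(Gate.had w).act ψ x‖ ^ 2 + ‖(Gate.had w).act ψ (flipEquiv w x)‖ ^ 2 =
        ‖ψ x‖ ^ 2 + ‖ψ (flipEquiv w x)‖ ^ 2 := by
      intro x
      have par : ∀ a b : ℂ, ‖(a + b) / ((Real.sqrt 2 : ℝ) : ℂ)‖ ^ 2 +
          ‖(a - b) / ((Real.sqrt 2 : ℝ) : ℂ)‖ ^ 2 = ‖a‖ ^ 2 + ‖b‖ ^ 2 := by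
        intro a b
        have := parallelogram_law_with_norm ℝ a b
        rw [norm_div, norm_div, Complex.norm_real, Real.norm_of_nonneg (Real.sqrt_nonneg 2),
          div_pow, div_pow, Real.sq_sqrt (by norm_num)]
        nlinarith [this]
      have hx : ∀ b, x w = b → Function.update x w b = x := fun b hb => by
        rw [← hb, Function.update_eq_self]
      simp only [flipEquiv, Equiv.coe_fn_mk, had_act_apply, Function.update_self,
        Function.update_idem]
      cases hb : x w
      · rw [hx _ hb]
        simpa [sub_eq_add_neg] using par (ψ x) (ψ (Function.update x w true))
      · rw [hx _ hb]
        have := par (ψ (Function.update x w false)) (ψ x)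
        simp only [if_true, Bool.not_true, Bool.false_eq_true, if_false, one_mul, neg_mul,
          ← sub_eq_add_neg]
        linarith
    have h2 : ∀ f : (ι → Bool) → ℝ, ∑ x, f (flipEquiv w x) = ∑ x, f x :=
      fun f => Equiv.sum_comp (flipEquiv w) f
    have h3 := Finset.sum_congr (rfl : (Finset.univ : Finset (ι → Bool)) = _) fun x _ => key x
    rw [Finset.sum_add_distrib, Finset.sum_add_distrib,
      h2 fun x => ‖(Gate.had w).act ψ x‖ ^ 2, h2 fun x => ‖ψ x‖ ^ 2] at h3
    linarith
  · rw [EuclideanSpace.norm_eq, EuclideanSpace.norm_eq]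
    simp only [hd, norm_mul, h1, one_mul]

/-- A gate multiplies by functions of the other qubits like a scalar. -/
theorem Gate.act_mul (g : Gate ι) (h : (ι → Bool) → ℂ)
    (hh : ∀ w ∈ g.wires, ∀ x b, h (Function.update x w b) = h x) (ψ φ : State ι)
    (hφ : ∀ x, φ x = h x * ψ x) (x : ι → Bool) : g.act φ x = h x * g.act ψ x := by
  rcases g.had_or_diagonal with ⟨w, rfl⟩ | ⟨d, hd, -, -, h1⟩
  · have := hh w (by simp [Gate.wires])
    simp only [had_act_apply, hφ, this]; ring
  · rw [hd, hd, hφ]; ring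

/-- Gates on disjoint sets of qubits commute. -/
theorem Gate.act_comm (g h : Gate ι) (hgh : ∀ w ∈ g.wires, w ∉ h.wires) (ψ : State ι) :
    g.act (h.act ψ) = h.act (g.act ψ) := by
  rcases g.had_or_diagonal with ⟨w, rfl⟩ | ⟨d, hd, -, hdw, -⟩
  · rcases h.had_or_diagonal with ⟨v, rfl⟩ | ⟨d', hd', -, hdw', -⟩
    · have hwv : w ≠ v := fun h => hgh w (by simp [Gate.wires]) (by simp [Gate.wires, h])
      ext x
      simp only [had_act_apply, Function.update_of_ne hwv, Function.update_of_ne hwv.symm,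
        Function.update_comm hwv]
      ring
    · ext x
      rw [Gate.act_mul (Gate.had w) d' _ ψ (h.act ψ) (hd' ψ) x, hd']
      intro v hv x b
      exact hdw' x v b (hgh v hv)
  · ext x
    rw [hd, Gate.act_mul h d _ ψ (g.act ψ) (hd ψ) x]
    intro v hv x b
    exact hdw x v b fun h' => hgh v h' hv

/-! ### Runs of circuits -/

/-- The action of a list of gates, the first gate acting first. -/
noncomputable def acts (l : List (Gate ι)) (ψ : State ι) : State ι := l.foldl (fun φ g => g.act φ) ψ

@[simp] theorem acts_nil (ψ : State ι) : acts [] ψ = ψ := rfl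
@[simp] theorem acts_cons (g : Gate ι) (l) (ψ : State ι) : acts (g :: l) ψ = acts l (g.act ψ) := rfl
theorem acts_append (l m : List (Gate ι)) (ψ : State ι) : acts (l ++ m) ψ = acts m (acts l ψ) :=
  List.foldl_append

namespace Circuit

theorem run_eq_acts (C : Circuit ι) (ψ : State ι) : C.run ψ = acts C.flatten ψ := rfl

@[simp] theorem run_nil (ψ : State ι) : run ([] : Circuit ι) ψ = ψ := rfl

theorem run_cons (s : List (Gate ι)) (C : Circuit ι) (ψ : State ι) :
    run (s :: C) ψ = C.run (acts s ψ) := by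
  rw [run_eq_acts, List.flatten_cons, acts_append, run_eq_acts]

theorem run_append (C D : Circuit ι) (ψ : State ι) : (C ++ D).run ψ = D.run (C.run ψ) := by
  rw [run_eq_acts, List.flatten_append, acts_append, run_eq_acts, run_eq_acts]

end Circuit

theorem acts_inv (l : List (Gate ι)) (ψ : State ι) :
    acts (l.map Gate.inv).reverse (acts l ψ) = ψ := by
  induction l generalizing ψ with
  | nil => rfl
  | cons g l ih =>
    rw [List.map_cons, List.reverse_cons, acts_append, acts_cons g l, ih]
    exact g.inv_act ψ

namespace Circuit

theorem reversed_run (C : Circuit ι) (ψ : State ι) : C.reversed.run (C.run ψ) = ψ := by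
  rw [run_eq_acts, flatten_reversed, run_eq_acts, acts_inv]

theorem run_reversed (C : Circuit ι) (ψ : State ι) : C.run (C.reversed.run ψ) = ψ := by
  have := C.reversed.reversed_run ψ
  rwa [reversed_reversed] at this

theorem reversed_run_eq_iff (C : Circuit ι) (ψ φ : State ι) :
    C.reversed.run φ = ψ ↔ C.run ψ = φ :=
  ⟨fun h => by rw [← h, run_reversed], fun h => by rw [← h, reversed_run]⟩

theorem run_add (C : Circuit ι) (ψ φ : State ι) : C.run (ψ + φ) = C.run ψ + C.run φ := by
  simp only [run_eq_acts]
  induction C.flatten generalizing ψ φ with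
  | nil => rfl
  | cons g l ih => rw [acts_cons, acts_cons, acts_cons, g.act_add, ih]

theorem run_smul (C : Circuit ι) (c : ℂ) (ψ : State ι) : C.run (c • ψ) = c • C.run ψ := by
  simp only [run_eq_acts]
  induction C.flatten generalizing ψ with
  | nil => rfl
  | cons g l ih => rw [acts_cons, acts_cons, g.act_smul, ih]

variable [Fintype ι]

theorem norm_run (C : Circuit ι) (ψ : State ι) : ‖C.run ψ‖ = ‖ψ‖ := by
  simp only [run_eq_acts]
  induction C.flatten generalizing ψ with
  | nil => rfl
  | cons g l ih => rw [acts_cons, ih, g.norm_act]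

/-- The action of a circuit, as a linear isometry. -/
noncomputable def runIso (C : Circuit ι) : State ι →ₗᵢ[ℂ] State ι where
  toFun := C.run
  map_add' := C.run_add
  map_smul' := C.run_smul
  norm_map' := C.norm_run

theorem run_sub (C : Circuit ι) (ψ φ : State ι) : C.run (ψ - φ) = C.run ψ - C.run φ :=
  map_sub C.runIso ψ φ

theorem run_sum {τ : Type*} (C : Circuit ι) (s : Finset τ) (f : τ → State ι) :
    C.run (∑ i ∈ s, f i) = ∑ i ∈ s, C.run (f i) :=
  map_sum C.runIso f s

theorem inner_run (C : Circuit ι) (ψ φ : State ι) :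
    inner ℂ (C.run ψ) (C.run φ) = inner ℂ ψ φ :=
  C.runIso.inner_map_map ψ φ

end Circuit
end Basics

/-! ### Circuits confined to a set of qubits, resources -/

namespace Circuit

section Resources

variable {ι κ : Type} {τ : Type*}

/-- All gates of the circuit act on qubits of the set `s`. -/
def On (C : Circuit ι) (s : Set ι) : Prop := ∀ t ∈ C, ∀ g ∈ t, ∀ w ∈ Gate.wires g, w ∈ s

theorem On.mono {C : Circuit ι} {s t : Set ι} (h : C.On s) (hst : s ⊆ t) : C.On t :=
  fun u hu g hg w hw => hst (h u hu g hg w hw)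

theorem on_univ (C : Circuit ι) : C.On Set.univ := fun _ _ _ _ _ _ => trivial

theorem on_nil (s : Set ι) : On ([] : Circuit ι) s := by simp [On]

theorem On.append {C D : Circuit ι} {s : Set ι} (hC : C.On s) (hD : D.On s) : (C ++ D).On s := by
  intro t ht
  rcases List.mem_append.1 ht with h | h
  exacts [hC t h, hD t h]

theorem On.reversed {C : Circuit ι} {s : Set ι} (hC : C.On s) : C.reversed.On s := by
  intro t ht g hg w hw
  simp only [Circuit.reversed, List.mem_map, List.mem_reverse] at ht
  obtain ⟨u, hu, rfl⟩ := ht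
  simp only [List.mem_map, List.mem_reverse] at hg
  obtain ⟨g, hg, rfl⟩ := hg
  rw [Gate.wires_inv] at hw
  exact hC u hu g hg w hw

theorem On.relabel {C : Circuit ι} {s : Set ι} (hC : C.On s) (f : ι → κ) :
    (C.relabel f).On (f '' s) := by
  intro t ht g hg w hw
  simp only [Circuit.relabel, List.mem_map] at ht
  obtain ⟨u, hu, rfl⟩ := ht
  simp only [List.mem_map] at hg
  obtain ⟨g, hg, rfl⟩ := hg
  rw [Gate.wires_relabel, List.mem_map] at hw
  obtain ⟨v, hv, rfl⟩ := hw
  exact ⟨v, hC u hu g hg v hv, rfl⟩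

theorem relabel_on_range (C : Circuit ι) (f : ι → κ) : (C.relabel f).On (Set.range f) := by
  simpa using C.on_univ.relabel f

theorem On.par {C D : Circuit ι} {s : Set ι} (hC : C.On s) (hD : D.On s) : (par C D).On s := by
  induction C generalizing D with
  | nil => exact hD
  | cons a C ih =>
    cases D with
    | nil => exact hC
    | cons b D =>
      have hC' : On C s := fun t ht => hC t (List.mem_cons_of_mem _ ht)
      have hD' : On D s := fun t ht => hD t (List.mem_cons_of_mem _ ht)
      intro t ht
      rcases List.mem_cons.1 ht with rfl | ht
      · intro g hg
        rcases List.mem_append.1 hg with h | h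
        exacts [hC a List.mem_cons_self g h, hD b List.mem_cons_self g h]
      · exact ih hC' hD' t ht

theorem WellFormed.append {C D : Circuit ι} (hC : C.WellFormed) (hD : D.WellFormed) :
    (C ++ D).WellFormed := by
  intro t ht
  rcases List.mem_append.1 ht with h | h
  exacts [hC t h, hD t h]

theorem WellFormed.reversed {C : Circuit ι} (hC : C.WellFormed) : C.reversed.WellFormed := by
  intro t ht
  simp only [Circuit.reversed, List.mem_map, List.mem_reverse] at ht
  obtain ⟨u, hu, rfl⟩ := ht
  have h : (u.reverse.map Gate.inv).flatMap Gate.wires = u.reverse.flatMap Gate.wires := by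
    rw [List.flatMap_map]; simp only [Gate.wires_inv]
  rw [h]
  exact ((List.reverse_perm u).flatMap_right Gate.wires).nodup_iff.2 (hC u hu)

theorem WellFormed.relabel {C : Circuit ι} (hC : C.WellFormed) {f : ι → κ}
    (hf : Function.Injective f) : (C.relabel f).WellFormed := by
  intro t ht
  simp only [Circuit.relabel, List.mem_map] at ht
  obtain ⟨u, hu, rfl⟩ := ht
  have h : (u.map (Gate.relabel f)).flatMap Gate.wires = (u.flatMap Gate.wires).map f := by
    rw [List.flatMap_map, List.map_flatMap]; simp only [Gate.wires_relabel]
  rw [h]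
  exact (hC u hu).map hf

theorem WellFormed.par {C D : Circuit ι} {s t : Set ι} (hC : C.WellFormed) (hD : D.WellFormed)
    (hCs : C.On s) (hDt : D.On t) (hst : Disjoint s t) : (par C D).WellFormed := by
  induction C generalizing D with
  | nil => exact hD
  | cons a C ih =>
    cases D with
    | nil => exact hC
    | cons b D =>
      intro u hu
      rcases List.mem_cons.1 hu with rfl | hu
      · rw [List.flatMap_append]
        refine List.Nodup.append (hC a List.mem_cons_self) (hD b List.mem_cons_self) ?_
        intro w hw hw'
        obtain ⟨g, hg, hw⟩ := List.mem_flatMap.1 hw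
        obtain ⟨g', hg', hw'⟩ := List.mem_flatMap.1 hw'
        exact Set.disjoint_left.1 hst (hCs a List.mem_cons_self g hg w hw)
          (hDt b List.mem_cons_self g' hg' w hw')
      · exact ih (fun t ht => hC t (List.mem_cons_of_mem _ ht))
          (fun t ht => hD t (List.mem_cons_of_mem _ ht))
          (fun t ht => hCs t (List.mem_cons_of_mem _ ht))
          (fun t ht => hDt t (List.mem_cons_of_mem _ ht)) u hu

@[simp] theorem size_nil : size ([] : Circuit ι) = 0 := rfl

@[simp] theorem size_append (C D : Circuit ι) : (C ++ D).size = C.size + D.size := by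
  simp [size]

@[simp] theorem size_reversed (C : Circuit ι) : C.reversed.size = C.size := by
  simp only [size, reversed, List.map_map, List.map_reverse, List.sum_reverse]
  congr 1
  exact List.map_congr_left fun s _ => by simp

@[simp] theorem size_relabel (f : ι → κ) (C : Circuit ι) : (C.relabel f).size = C.size := by
  simp only [size, relabel, List.map_map]
  congr 1
  exact List.map_congr_left fun s _ => by simp

theorem size_par (C D : Circuit ι) : (par C D).size = C.size + D.size := by
  induction C generalizing D with
  | nil => simp [par]
  | cons a C ih =>
    cases D with
    | nil => simp [par]
    | cons b D =>
      have := ih D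
      simp only [size] at this
      simp only [par, size, List.map_cons, List.sum_cons, List.length_append, this]
      omega

@[simp] theorem depth_append (C D : Circuit ι) : (C ++ D).depth = C.depth + D.depth := by
  simp [depth]

@[simp] theorem depth_reversed (C : Circuit ι) : C.reversed.depth = C.depth := by
  simp [depth, reversed]

@[simp] theorem depth_relabel (f : ι → κ) (C : Circuit ι) : (C.relabel f).depth = C.depth := by
  simp [depth, relabel]

theorem depth_par (C D : Circuit ι) : (par C D).depth = max C.depth D.depth := by
  induction C generalizing D with
  | nil => simp [par, depth]
  | cons a C ih =>
    cases D with
    | nil => simp [par, depth]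
    | cons b D =>
      have := ih D
      simp only [depth] at this
      simp only [par, depth, List.length_cons, this]
      omega

theorem relabel_par (f : ι → κ) (C D : Circuit ι) :
    (par C D).relabel f = par (C.relabel f) (D.relabel f) := by
  induction C generalizing D with
  | nil => rfl
  | cons a C ih =>
    cases D with
    | nil => rfl
    | cons b D =>
      have := ih D
      simp only [relabel] at this
      simp only [par, relabel, List.map_cons, List.map_append, this]

theorem relabel_relabel {μ : Type} (f : ι → κ) (g : κ → μ) (C : Circuit ι) :
    (C.relabel f).relabel g = C.relabel (g ∘ f) := by
  have : (Gate.relabel g ∘ Gate.relabel f : Gate ι → Gate μ) = Gate.relabel (g ∘ f) := by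
    funext x; cases x <;> rfl
  simp only [relabel, List.map_map]
  refine List.map_congr_left fun s _ => ?_
  rw [Function.comp_apply, List.map_map, this]

theorem relabel_reversed (f : ι → κ) (C : Circuit ι) :
    (C.relabel f).reversed = C.reversed.relabel f := by
  have : (Gate.inv ∘ Gate.relabel f : Gate ι → Gate κ) = Gate.relabel f ∘ Gate.inv := by
    funext x; cases x <;> rfl
  simp only [relabel, reversed, List.map_map, ← List.map_reverse]
  refine List.map_congr_left fun s _ => ?_
  simp only [Function.comp_apply, ← List.map_reverse, List.map_map, this]

theorem On.mem_flatten {C : Circuit ι} {s : Set ι} (hC : C.On s) {g : Gate ι}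
    (hg : g ∈ C.flatten) {w : ι} (hw : w ∈ g.wires) : w ∈ s := by
  obtain ⟨t, ht, hg⟩ := List.mem_flatten.1 hg
  exact hC t ht g hg w hw

/-- The state of the qubits `f i` if the other qubits are fixed to their values in `z`. -/
noncomputable def slice (f : ι → κ) (Ψ : State κ) (z : κ → Bool) : State ι :=
  WithLp.toLp 2 fun x => Ψ (Function.extend f x z)

theorem slice_apply (f : ι → κ) (Ψ : State κ) (z : κ → Bool) (x : ι → Bool) :
    slice f Ψ z x = Ψ (Function.extend f x z) := rfl

theorem slice_extend {f : ι → κ} (hf : Function.Injective f) (Ψ : State κ) (x : ι → Bool)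
    (z : κ → Bool) : slice f Ψ (Function.extend f x z) = slice f Ψ z := by
  ext y
  rw [slice_apply, slice_apply]
  refine congrArg Ψ (funext fun v => ?_)
  by_cases hv : ∃ i, f i = v
  · obtain ⟨i, rfl⟩ := hv; simp [hf.extend_apply]
  · simp [Function.extend_apply' _ _ _ hv]

theorem extend_comp_self {f : ι → κ} (hf : Function.Injective f) (z : κ → Bool) :
    Function.extend f (z ∘ f) z = z := by
  funext v
  by_cases hv : ∃ i, f i = v
  · obtain ⟨i, rfl⟩ := hv
    rw [hf.extend_apply, Function.comp_apply]
  · rw [Function.extend_apply' _ _ _ hv]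

theorem on_foldr_par {E : Circuit ι} {u : Set ι} (hE : E.On u) (l : List τ) (f : τ → Circuit ι)
    (hf : ∀ i ∈ l, (f i).On u) : ((l.map f).foldr par E).On u := by
  induction l with
  | nil => exact hE
  | cons i l ih =>
    exact (hf i List.mem_cons_self).par (ih fun j hj => hf j (List.mem_cons_of_mem _ hj))

theorem wellFormed_foldr_par (l : List τ) (hl : l.Nodup) (f : τ → Circuit ι)
    (s : τ → Set ι) (hf : ∀ i ∈ l, (f i).WellFormed) (hs : ∀ i ∈ l, (f i).On (s i))
    (hd : ∀ i ∈ l, ∀ j ∈ l, i ≠ j → Disjoint (s i) (s j)) :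
    ((l.map f).foldr par []).WellFormed := by
  induction l with
  | nil => simp [WellFormed]
  | cons i l ih =>
    rw [List.nodup_cons] at hl
    refine WellFormed.par (s := s i) (t := ⋃ j ∈ l, s j) (hf i List.mem_cons_self)
      (ih hl.2 (fun j hj => hf j (List.mem_cons_of_mem _ hj))
        (fun j hj => hs j (List.mem_cons_of_mem _ hj))
        (fun j hj k hk => hd j (List.mem_cons_of_mem _ hj) k (List.mem_cons_of_mem _ hk)))
      (hs i List.mem_cons_self)
      (on_foldr_par (on_nil _) l f fun j hj =>
        (hs j (List.mem_cons_of_mem _ hj)).mono (Set.subset_biUnion_of_mem (u := s) hj)) ?_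
    rw [Set.disjoint_iUnion₂_right]
    exact fun j hj => hd i List.mem_cons_self j (List.mem_cons_of_mem _ hj)
      fun h => hl.1 (h ▸ hj)

theorem size_foldr_par (l : List τ) (f : τ → Circuit ι) :
    ((l.map f).foldr par []).size = (l.map fun i => (f i).size).sum := by
  induction l with
  | nil => rfl
  | cons i l ih => simp [size_par, ih]

theorem depth_foldr_par_le (l : List τ) (f : τ → Circuit ι) (d : ℕ)
    (hd : ∀ i ∈ l, (f i).depth ≤ d) : ((l.map f).foldr par []).depth ≤ d := by
  induction l with
  | nil => simp [depth]
  | cons i l ih =>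
    simp only [List.map_cons, List.foldr_cons, depth_par]
    exact max_le (hd i List.mem_cons_self) (ih fun j hj => hd j (List.mem_cons_of_mem _ hj))

end Resources

/-! ### Runs of circuits on disjoint sets of qubits -/

section Runs

variable {ι κ : Type} {τ : Type*} [DecidableEq ι] [DecidableEq κ]

theorem acts_comm (l m : List (Gate ι))
    (h : ∀ g ∈ l, ∀ g' ∈ m, ∀ w ∈ g.wires, w ∉ g'.wires) (ψ : State ι) :
    acts l (acts m ψ) = acts m (acts l ψ) := by
  have one : ∀ (g : Gate ι) (m : List (Gate ι)), (∀ g' ∈ m, ∀ w ∈ g.wires, w ∉ g'.wires) →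
      ∀ ψ, g.act (acts m ψ) = acts m (g.act ψ) := by
    intro g m hm
    induction m with
    | nil => intro ψ; rfl
    | cons a m ih =>
      intro ψ
      rw [acts_cons, acts_cons, ih fun g' hg' => hm g' (List.mem_cons_of_mem _ hg'),
        Gate.act_comm g a (hm a List.mem_cons_self)]
  induction l generalizing ψ with
  | nil => rfl
  | cons g l ih =>
    rw [acts_cons, acts_cons, one g m (h g List.mem_cons_self),
      ih fun g' hg' => h g' (List.mem_cons_of_mem _ hg')]

/-- Circuits on disjoint sets of qubits commute. -/
theorem run_comm {C D : Circuit ι} {s t : Set ι} (hC : C.On s) (hD : D.On t)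
    (hst : Disjoint s t) (ψ : State ι) : C.run (D.run ψ) = D.run (C.run ψ) :=
  acts_comm _ _ (fun _ hg _ hg' _ hw hw' =>
    Set.disjoint_left.1 hst (hC.mem_flatten hg hw) (hD.mem_flatten hg' hw')) ψ

/-- Stages run side by side may as well be run one circuit after the other. -/
theorem run_par {C D : Circuit ι} {s t : Set ι} (hC : C.On s) (hD : D.On t)
    (hst : Disjoint s t) (ψ : State ι) : (par C D).run ψ = D.run (C.run ψ) := by
  induction C generalizing D ψ with
  | nil => rfl
  | cons a C ih =>
    cases D with
    | nil => rfl
    | cons b D =>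
      have hC' : On C s := fun t ht => hC t (List.mem_cons_of_mem _ ht)
      have hD' : On D t := fun t ht => hD t (List.mem_cons_of_mem _ ht)
      have hb : On [b] t := fun u hu => by
        rw [List.mem_singleton.1 hu]; exact hD b List.mem_cons_self
      have := run_comm hC' hb hst (acts a ψ)
      rw [run_cons, run_cons, run_nil, run_nil] at this
      rw [par, run_cons, acts_append, ih hC' hD', run_cons, run_cons, this]

theorem run_foldr_par {E : Circuit ι} (hE : E.flatten = []) (l : List τ) (hl : l.Nodup)
    (f : τ → Circuit ι) (s : τ → Set ι) (hs : ∀ i ∈ l, (f i).On (s i))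
    (hd : ∀ i ∈ l, ∀ j ∈ l, i ≠ j → Disjoint (s i) (s j)) (ψ : State ι) :
    ((l.map f).foldr par E).run ψ = run (l.map f).flatten ψ := by
  induction l generalizing ψ with
  | nil =>
    simp [run_eq_acts, hE]
  | cons i l ih =>
    rw [List.nodup_cons] at hl
    have hEu : ∀ u, E.On u := fun u t ht g hg => by
      have : g ∈ E.flatten := List.mem_flatten.2 ⟨t, ht, hg⟩
      simp [hE] at this
    rw [List.map_cons, List.foldr_cons, List.flatten_cons, run_append,
      run_par (hs i List.mem_cons_self)
      (on_foldr_par (hEu _) l f fun j hj =>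
        (hs j (List.mem_cons_of_mem _ hj)).mono (Set.subset_biUnion_of_mem (u := s) hj)),
      ih hl.2 (fun j hj => hs j (List.mem_cons_of_mem _ hj))
        (fun j hj k hk => hd j (List.mem_cons_of_mem _ hj) k (List.mem_cons_of_mem _ hk))]
    rw [Set.disjoint_iUnion₂_right]
    exact fun j hj => hd i List.mem_cons_self j (List.mem_cons_of_mem _ hj)
      fun h => hl.1 (h ▸ hj)

/-- In a parallel composition, any one of the circuits can be run last. -/
theorem exists_run_foldr_par (l : List τ) (hl : l.Nodup) (f : τ → Circuit ι) (s : τ → Set ι)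
    (hs : ∀ i ∈ l, (f i).On (s i)) (hd : ∀ i ∈ l, ∀ j ∈ l, i ≠ j → Disjoint (s i) (s j))
    {i : τ} (hi : i ∈ l) :
    ∃ D : Circuit ι, D.On (s i)ᶜ ∧ ∀ ψ, ((l.map f).foldr par []).run ψ = (f i).run (D.run ψ) := by
  obtain ⟨l₁, l₂, rfl⟩ := List.append_of_mem hi
  have hni : ∀ j, j ∈ l₁ ∨ j ∈ l₂ → i ≠ j := by
    rintro j hj rfl
    have := List.nodup_middle.1 hl
    rw [List.nodup_cons, List.mem_append] at this
    exact this.1 hj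
  have on : ∀ m : List τ, (∀ j ∈ m, j ∈ l₁ ∨ j ∈ l₂) → On (m.map f).flatten (s i)ᶜ := by
    intro m hm t ht
    obtain ⟨c, hc, ht⟩ := List.mem_flatten.1 ht
    obtain ⟨j, hj, rfl⟩ := List.mem_map.1 hc
    have hj' : j ∈ l₁ ++ i :: l₂ := by
      rcases hm j hj with h | h <;> simp [h]
    exact ((hs j hj').mono
      (Set.disjoint_left.1 (hd j hj' i hi (hni j (hm j hj)).symm))) t ht
  refine ⟨(l₁.map f).flatten ++ (l₂.map f).flatten,
    (on l₁ fun j hj => Or.inl hj).append (on l₂ fun j hj => Or.inr hj), fun ψ => ?_⟩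
  rw [run_foldr_par (E := []) rfl _ hl f s hs hd, List.map_append, List.flatten_append,
    List.map_cons,
    List.flatten_cons, run_append, run_append, run_append,
    run_comm (hs i hi) (on l₂ fun j hj => Or.inr hj) disjoint_compl_right]

/-- A circuit treats functions of the qubits that it does not touch as scalars. -/
theorem run_mul {C : Circuit ι} {s : Set ι} (hC : C.On s) (h : (ι → Bool) → ℂ)
    (hh : ∀ w ∈ s, ∀ x b, h (Function.update x w b) = h x) {ψ φ : State ι}
    (hφ : ∀ x, φ x = h x * ψ x) (x : ι → Bool) : C.run φ x = h x * C.run ψ x := by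
  have key : ∀ l : List (Gate ι), (∀ g ∈ l, ∀ w ∈ g.wires, w ∈ s) → ∀ ψ φ : State ι,
      (∀ x, φ x = h x * ψ x) → ∀ x, acts l φ x = h x * acts l ψ x := by
    intro l
    induction l with
    | nil => intro _ ψ φ hφ; exact hφ
    | cons g l ih =>
      intro hl ψ φ hφ
      exact ih (fun g' hg' => hl g' (List.mem_cons_of_mem _ hg')) _ _
        (g.act_mul h (fun w hw => hh w (hl g List.mem_cons_self w hw)) ψ φ hφ)
  exact key _ (fun g hg w hw => hC.mem_flatten hg hw) ψ φ hφ x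

/-! ### Circuits placed on a part of the qubits -/

theorem extend_update {f : ι → κ} (hf : Function.Injective f) (x : ι → Bool) (z : κ → Bool)
    (w : ι) (b : Bool) :
    Function.extend f (Function.update x w b) z =
      Function.update (Function.extend f x z) (f w) b := by
  funext v
  by_cases hv : ∃ i, f i = v
  · obtain ⟨i, rfl⟩ := hv
    rw [hf.extend_apply]
    by_cases hi : i = w
    · subst hi; simp
    · rw [Function.update_of_ne hi, Function.update_of_ne (hf.ne hi), hf.extend_apply]
  · rw [Function.extend_apply' _ _ _ hv, Function.update_of_ne, Function.extend_apply' _ _ _ hv]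
    rintro rfl
    exact hv ⟨w, rfl⟩

theorem slice_act {f : ι → κ} (hf : Function.Injective f) (g : Gate ι) (Ψ : State κ)
    (z : κ → Bool) : slice f ((g.relabel f).act Ψ) z = g.act (slice f Ψ z) := by
  ext x
  cases g <;> simp only [slice_apply, Gate.relabel, Gate.act, extend_update hf, hf.extend_apply]

/-- A placed circuit acts on each slice separately, and there as the original circuit. -/
theorem slice_run {f : ι → κ} (hf : Function.Injective f) (C : Circuit ι) (Ψ : State κ)
    (z : κ → Bool) : slice f ((C.relabel f).run Ψ) z = C.run (slice f Ψ z) := by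
  have h : (C.relabel f).flatten = C.flatten.map (Gate.relabel f) := by
    simp [relabel, List.map_flatten]
  rw [run_eq_acts, run_eq_acts, h]
  induction C.flatten generalizing Ψ with
  | nil => rfl
  | cons g l ih => rw [List.map_cons, acts_cons, acts_cons, ih, slice_act hf]

theorem run_relabel_apply {f : ι → κ} (hf : Function.Injective f) (C : Circuit ι) (Ψ : State κ)
    (z : κ → Bool) : (C.relabel f).run Ψ z = C.run (slice f Ψ z) (z ∘ f) := by
  rw [← slice_run hf, slice_apply, extend_comp_self hf]

/-- To evaluate a placed circuit at `z`, it is enough to know the input up to a factor on the slice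
through `z`; the input need not be a product state globally. -/
theorem run_relabel_apply_of_slice {f : ι → κ} (hf : Function.Injective f) (C : Circuit ι)
    {Ψ : State κ} {z : κ → Bool} {c : ℂ} {φ : State ι}
    (h : ∀ x, Ψ (Function.extend f x z) = c * φ x) :
    (C.relabel f).run Ψ z = c * C.run φ (z ∘ f) := by
  have : slice f Ψ z = c • φ := by
    ext x; rw [slice_apply, h]; rfl
  rw [run_relabel_apply hf, this, run_smul]; rfl

/-- The assignments of all qubits and of a part of them, with the values on that part exchanged. -/
noncomputable def exchangeEquiv {f : ι → κ} (hf : Function.Injective f) :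
    ((κ → Bool) × (ι → Bool)) ≃ ((κ → Bool) × (ι → Bool)) where
  toFun p := (Function.extend f p.2 p.1, p.1 ∘ f)
  invFun p := (Function.extend f p.2 p.1, p.1 ∘ f)
  left_inv p := by
    refine Prod.ext ?_ ?_
    · funext v
      by_cases hv : ∃ i, f i = v
      · obtain ⟨i, rfl⟩ := hv; simp [hf.extend_apply]
      · simp [Function.extend_apply' _ _ _ hv]
    · funext i; simp [hf.extend_apply]
  right_inv p := by
    refine Prod.ext ?_ ?_
    · funext v
      by_cases hv : ∃ i, f i = v
      · obtain ⟨i, rfl⟩ := hv; simp [hf.extend_apply]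
      · simp [Function.extend_apply' _ _ _ hv]
    · funext i; simp [hf.extend_apply]

/-- Exchanging the values on the range of `f` with a separate assignment of them permutes the
pairs `(z, x)`. With this, norms and probabilities are computed slice by slice. -/
theorem sum_extend [Fintype ι] [Fintype κ] {f : ι → κ} (hf : Function.Injective f)
    (F : (κ → Bool) → (ι → Bool) → ℝ) :
    ∑ z, ∑ x, F (Function.extend f x z) (z ∘ f) = ∑ z, ∑ x, F z x := by
  rw [← Fintype.sum_prod_type', ← Fintype.sum_prod_type']
  exact Equiv.sum_comp (exchangeEquiv hf) fun p => F p.1 p.2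

end Runs

/-! ### Reversible classical circuits -/

section ClassicalCircuits

variable {ι : Type}

/-- Gates performed one after the other need only be well formed each for itself. -/
theorem singleton_stages_wellFormed (l : List (Gate ι)) (hl : ∀ g ∈ l, g.wires.Nodup) :
    WellFormed (l.map fun g => [g]) := by
  intro s hs
  obtain ⟨g, hg, rfl⟩ := List.mem_map.1 hs
  simpa using hl g hg

/-- Negation of the qubit `w`. -/
def notC (w : ι) : Circuit ι := [.had w, .rot 1 w, .had w].map fun g => [g]

/-- Negation of the qubit `t` controlled by the qubit `c`. -/
def cnotC (c t : ι) : Circuit ι := [.had t, .crot 1 c t, .had t].map fun g => [g]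

/-- The Toffoli gate with controls `a`, `b` and target `t`. It rests on the identity
`i ^ (a c + b c - (a ⊕ b) c) = (-1) ^ (a b c)` for bits. -/
def tof (a b t : ι) : Circuit ι :=
  ([.had t, .crot 2 b t] : List (Gate ι)).map (fun g => [g]) ++ cnotC a b ++
    ([.crotInv 2 b t] : List (Gate ι)).map (fun g => [g]) ++ cnotC a b ++
    ([.crot 2 a t, .had t] : List (Gate ι)).map fun g => [g]

theorem notC_on (w : ι) : (notC w).On {w} := by
  simp [notC, On, Gate.wires]

theorem cnotC_on (c t : ι) : (cnotC c t).On {c, t} := by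
  simp [cnotC, On, Gate.wires]

theorem tof_on (a b t : ι) : (tof a b t).On {a, b, t} := by
  simp [tof, cnotC, On, Gate.wires]

theorem notC_wellFormed (w : ι) : (notC w).WellFormed :=
  singleton_stages_wellFormed _ (by simp [Gate.wires])

theorem cnotC_wellFormed {c t : ι} (h : c ≠ t) : (cnotC c t).WellFormed :=
  singleton_stages_wellFormed _ (by simp [Gate.wires, h])

theorem tof_wellFormed {a b t : ι} (hab : a ≠ b) (hat : a ≠ t) (hbt : b ≠ t) :
    (tof a b t).WellFormed :=
  ((((singleton_stages_wellFormed _ (by simp [Gate.wires, hbt])).append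
    (cnotC_wellFormed hab)).append
    (singleton_stages_wellFormed _ (by simp [Gate.wires, hbt]))).append
    (cnotC_wellFormed hab)).append (singleton_stages_wellFormed _ (by simp [Gate.wires, hat]))

/-- A layer of negations. -/
def nots {m : ℕ} (t : Fin m → ι) : Circuit ι :=
  ((List.finRange m).map fun i => notC (t i)).foldr par []

/-- A layer of Toffoli gates. -/
def tofs {m : ℕ} (a b t : Fin m → ι) : Circuit ι :=
  ((List.finRange m).map fun i => tof (a i) (b i) (t i)).foldr par []

theorem cnots_eq {m : ℕ} (c t : Fin m → ι) :
    cnots c t = ((List.finRange m).map fun i => cnotC (c i) (t i)).foldr par [[], [], []] := by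
  rw [cnots, hadamards]
  induction List.finRange m with
  | nil => rfl
  | cons i l ih =>
    rw [List.map_cons (f := fun i => cnotC (c i) (t i)), List.foldr_cons, ← ih]
    rfl

section Layers

variable {m : ℕ} {a b c t : Fin m → ι}

theorem nots_disjoint (h : Function.Injective t) (i j : Fin m) (hij : i ≠ j) :
    Disjoint ({t i} : Set ι) {t j} := by
  simpa using h.ne hij

theorem cnots_disjoint (h : Function.Injective (Sum.elim c t)) (i j : Fin m) (hij : i ≠ j) :
    Disjoint ({c i, t i} : Set ι) {c j, t j} := by
  rw [Sum.elim_injective] at h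
  obtain ⟨h1, h2, h3⟩ := h
  simp only [Set.disjoint_left, Set.mem_insert_iff, Set.mem_singleton_iff]
  rintro w (rfl | rfl) (h | h)
  exacts [hij (h1 h), h3 _ _ h, h3 _ _ h.symm, hij (h2 h)]

theorem tofs_disjoint (h : Function.Injective (Sum.elim a (Sum.elim b t))) (i j : Fin m)
    (hij : i ≠ j) : Disjoint ({a i, b i, t i} : Set ι) {a j, b j, t j} := by
  rw [Sum.elim_injective, Sum.elim_injective] at h
  obtain ⟨h1, ⟨h2, h3, h4⟩, h5⟩ := h
  have h6 : ∀ i j, a i ≠ b j := fun i j => h5 i (Sum.inl j)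
  have h7 : ∀ i j, a i ≠ t j := fun i j => h5 i (Sum.inr j)
  simp only [Set.disjoint_left, Set.mem_insert_iff, Set.mem_singleton_iff]
  rintro w (rfl | rfl | rfl) (h | h | h)
  exacts [hij (h1 h), h6 _ _ h, h7 _ _ h, h6 _ _ h.symm, hij (h2 h), h4 _ _ h, h7 _ _ h.symm,
    h4 _ _ h.symm, hij (h3 h)]

theorem tofs_ne (h : Function.Injective (Sum.elim a (Sum.elim b t))) (i : Fin m) :
    a i ≠ b i ∧ a i ≠ t i ∧ b i ≠ t i := by
  refine ⟨fun e => ?_, fun e => ?_, fun e => ?_⟩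
  · simpa using h (a₁ := Sum.inl i) (a₂ := Sum.inr (Sum.inl i)) e
  · simpa using h (a₁ := Sum.inl i) (a₂ := Sum.inr (Sum.inr i)) e
  · simpa using h (a₁ := Sum.inr (Sum.inl i)) (a₂ := Sum.inr (Sum.inr i)) e

theorem nots_wellFormed (h : Function.Injective t) : (nots t).WellFormed :=
  wellFormed_foldr_par _ (List.nodup_finRange m) _ (fun i => {t i}) (fun _ _ => notC_wellFormed _)
    (fun _ _ => notC_on _) fun i _ j _ => nots_disjoint h i j

theorem hadamards_wellFormed (h : Function.Injective t) : (hadamards t).WellFormed := by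
  intro s hs
  rw [hadamards, List.mem_singleton] at hs
  subst hs
  rw [List.flatMap_map]
  have : ∀ l : List (Fin m), (l.flatMap fun i => [t i]) = l.map t := fun l => by
    induction l with
    | nil => rfl
    | cons i l ih => simp [ih]
  simpa only [Gate.wires, this] using (List.nodup_finRange m).map h

theorem cnots_wellFormed (h : Function.Injective (Sum.elim c t)) : (cnots c t).WellFormed := by
  have ht : Function.Injective t := (Sum.elim_injective.1 h).2.1
  refine ((hadamards_wellFormed ht).append fun s hs => ?_).append (hadamards_wellFormed ht)
  rw [List.mem_singleton] at hs
  subst hs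
  rw [List.flatMap_map, List.nodup_flatMap]
  refine ⟨fun i _ => ?_, (List.nodup_finRange m).imp fun {i j} hij => ?_⟩
  · simpa [Gate.wires] using fun e => by simpa using h (a₁ := Sum.inl i) (a₂ := Sum.inr i) e
  · intro w hw hw'
    simp only [Gate.wires, List.mem_cons, List.not_mem_nil, or_false] at hw hw'
    exact (Set.disjoint_left.1 (cnots_disjoint h i j hij) (show w ∈ _ by simpa using hw))
      (by simpa using hw')

theorem tofs_wellFormed (h : Function.Injective (Sum.elim a (Sum.elim b t))) :
    (tofs a b t).WellFormed :=
  wellFormed_foldr_par _ (List.nodup_finRange m) _ (fun i => {a i, b i, t i})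
    (fun i _ => tof_wellFormed (tofs_ne h i).1 (tofs_ne h i).2.1 (tofs_ne h i).2.2)
    (fun _ _ => tof_on _ _ _) fun i _ j _ => tofs_disjoint h i j

theorem size_nots (t : Fin m → ι) : (nots t).size = 3 * m := by
  rw [nots, size_foldr_par]; simp [notC, size, mul_comm]

theorem size_cnots (c t : Fin m → ι) : (cnots c t).size = 3 * m := by
  simp [cnots, hadamards, size]; ring

theorem size_hadamards (t : Fin m → ι) : (hadamards t).size = m := by
  simp [hadamards, size]

theorem size_tofs (a b t : Fin m → ι) : (tofs a b t).size = 11 * m := by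
  rw [tofs, size_foldr_par]; simp [tof, cnotC, size, mul_comm]

theorem depth_nots (t : Fin m → ι) : (nots t).depth ≤ 3 :=
  depth_foldr_par_le _ _ _ fun _ _ => le_rfl

theorem depth_cnots (c t : Fin m → ι) : (cnots c t).depth = 3 := rfl

theorem depth_hadamards (t : Fin m → ι) : (hadamards t).depth = 1 := rfl

theorem depth_tofs (a b t : Fin m → ι) : (tofs a b t).depth ≤ 11 :=
  depth_foldr_par_le _ _ _ fun _ _ => le_rfl

end Layers
end ClassicalCircuits

section Classical

variable {ι : Type} [DecidableEq ι]

theorem ket_apply [Fintype ι] (x z : ι → Bool) : ket x z = if z = x then 1 else 0 := by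
  simp [ket]

theorem zeroKet_apply [Fintype ι] (z : ι → Bool) :
    (zeroKet : State ι) z = if z = fun _ => false then 1 else 0 := ket_apply _ _

/-- The circuit maps the basis state of `z` to the basis state of `z'`. -/
def Maps [Fintype ι] (C : Circuit ι) (z z' : ι → Bool) : Prop := C.run (ket z) = ket z'

section

variable [Fintype ι]

theorem Maps.append {C D : Circuit ι} {x y z : ι → Bool} (hC : C.Maps x y) (hD : D.Maps y z) :
    (C ++ D).Maps x z := by
  rw [Maps, run_append, hC, hD]

theorem Maps.reversed {C : Circuit ι} {x y : ι → Bool} (hC : C.Maps x y) :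
    C.reversed.Maps y x := (C.reversed_run_eq_iff _ _).2 hC

theorem maps_nil (z : ι → Bool) : Maps ([] : Circuit ι) z z := rfl

/-- The amplitudes of a state are moved along with the basis states. -/
theorem Maps.run_apply {C : Circuit ι} {x y : ι → Bool} (hC : C.Maps x y) (ψ : State ι) :
    C.run ψ y = ψ x := by
  have h1 : ∀ (φ : State ι) z, inner ℂ (ket z) φ = φ z := fun φ z => by
    rw [ket, EuclideanSpace.inner_single_left]; simp
  rw [← h1, ← h1, ← hC, inner_run]

/-- A circuit that permutes the amplitudes by an involution moves the basis states by the same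
involution. -/
theorem maps_of_involutive {C : Circuit ι} {F : (ι → Bool) → ι → Bool}
    (hF : ∀ z, F (F z) = z) (hC : ∀ ψ z, C.run ψ z = ψ (F z)) (z : ι → Bool) :
    C.Maps z (F z) := by
  rw [Maps]
  ext y
  rw [hC, ket_apply, ket_apply]
  refine if_congr ⟨fun h => ?_, fun h => ?_⟩ rfl rfl
  · rw [← h, hF]
  · rw [h, hF]

end

theorem phase_one : phase 1 = -1 := by
  rw [phase, pow_one, mul_comm (2 : ℂ), mul_assoc, mul_comm (2 : ℂ), ← mul_assoc,
    mul_div_assoc, div_self two_ne_zero, mul_one, Complex.exp_pi_mul_I]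

theorem phase_two_mul_self : phase 2 * phase 2 = -1 := by
  rw [← phase_one, phase, phase, ← Complex.exp_add]; congr 1; ring

theorem had_sq_apply (w : ι) (d : (ι → Bool) → ℂ) (ψ φ : State ι)
    (hφ : ∀ x, φ x = d x * (Gate.had w).act ψ x) (x : ι → Bool)
    (h0 : d (Function.update x w false) = 1)
    (h1 : d (Function.update x w true) = 1 ∨ d (Function.update x w true) = -1) :
    (Gate.had w).act φ x =
      if d (Function.update x w true) = 1 then ψ x else ψ (Function.update x w (!x w)) := by
  have h2 := sqrt_two_sq
  have h3 := sqrt_two_ne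
  simp only [had_act_apply, hφ, h0, Function.update_self, Function.update_idem]
  have hx : ∀ b, x w = b → Function.update x w b = x := fun b hb => by
    rw [← hb, Function.update_eq_self]
  have hne : (-1 : ℂ) ≠ 1 := by norm_num
  rcases h1 with h1 | h1 <;> rw [h1] <;> cases hb : x w <;> have hb' := hx _ hb <;>
    simp only [hb', if_true, if_false, hne, Bool.not_true, Bool.not_false, Bool.false_eq_true] <;>
    field_simp <;> simp only [pow_two, h2] <;> ring

theorem run_notC_apply (w : ι) (ψ : State ι) (x : ι → Bool) :
    (notC w).run ψ x = ψ (Function.update x w (!x w)) := by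
  have h := had_sq_apply w (fun x => if x w then phase 1 else 1) ψ
    ((Gate.rot 1 w).act ((Gate.had w).act ψ)) (fun _ => rfl) x
    (by simp) (by simp [phase_one])
  have hne : ¬ (-1 : ℂ) = 1 := by norm_num
  have e : (notC w).run ψ = (Gate.had w).act ((Gate.rot 1 w).act ((Gate.had w).act ψ)) := rfl
  rw [e, h]
  simp [phase_one, hne]

theorem run_cnotC_apply {c t : ι} (hct : c ≠ t) (ψ : State ι) (x : ι → Bool) :
    (cnotC c t).run ψ x = ψ (Function.update x t (x t ^^ x c)) := by
  have h := had_sq_apply t (fun x => if x c && x t then phase 1 else 1) ψ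
    ((Gate.crot 1 c t).act ((Gate.had t).act ψ)) (fun _ => rfl) x
    (by simp) (by cases hc : x c <;> simp [phase_one, Function.update_of_ne hct, hc])
  have hne : ¬ (-1 : ℂ) = 1 := by norm_num
  have e : (cnotC c t).run ψ = (Gate.had t).act ((Gate.crot 1 c t).act ((Gate.had t).act ψ)) := rfl
  rw [e, h]
  cases hc : x c <;> simp [phase_one, hne, Function.update_of_ne hct, hc]

theorem run_tof_apply {a b t : ι} (hab : a ≠ b) (hat : a ≠ t) (hbt : b ≠ t) (ψ : State ι)
    (x : ι → Bool) :
    (tof a b t).run ψ x = ψ (Function.update x t (x t ^^ (x a && x b))) := by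
  have hne : ¬ (-1 : ℂ) = 1 := by norm_num
  have h2 := phase_two_mul_self
  have h3 := phase_ne_zero 2
  have h := had_sq_apply t (fun x => if x a && x b && x t then -1 else 1) ψ
    ((Gate.crot 2 a t).act ((cnotC a b).run ((Gate.crotInv 2 b t).act
      ((cnotC a b).run ((Gate.crot 2 b t).act ((Gate.had t).act ψ)))))) ?_ x
    (by simp) (by cases ha : x a <;> cases hb : x b <;>
      simp [Function.update_of_ne hat, Function.update_of_ne hbt, ha, hb])
  · have e : (tof a b t).run ψ x = (Gate.had t).act
      ((Gate.crot 2 a t).act ((cnotC a b).run ((Gate.crotInv 2 b t).act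
      ((cnotC a b).run ((Gate.crot 2 b t).act ((Gate.had t).act ψ)))))) x := by
      simp [tof, run_append, run_cons]
    rw [e, h]
    cases hxa : x a <;> cases hxb : x b <;>
      simp [Function.update_of_ne hat, Function.update_of_ne hbt, hxa, hxb, hne]
  · intro y
    have crot : ∀ k (c d : ι) (φ : State ι) z, (Gate.crot k c d).act φ z =
      (if z c && z d then phase k else 1) * φ z := fun _ _ _ _ _ => rfl
    have crotInv : ∀ k (c d : ι) (φ : State ι) z, (Gate.crotInv k c d).act φ z =
      (if z c && z d then (phase k)⁻¹ else 1) * φ z := fun _ _ _ _ _ => rfl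
    simp only [crot, crotInv, run_cnotC_apply hab, Function.update_self,
      Function.update_of_ne hab, Function.update_of_ne hbt.symm, Function.update_idem]
    have hy : Function.update y b ((y b ^^ y a) ^^ y a) = y := by
      rw [Bool.xor_assoc, Bool.xor_self, Bool.xor_false, Function.update_eq_self]
    rw [hy]
    cases hya : y a <;> cases hyb : y b <;> cases hyt : y t <;> simp [h3]
    rw [← mul_assoc, h2]; ring

section

variable [Fintype ι]

theorem maps_notC (w : ι) (z : ι → Bool) : (notC w).Maps z (Function.update z w (!z w)) :=
  maps_of_involutive (fun z => by simp) (run_notC_apply w) z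

theorem maps_cnotC {c t : ι} (hct : c ≠ t) (z : ι → Bool) :
    (cnotC c t).Maps z (Function.update z t (z t ^^ z c)) :=
  maps_of_involutive (fun z => by simp [Function.update_of_ne hct]) (run_cnotC_apply hct) z

theorem maps_tof {a b t : ι} (hab : a ≠ b) (hat : a ≠ t) (hbt : b ≠ t) (z : ι → Bool) :
    (tof a b t).Maps z (Function.update z t (z t ^^ (z a && z b))) :=
  maps_of_involutive (fun z => by simp [Function.update_of_ne hat, Function.update_of_ne hbt])
    (run_tof_apply hab hat hbt) z

end

/-- A layer of operations with one target qubit each, on disjoint sets of qubits. -/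
theorem maps_foldr_par [Fintype ι] {τ : Type*} {E : Circuit ι} (hE : E.flatten = []) (l : List τ)
    (hl : l.Nodup) (f : τ → Circuit ι) (s : τ → Set ι) (hs : ∀ i ∈ l, (f i).On (s i))
    (hd : ∀ i ∈ l, ∀ j ∈ l, i ≠ j → Disjoint (s i) (s j))
    (t : τ → ι) (v : τ → (ι → Bool) → Bool) (ht : ∀ i ∈ l, t i ∈ s i)
    (hv : ∀ i ∈ l, ∀ z z' : ι → Bool, (∀ w ∈ s i, z w = z' w) → v i z = v i z')
    (hf : ∀ i ∈ l, ∀ z, (f i).Maps z (Function.update z (t i) (v i z)))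
    {z z' : ι → Bool} (h1 : ∀ i ∈ l, z' (t i) = v i z)
    (h2 : ∀ w, (∀ i ∈ l, t i ≠ w) → z' w = z w) : ((l.map f).foldr par E).Maps z z' := by
  rw [Maps, run_foldr_par hE l hl f s hs hd]
  change Maps _ z z'
  clear hs
  induction l generalizing z with
  | nil =>
    have : z = z' := funext fun w => (h2 w (by simp)).symm
    rw [this]; exact maps_nil z'
  | cons i l ih =>
    rw [List.nodup_cons] at hl
    have hti : ∀ j ∈ l, t i ∉ s j := fun j hj h =>
      Set.disjoint_left.1 (hd i List.mem_cons_self j (List.mem_cons_of_mem _ hj)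
        fun h => hl.1 (h ▸ hj)) (ht i List.mem_cons_self) h
    rw [List.map_cons, List.flatten_cons]
    refine (hf i List.mem_cons_self z).append (ih hl.2
      (fun j hj k hk => hd j (List.mem_cons_of_mem _ hj) k (List.mem_cons_of_mem _ hk))
      (fun j hj => ht j (List.mem_cons_of_mem _ hj))
      (fun j hj => hv j (List.mem_cons_of_mem _ hj))
      (fun j hj => hf j (List.mem_cons_of_mem _ hj)) (fun j hj => ?_) fun w hw => ?_)
    · rw [h1 j (List.mem_cons_of_mem _ hj)]
      refine hv j (List.mem_cons_of_mem _ hj) _ _ fun w hw => ?_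
      rw [Function.update_of_ne]
      rintro rfl
      exact hti j hj hw
    · by_cases hwi : w = t i
      · subst hwi; rw [h1 i List.mem_cons_self, Function.update_self]
      · rw [Function.update_of_ne hwi]
        refine h2 w fun j hj => ?_
        rcases List.mem_cons.1 hj with rfl | hj
        exacts [Ne.symm hwi, hw j hj]

section Layers

variable {m : ℕ} {a b c t : Fin m → ι}

theorem maps_nots [Fintype ι] (h : Function.Injective t) {z z' : ι → Bool}
    (h1 : ∀ i, z' (t i) = !z (t i)) (h2 : ∀ w, (∀ i, t i ≠ w) → z' w = z w) :
    (nots t).Maps z z' :=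
  maps_foldr_par rfl _ (List.nodup_finRange m) _ (fun i => {t i}) (fun i _ => notC_on _)
    (fun i _ j _ => nots_disjoint h i j) t (fun i z => !z (t i)) (fun i _ => rfl)
    (fun i _ z z' hz => by rw [hz _ rfl]) (fun i _ z => maps_notC _ z) (fun i _ => h1 i)
    fun w hw => h2 w fun i => hw i (List.mem_finRange i)

theorem maps_cnots [Fintype ι] (h : Function.Injective (Sum.elim c t)) {z z' : ι → Bool}
    (h1 : ∀ i, z' (t i) = (z (t i) ^^ z (c i))) (h2 : ∀ w, (∀ i, t i ≠ w) → z' w = z w) :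
    (cnots c t).Maps z z' := by
  rw [cnots_eq]
  exact maps_foldr_par rfl _ (List.nodup_finRange m) _ (fun i => {c i, t i})
    (fun i _ => cnotC_on _ _)
    (fun i _ j _ => cnots_disjoint h i j) t (fun i z => z (t i) ^^ z (c i)) (fun i _ => by simp)
    (fun i _ z z' hz => by rw [hz (c i) (by simp), hz (t i) (by simp)])
    (fun i _ z => maps_cnotC (fun e => by simpa using h (a₁ := Sum.inl i) (a₂ := Sum.inr i) e) z)
    (fun i _ => h1 i) fun w hw => h2 w fun i => hw i (List.mem_finRange i)

theorem maps_tofs [Fintype ι] (h : Function.Injective (Sum.elim a (Sum.elim b t)))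
    {z z' : ι → Bool} (h1 : ∀ i, z' (t i) = (z (t i) ^^ (z (a i) && z (b i))))
    (h2 : ∀ w, (∀ i, t i ≠ w) → z' w = z w) : (tofs a b t).Maps z z' :=
  maps_foldr_par rfl _ (List.nodup_finRange m) _ (fun i => {a i, b i, t i})
    (fun i _ => tof_on _ _ _) (fun i _ j _ => tofs_disjoint h i j) t
    (fun i z => z (t i) ^^ (z (a i) && z (b i))) (fun i _ => by simp)
    (fun i _ z z' hz => by rw [hz (a i) (by simp), hz (b i) (by simp), hz (t i) (by simp)])
    (fun i _ z => maps_tof (tofs_ne h i).1 (tofs_ne h i).2.1 (tofs_ne h i).2.2 z)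
    (fun i _ => h1 i) fun w hw => h2 w fun i => hw i (List.mem_finRange i)

end Layers
end Classical
end Circuit

/-! ### Numbers in binary -/

section Numbers

variable {n : ℕ}

theorem val_succ (x : Fin (n + 1) → Bool) :
    val x = (x 0).toNat + 2 * val fun i : Fin n => x i.succ := by
  rw [val, Fin.sum_univ_succ, val, Finset.mul_sum]
  congr 1
  · cases x 0 <;> simp
  · refine Finset.sum_congr rfl fun i _ => ?_
    split_ifs <;> simp [pow_succ, mul_comm]

theorem val_lt (x : Fin n → Bool) : val x < 2 ^ n := by
  induction n with
  | zero => simp [val]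
  | succ n ih =>
    have := ih fun i => x i.succ
    rw [val_succ, pow_succ]
    cases x 0 <;> simp <;> omega

theorem testBit_val (x : Fin n → Bool) (p : Fin n) : (val x).testBit p = x p := by
  induction n with
  | zero => exact p.elim0
  | succ n ih =>
    rw [val_succ]
    refine Fin.cases ?_ (fun i => ?_) p
    · rw [Fin.val_zero, Nat.testBit_zero]
      cases x 0 <;> simp
    · rw [Fin.val_succ, Nat.testBit_succ, ← ih (fun i => x i.succ) i]
      congr 1
      cases x 0 <;> simp; omega

theorem bits_val (x : Fin n → Bool) : bits n (val x) = x := funext fun p => testBit_val x p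

theorem val_injective : Function.Injective (val : (Fin n → Bool) → ℕ) := fun x y h => by
  rw [← bits_val x, h, bits_val]

theorem val_bits (n m : ℕ) : val (bits n m) = m % 2 ^ n := by
  refine Nat.eq_of_testBit_eq fun i => ?_
  rw [Nat.testBit_mod_two_pow]
  by_cases hi : i < n
  · rw [testBit_val (bits n m) ⟨i, hi⟩]; simp [hi, bits]
  · rw [Nat.testBit_lt_two_pow ((val_lt _).trans_le (Nat.pow_le_pow_right two_pos (not_lt.1 hi)))]
    simp [hi]

theorem bits_mod (n m : ℕ) : bits n (m % 2 ^ n) = bits n m := by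
  rw [← val_bits, bits_val]

/-- Sums over register contents are sums over an initial segment of `ℕ`. -/
theorem sum_val {M : Type*} [AddCommMonoid M] (n : ℕ) (F : ℕ → M) :
    ∑ x : Fin n → Bool, F (val x) = ∑ m ∈ Finset.range (2 ^ n), F m := by
  refine Finset.sum_bij (fun x _ => val x) (fun x _ => Finset.mem_range.2 (val_lt x))
    (fun x _ y _ h => val_injective h) (fun m hm => ⟨bits n m, Finset.mem_univ _, ?_⟩)
    fun _ _ => rfl
  rw [val_bits, Nat.mod_eq_of_lt (Finset.mem_range.1 hm)]

end Numbers

/-! ### Carries -/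

/-- The carries out of the positions `0, 1, …` of an addition, for which position `i` generates a
carry if `g i` holds, and propagates one if `p i` holds. -/
def carry (p g : ℕ → Bool) : ℕ → Bool
  | 0 => g 0
  | i + 1 => g (i + 1) ^^ (p (i + 1) && carry p g i)

/-- The carries of an addition can be found from those of the addition in which the positions are
merged in pairs. -/
theorem carry_merge (p g : ℕ → Bool) (i : ℕ) :
    carry (fun i => p (2 * i) && p (2 * i + 1))
      (fun i => g (2 * i + 1) ^^ (p (2 * i + 1) && g (2 * i))) i = carry p g (2 * i + 1) := by
  induction i with
  | zero => simp [carry]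
  | succ i ih =>
    have e : carry p g (2 * (i + 1) + 1) = (g (2 * i + 2 + 1) ^^ (p (2 * i + 2 + 1) &&
      (g (2 * i + 2) ^^ (p (2 * i + 2) && carry p g (2 * i + 1))))) := rfl
    rw [e, carry, ih, Nat.mul_succ]
    cases g (2 * i + 2 + 1) <;> cases p (2 * i + 2 + 1) <;> cases g (2 * i + 2) <;>
      cases p (2 * i + 2) <;> simp

/-- The carries that enter the positions. -/
def carryIn (p g : ℕ → Bool) : ℕ → Bool
  | 0 => false
  | i + 1 => carry p g i

theorem carry_eq (p g : ℕ → Bool) (i : ℕ) : carry p g i = (g i ^^ (p i && carryIn p g i)) := by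
  cases i <;> simp [carry, carryIn]

/-- The borrows of `x - y`. -/
def borrow (x y : ℕ → Bool) : ℕ → Bool :=
  carry (fun i => !x i ^^ y i) (fun i => !x i && y i)

/-- The digits of `x - y`. -/
def diff (x y : ℕ → Bool) (i : ℕ) : Bool :=
  x i ^^ y i ^^ carryIn (fun i => !x i ^^ y i) (fun i => !x i && y i) i

/-- The borrows of `x - y` are the carries of the addition of `y` to the difference. -/
theorem carry_diff (x y : ℕ → Bool) (i : ℕ) :
    carry (fun i => diff x y i ^^ y i) (fun i => diff x y i && y i) i = borrow x y i := by
  have step : ∀ i, carryIn (fun i => diff x y i ^^ y i) (fun i => diff x y i && y i) i =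
      carryIn (fun i => !x i ^^ y i) (fun i => !x i && y i) i →
      carry (fun i => diff x y i ^^ y i) (fun i => diff x y i && y i) i = borrow x y i := by
    intro i h
    rw [carry_eq, h, borrow, carry_eq, diff]
    cases x i <;> cases y i <;>
      cases carryIn (fun i => !x i ^^ y i) (fun i => !x i && y i) i <;> rfl
  induction i with
  | zero => exact step 0 rfl
  | succ i ih => exact step (i + 1) ih

/-- The digits of `x - y` together with the final borrow account for the value of `x - y`. -/
theorem sum_diff (x y : ℕ → Bool) (m : ℕ) :
    ∑ i ∈ Finset.range m, (diff x y i).toNat * 2 ^ i + ∑ i ∈ Finset.range m, (y i).toNat * 2 ^ i =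
      ∑ i ∈ Finset.range m, (x i).toNat * 2 ^ i +
        (carryIn (fun i => !x i ^^ y i) (fun i => !x i && y i) m).toNat * 2 ^ m := by
  induction m with
  | zero => simp [carryIn]
  | succ m ih =>
    rw [Finset.sum_range_succ, Finset.sum_range_succ, Finset.sum_range_succ, carryIn, carry_eq,
      pow_succ]
    have h : ∀ a b c : Bool, (a ^^ b ^^ c).toNat + b.toNat + c.toNat =
        a.toNat + 2 * ((!a && b) ^^ ((!a ^^ b) && c)).toNat := by decide
    have h' := h (x m) (y m) (carryIn (fun i => !x i ^^ y i) (fun i => !x i && y i) m)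
    rw [← diff] at h'
    have h'' := congrArg (· * 2 ^ m) h'
    simp only [add_mul] at h''
    linarith

theorem val_eq_sum_range {n : ℕ} (x : Fin n → Bool) (x' : ℕ → Bool) (h : ∀ i : Fin n, x' i = x i) :
    val x = ∑ i ∈ Finset.range n, (x' i).toNat * 2 ^ i := by
  rw [val, Finset.sum_range]
  refine Finset.sum_congr rfl fun i _ => ?_
  rw [h]; cases x i <;> simp

/-! ### The subtraction circuit -/

namespace Circuit

section Prefix

variable {ι : Type}

/-- Parallel prefix computation of carries: from the propagation bits `p` and the generation bits
`g`, the latter are replaced by the carries. Neighbouring positions are merged, the merged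
propagation bits being kept in half of the ancillas `P`; the carries of the odd positions are then
computed by recursion, and those of the even positions from them. -/
def carries : (n : ℕ) → (p g P : Fin n → ι) → Circuit ι
  | 0, _, _, _ => []
  | 1, _, _, _ => []
  | n + 2, p, g, P =>
    let merge : Circuit ι := tofs (fun i : Fin (n / 2 + 1) => p ⟨2 * i, by omega⟩)
      (fun i => p ⟨2 * i + 1, by omega⟩) (fun i => P ⟨i, by omega⟩)
    merge ++
      tofs (fun i : Fin (n / 2 + 1) => p ⟨2 * i + 1, by omega⟩) (fun i => g ⟨2 * i, by omega⟩)
        (fun i => g ⟨2 * i + 1, by omega⟩) ++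
      carries (n / 2 + 1) (fun i => P ⟨i, by omega⟩) (fun i => g ⟨2 * i + 1, by omega⟩)
        (fun i => P ⟨n / 2 + 1 + i, by omega⟩) ++
      tofs (fun i : Fin ((n + 1) / 2) => p ⟨2 * i + 2, by omega⟩)
        (fun i => g ⟨2 * i + 1, by omega⟩) (fun i => g ⟨2 * i + 2, by omega⟩) ++
      merge

theorem size_carries (n : ℕ) (p g P : Fin n → ι) : (carries n p g P).size ≤ 44 * n := by
  induction n using Nat.strong_induction_on with
  | _ n ih =>
    match n with
    | 0 => simp [carries]
    | 1 => simp [carries]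
    | n + 2 =>
      rw [carries]
      simp only [size_append, size_tofs]
      have := ih (n / 2 + 1) (by omega) (fun i => P ⟨i, by omega⟩)
        (fun i => g ⟨2 * i + 1, by omega⟩) (fun i => P ⟨n / 2 + 1 + i, by omega⟩)
      omega

/-- Each level of the recursion halves the number of positions and has four layers of Toffoli
gates of depth at most `11`. -/
theorem depth_carries (n : ℕ) (p g P : Fin n → ι) :
    (carries n p g P).depth ≤ 44 * Nat.log 2 n := by
  induction n using Nat.strong_induction_on with
  | _ n ih =>
    match n with
    | 0 => simp [carries, depth]
    | 1 => simp [carries, depth]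
    | n + 2 =>
      rw [carries]
      have h := ih (n / 2 + 1) (by omega) (fun i => P ⟨i, by omega⟩)
        (fun i => g ⟨2 * i + 1, by omega⟩) (fun i => P ⟨n / 2 + 1 + i, by omega⟩)
      have hl : Nat.log 2 (n + 2) = Nat.log 2 (n / 2 + 1) + 1 := by
        rw [Nat.log_of_one_lt_of_le one_lt_two (by omega)]
        congr 2
        omega
      simp only [depth_append]
      rw [hl]
      have h1 := depth_tofs (fun i : Fin (n / 2 + 1) => p ⟨2 * i, by omega⟩)
        (fun i => p ⟨2 * i + 1, by omega⟩) (fun i => P ⟨i, by omega⟩)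
      have h2 := depth_tofs (fun i : Fin (n / 2 + 1) => p ⟨2 * i + 1, by omega⟩)
        (fun i => g ⟨2 * i, by omega⟩) (fun i => g ⟨2 * i + 1, by omega⟩)
      have h3 := depth_tofs (fun i : Fin ((n + 1) / 2) => p ⟨2 * i + 2, by omega⟩)
        (fun i => g ⟨2 * i + 1, by omega⟩) (fun i => g ⟨2 * i + 2, by omega⟩)
      omega

theorem injective_elim_three {α β γ : Type*} {a : α → ι} {b : β → ι} {c : γ → ι} :
    Function.Injective (Sum.elim a (Sum.elim b c)) ↔ Function.Injective a ∧
      Function.Injective b ∧ Function.Injective c ∧ (∀ i j, a i ≠ b j) ∧ (∀ i j, a i ≠ c j) ∧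
      ∀ i j, b i ≠ c j := by
  simp only [Sum.elim_injective, Sum.forall, Sum.elim_inl, Sum.elim_inr]
  constructor
  · rintro ⟨h1, ⟨h2, h3, h4⟩, h5⟩
    exact ⟨h1, h2, h3, fun i => (h5 i).1, fun i => (h5 i).2, h4⟩
  · rintro ⟨h1, h2, h3, h4, h5, h6⟩
    exact ⟨h1, ⟨h2, h3, h6⟩, fun i => ⟨h4 i, h5 i⟩⟩

section

variable {n : ℕ} {p g P : Fin (n + 2) → ι}
theorem carries_merge_injective
    (h : Function.Injective (Sum.elim p (Sum.elim g P))) : Function.Injective (Sum.elim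
    (fun i : Fin (n / 2 + 1) => p ⟨2 * i, by omega⟩) (Sum.elim
      (fun i : Fin (n / 2 + 1) => p ⟨2 * i + 1, by omega⟩)
      (fun i : Fin (n / 2 + 1) => P ⟨i, by omega⟩))) := by
  obtain ⟨h1, h2, h3, h4, h5, h6⟩ := injective_elim_three.1 h
  refine injective_elim_three.2 ⟨fun i j e => ?_, fun i j e => ?_, fun i j e => ?_,
    fun i j e => ?_, fun i j => h5 _ _, fun i j => h5 _ _⟩
  · have := Fin.mk.inj (h1 e); omega
  · have := Fin.mk.inj (h1 e); omega
  · have := Fin.mk.inj (h3 e); omega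
  · have := Fin.mk.inj (h1 e); omega

theorem carries_up_injective
    (h : Function.Injective (Sum.elim p (Sum.elim g P))) : Function.Injective (Sum.elim
    (fun i : Fin (n / 2 + 1) => p ⟨2 * i + 1, by omega⟩) (Sum.elim
      (fun i : Fin (n / 2 + 1) => g ⟨2 * i, by omega⟩)
      (fun i : Fin (n / 2 + 1) => g ⟨2 * i + 1, by omega⟩))) := by
  obtain ⟨h1, h2, h3, h4, h5, h6⟩ := injective_elim_three.1 h
  refine injective_elim_three.2 ⟨fun i j e => ?_, fun i j e => ?_, fun i j e => ?_,
    fun i j => h4 _ _, fun i j => h4 _ _, fun i j e => ?_⟩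
  · have := Fin.mk.inj (h1 e); omega
  · have := Fin.mk.inj (h2 e); omega
  · have := Fin.mk.inj (h2 e); omega
  · have := Fin.mk.inj (h2 e); omega

theorem carries_rec_injective
    (h : Function.Injective (Sum.elim p (Sum.elim g P))) : Function.Injective (Sum.elim
    (fun i : Fin (n / 2 + 1) => P ⟨i, by omega⟩) (Sum.elim
      (fun i : Fin (n / 2 + 1) => g ⟨2 * i + 1, by omega⟩)
      (fun i : Fin (n / 2 + 1) => P ⟨n / 2 + 1 + i, by omega⟩))) := by
  obtain ⟨h1, h2, h3, h4, h5, h6⟩ := injective_elim_three.1 h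
  refine injective_elim_three.2 ⟨fun i j e => ?_, fun i j e => ?_, fun i j e => ?_,
    fun i j => (h6 _ _).symm, fun i j e => ?_, fun i j => h6 _ _⟩
  · have := Fin.mk.inj (h3 e); omega
  · have := Fin.mk.inj (h2 e); omega
  · have := Fin.mk.inj (h3 e); omega
  · have := Fin.mk.inj (h3 e); omega

theorem carries_down_injective
    (h : Function.Injective (Sum.elim p (Sum.elim g P))) : Function.Injective (Sum.elim
    (fun i : Fin ((n + 1) / 2) => p ⟨2 * i + 2, by omega⟩) (Sum.elim
      (fun i : Fin ((n + 1) / 2) => g ⟨2 * i + 1, by omega⟩)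
      (fun i : Fin ((n + 1) / 2) => g ⟨2 * i + 2, by omega⟩))) := by
  obtain ⟨h1, h2, h3, h4, h5, h6⟩ := injective_elim_three.1 h
  refine injective_elim_three.2 ⟨fun i j e => ?_, fun i j e => ?_, fun i j e => ?_,
    fun i j => h4 _ _, fun i j => h4 _ _, fun i j e => ?_⟩
  · have := Fin.mk.inj (h1 e); omega
  · have := Fin.mk.inj (h2 e); omega
  · have := Fin.mk.inj (h2 e); omega
  · have := Fin.mk.inj (h2 e); omega

end

theorem carries_wellFormed (n : ℕ) (p g P : Fin n → ι)
    (h : Function.Injective (Sum.elim p (Sum.elim g P))) : (carries n p g P).WellFormed := by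
  induction n using Nat.strong_induction_on with
  | _ n ih =>
    match n with
    | 0 => simp [carries, WellFormed]
    | 1 => simp [carries, WellFormed]
    | n + 2 =>
      rw [carries]
      exact ((((tofs_wellFormed (carries_merge_injective h)).append
        (tofs_wellFormed (carries_up_injective h))).append
        (ih _ (by omega) _ _ _ (carries_rec_injective h))).append
        (tofs_wellFormed (carries_down_injective h))).append
        (tofs_wellFormed (carries_merge_injective h))

/-- The ancillas `P` are clean before and after: the first layer of Toffoli gates, being an
involution, is repeated at the end to clear them. -/
theorem maps_carries [DecidableEq ι] [Fintype ι] (n : ℕ) (p g P : Fin n → ι)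
    (h : Function.Injective (Sum.elim p (Sum.elim g P))) (pv gv : ℕ → Bool) (z z' : ι → Bool)
    (hp : ∀ i, z (p i) = pv i) (hg : ∀ i, z (g i) = gv i) (hP : ∀ i, z (P i) = false)
    (h1 : ∀ i, z' (g i) = carry pv gv i) (h2 : ∀ w, (∀ i, g i ≠ w) → z' w = z w) :
    (carries n p g P).Maps z z' := by
  induction n using Nat.strong_induction_on generalizing pv gv z z' with
  | _ n ih =>
    match n with
    | 0 =>
      have : z = z' := funext fun w => (h2 w (fun i => i.elim0)).symm
      rw [this, carries]; exact maps_nil z'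
    | 1 =>
      have : z = z' := funext fun w => by
        by_cases hw : g 0 = w
        · rw [← hw, h1, hg]; rfl
        · exact (h2 w (fun i => by rwa [Subsingleton.elim i 0])).symm
      rw [this, carries]; exact maps_nil z'
    | n + 2 =>
      obtain ⟨i1, i2, i3, n1, n2, n3⟩ := injective_elim_three.1 h
      rw [carries]
      classical
      -- the merged propagation and generation bits
      set pv' : ℕ → Bool := fun i => pv (2 * i) && pv (2 * i + 1) with hpv'
      set gv' : ℕ → Bool := fun i => gv (2 * i + 1) ^^ (pv (2 * i + 1) && gv (2 * i)) with hgv'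
      -- the values of `g` and `P` after the stages
      obtain ⟨st, stg, stP, stn⟩ : ∃ st : (Fin (n + 2) → Bool) → (Fin (n + 2) → Bool) → ι → Bool,
          (∀ a b i, st a b (g i) = a i) ∧ (∀ a b i, st a b (P i) = b i) ∧
          ∀ a b w, (∀ i, g i ≠ w) → (∀ i, P i ≠ w) → st a b w = z w := by
        refine ⟨fun a b => Function.extend g a (Function.extend P b z), fun a b i => ?_,
          fun a b i => ?_, fun a b w h h' => ?_⟩
        · exact i2.extend_apply _ _ _
        · dsimp only
          rw [Function.extend_apply' _ _ _ fun ⟨j, hj⟩ => n3 j i hj, i3.extend_apply]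
        · dsimp only
          rw [Function.extend_apply' _ _ _ (not_exists.2 h),
            Function.extend_apply' _ _ _ (not_exists.2 h')]
      have stp : ∀ a b i, st a b (p i) = pv i := fun a b i => by
        rw [stn _ _ _ (fun j => (n1 i j).symm) fun j => (n2 i j).symm, hp]
      have st_out : ∀ a b w, (∀ i, g i ≠ w) → (∀ i, P i ≠ w) → ∀ a' b', st a b w = st a' b' w :=
        fun a b w h h' a' b' => by rw [stn a b w h h', stn a' b' w h h']
      have st_congr : ∀ a b a' b' w, (∀ i, g i = w → a i = a' i) → (∀ i, P i = w → b i = b' i) →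
          st a b w = st a' b' w := by
        intro a b a' b' w ha hb
        by_cases hw : ∃ i, g i = w
        · obtain ⟨i, rfl⟩ := hw; rw [stg, stg, ha i rfl]
        · by_cases hw' : ∃ i, P i = w
          · obtain ⟨i, rfl⟩ := hw'; rw [stP, stP, hb i rfl]
          · exact st_out _ _ _ (not_exists.1 hw) (not_exists.1 hw') _ _
      have hz : z = st (fun i => gv i) (fun _ => false) := by
        funext w
        by_cases hw : ∃ i, g i = w
        · obtain ⟨i, rfl⟩ := hw; rw [stg, hg]
        · by_cases hw' : ∃ i, P i = w
          · obtain ⟨i, rfl⟩ := hw'; rw [stP, hP]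
          · exact (stn _ _ _ (not_exists.1 hw) (not_exists.1 hw')).symm
      have hz' : z' = st (fun i => carry pv gv i) (fun _ => false) := by
        funext w
        by_cases hw : ∃ i, g i = w
        · obtain ⟨i, rfl⟩ := hw; rw [stg, h1]
        · rw [h2 w (not_exists.1 hw)]
          by_cases hw' : ∃ i, P i = w
          · obtain ⟨i, rfl⟩ := hw'; rw [stP, hP]
          · exact (stn _ _ _ (not_exists.1 hw) (not_exists.1 hw')).symm
      rw [hz, hz']
      let Pv : Fin (n + 2) → Bool := fun i => if (i : ℕ) < n / 2 + 1 then pv' i else false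
      have m1 : Maps (tofs (fun i : Fin (n / 2 + 1) => p ⟨2 * i, by omega⟩)
          (fun i => p ⟨2 * i + 1, by omega⟩) (fun i => P ⟨i, by omega⟩))
          (st (fun i => gv i) (fun _ => false)) (st (fun i => gv i) Pv) := by
        refine maps_tofs (carries_merge_injective h) (fun i => ?_) fun w hw => ?_
        · simp only [stP, stp, Pv, i.2, if_true, hpv', Bool.false_xor]
        · refine st_congr _ _ _ _ _ (fun _ _ => rfl) fun i hi => if_neg fun hlt => hw ⟨i, hlt⟩ hi
      have m5 : Maps (tofs (fun i : Fin (n / 2 + 1) => p ⟨2 * i, by omega⟩)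
          (fun i => p ⟨2 * i + 1, by omega⟩) (fun i => P ⟨i, by omega⟩))
          (st (fun i => carry pv gv i) Pv) (st (fun i => carry pv gv i) (fun _ => false)) := by
        refine maps_tofs (carries_merge_injective h) (fun i => ?_) fun w hw => ?_
        · simp only [stP, stp, Pv, i.2, if_true, hpv', Bool.xor_self]
        · refine st_congr _ _ _ _ _ (fun _ _ => rfl)
            fun i hi => (if_neg fun hlt => hw ⟨i, hlt⟩ hi).symm
      have m2 : Maps (tofs (fun i : Fin (n / 2 + 1) => p ⟨2 * i + 1, by omega⟩)
          (fun i => g ⟨2 * i, by omega⟩) (fun i => g ⟨2 * i + 1, by omega⟩))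
          (st (fun i => gv i) Pv)
          (st (fun i => if (i : ℕ) % 2 = 1 then gv' (i / 2) else gv i) Pv) := by
        refine maps_tofs (carries_up_injective h) (fun i => ?_) fun w hw => ?_
        · have e1 : (2 * (i : ℕ) + 1) % 2 = 1 := by omega
          have e2 : (2 * (i : ℕ) + 1) / 2 = i := by omega
          simp only [stg, stp, e1, e2, if_true, hgv']
        · refine st_congr _ _ _ _ _ (fun i hi => if_neg fun hodd => ?_) fun _ _ => rfl
          refine hw ⟨i / 2, by omega⟩ (Eq.trans (congrArg g (Fin.ext ?_)) hi)
          simp only; omega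
      have m3 : Maps (carries (n / 2 + 1) (fun i => P ⟨i, by omega⟩)
          (fun i => g ⟨2 * i + 1, by omega⟩) (fun i => P ⟨n / 2 + 1 + i, by omega⟩))
          (st (fun i => if (i : ℕ) % 2 = 1 then gv' (i / 2) else gv i) Pv)
          (st (fun i => if (i : ℕ) % 2 = 1 then carry pv gv i else gv i) Pv) := by
        refine ih _ (by omega) _ _ _ (carries_rec_injective h) pv' gv' _ _ (fun i => ?_)
          (fun i => ?_) (fun i => ?_) (fun i => ?_) fun w hw => ?_
        · simp only [stP, Pv, i.2, if_true]
        · have e1 : (2 * (i : ℕ) + 1) % 2 = 1 := by omega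
          have e2 : (2 * (i : ℕ) + 1) / 2 = i := by omega
          simp only [stg, e1, e2, if_true]
        · simp only [stP, Pv]
          exact if_neg (by omega)
        · have e1 : (2 * (i : ℕ) + 1) % 2 = 1 := by omega
          simp only [stg, e1, if_true]
          exact (carry_merge pv gv i).symm
        · refine st_congr _ _ _ _ _ (fun i hi => ?_) fun _ _ => rfl
          have hi' : ¬ (i : ℕ) % 2 = 1 := fun hodd => by
            refine hw ⟨i / 2, by omega⟩ (Eq.trans (congrArg g (Fin.ext ?_)) hi)
            simp only; omega
          rw [if_neg hi', if_neg hi']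
      have m4 : Maps (tofs (fun i : Fin ((n + 1) / 2) => p ⟨2 * i + 2, by omega⟩)
          (fun i => g ⟨2 * i + 1, by omega⟩) (fun i => g ⟨2 * i + 2, by omega⟩))
          (st (fun i => if (i : ℕ) % 2 = 1 then carry pv gv i else gv i) Pv)
          (st (fun i => carry pv gv i) Pv) := by
        refine maps_tofs (carries_down_injective h) (fun i => ?_) fun w hw => ?_
        · have e1 : (2 * (i : ℕ) + 1) % 2 = 1 := by omega
          have e2 : ¬ (2 * (i : ℕ) + 2) % 2 = 1 := by omega
          simp only [stg, stp, e1, e2, if_true, if_false]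
          rfl
        · refine st_congr _ _ _ _ _ (fun i hi => ?_) fun _ _ => rfl
          by_cases hodd : (i : ℕ) % 2 = 1
          · rw [if_pos hodd]
          · rw [if_neg hodd]
            have h0 : (i : ℕ) = 0 := by
              by_contra h0
              refine hw ⟨i / 2 - 1, by omega⟩ (Eq.trans (congrArg g (Fin.ext ?_)) hi)
              simp only; omega
            rw [h0]; rfl
      exact (((m1.append m2).append m3).append m4).append m5

end Prefix

section Subtraction

variable {n : ℕ}

/-- The qubits of the subtraction circuit: minuend, subtrahend, and `2 n` ancillas, which hold the
carries and the merged propagation bits. -/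
abbrev SubWire (n : ℕ) : Type := Fin n ⊕ (Fin n ⊕ Fin (n + n))

/-- The qubits of the minuend. -/
def subX (i : Fin n) : SubWire n := Sum.inl i

/-- The qubits of the subtrahend. -/
def subY (i : Fin n) : SubWire n := Sum.inr (Sum.inl i)

/-- The qubits of the carries. -/
def subG (i : Fin n) : SubWire n := Sum.inr (Sum.inr (Fin.castAdd n i))

/-- The qubits of the merged propagation bits. -/
def subP (i : Fin n) : SubWire n := Sum.inr (Sum.inr (Fin.natAdd n i))

theorem subX_injective : Function.Injective (subX (n := n)) := Sum.inl_injective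
theorem subY_injective : Function.Injective (subY (n := n)) :=
  Sum.inr_injective.comp Sum.inl_injective
theorem subG_injective : Function.Injective (subG (n := n)) :=
  Sum.inr_injective.comp (Sum.inr_injective.comp (Fin.castAdd_injective n n))
theorem subP_injective : Function.Injective (subP (n := n)) :=
  Sum.inr_injective.comp (Sum.inr_injective.comp (Fin.natAdd_injective n n))
theorem subG_ne_subP (i j : Fin n) : subG i ≠ subP j := by
  intro h
  have := congrArg Fin.val (Sum.inr_injective (Sum.inr_injective h))
  simp at this
  omega

/-- The register contents `x`, `y`, with carries `c` in the ancillas. -/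
def subState (x y c : Fin n → Bool) : SubWire n → Bool :=
  Sum.elim x (Sum.elim y (Fin.addCases c fun _ => false))

section

variable (x y c : Fin n → Bool) (i : Fin n)
@[simp] theorem subState_X : subState x y c (subX i) = x i := rfl
@[simp] theorem subState_Y : subState x y c (subY i) = y i := rfl
@[simp] theorem subState_G : subState x y c (subG i) = c i := by simp [subState, subG]
@[simp] theorem subState_P : subState x y c (subP i) = false :=
  Fin.addCases_right (motive := fun _ => Bool) (left := c) (right := fun _ => false) i

end

theorem subWire_cases {q : SubWire n → Prop} (hX : ∀ i, q (subX i)) (hY : ∀ i, q (subY i))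
    (hG : ∀ i, q (subG i)) (hP : ∀ i, q (subP i)) : ∀ w, q w := by
  rintro (i | i | i)
  exacts [hX i, hY i, Fin.addCases (motive := fun i => q (Sum.inr (Sum.inr i))) hG hP i]

theorem subY_subX_injective : Function.Injective (Sum.elim (subY (n := n)) subX) :=
  Sum.elim_injective.2 ⟨subY_injective, subX_injective, fun _ _ h => by simp [subX, subY] at h⟩

theorem subXYG_injective : Function.Injective (Sum.elim (subX (n := n)) (Sum.elim subY subG)) :=
  injective_elim_three.2 ⟨subX_injective, subY_injective, subG_injective,
    fun _ _ h => by simp [subX, subY] at h, fun _ _ h => by simp [subX, subG] at h,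
    fun _ _ h => by simp [subY, subG] at h⟩

theorem subXGP_injective : Function.Injective (Sum.elim (subX (n := n)) (Sum.elim subG subP)) :=
  injective_elim_three.2 ⟨subX_injective, subG_injective, subP_injective,
    fun _ _ h => by simp [subX, subG] at h, fun _ _ h => by simp [subX, subP] at h, subG_ne_subP⟩

theorem subGX_injective : Function.Injective (Sum.elim
    (fun i : Fin (n - 1) => subG (⟨i, by omega⟩ : Fin n))
    (fun i : Fin (n - 1) => subX (⟨i + 1, by omega⟩ : Fin n))) :=
  Sum.elim_injective.2 ⟨fun i j h => by simpa [Fin.ext_iff] using subG_injective h,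
    fun i j h => by simpa [Fin.ext_iff] using subX_injective h,
    fun _ _ h => by simp [subX, subG] at h⟩

/-- The carries of `x + y` are written to the ancillas. -/
def addCarries (n : ℕ) : Circuit (SubWire n) :=
  tofs subX subY subG ++ cnots subY subX ++ carries n subX subG subP ++ cnots subY subX

/-- Subtraction in place. The borrows of `x - y` are the carries of the addition of `y` to the
complement of `x`. From them the difference is computed in place of `x`. They are cleared by the
reversed circuit, being also the carries of the addition of `y` to the difference. -/
def subtraction (n : ℕ) : Circuit (SubWire n) :=
  nots subX ++ addCarries n ++ nots subX ++ cnots subY subX ++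
    cnots (fun i : Fin (n - 1) => subG (⟨i, by omega⟩ : Fin n))
      (fun i : Fin (n - 1) => subX (⟨i + 1, by omega⟩ : Fin n)) ++
    (addCarries n).reversed

theorem maps_addCarries (x y c : Fin n → Bool) (x' y' : ℕ → Bool) (hx : ∀ i : Fin n, x' i = x i)
    (hy : ∀ i : Fin n, y' i = y i)
    (hc : ∀ i : Fin n, c i = carry (fun i => x' i ^^ y' i) (fun i => x' i && y' i) i) :
    (addCarries n).Maps (subState x y fun _ => false) (subState x y c) := by
  have h1 : Maps (tofs subX subY subG) (subState x y fun _ => false)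
      (subState x y fun i => x i && y i) := by
    refine maps_tofs subXYG_injective (fun i => by simp) (subWire_cases ?_ ?_ ?_ ?_) <;> intro i hi
    exacts [rfl, rfl, (hi i rfl).elim, by simp]
  have h2 : ∀ c, Maps (cnots subY subX) (subState x y c) (subState (fun i => x i ^^ y i) y c) := by
    intro c
    refine maps_cnots subY_subX_injective (fun i => by simp) (subWire_cases ?_ ?_ ?_ ?_) <;>
      intro i hi
    exacts [(hi i rfl).elim, rfl, by simp, by simp]
  have h3 : Maps (carries n subX subG subP) (subState (fun i => x i ^^ y i) y fun i => x i && y i)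
      (subState (fun i => x i ^^ y i) y c) := by
    refine maps_carries n _ _ _ subXGP_injective (fun i => x' i ^^ y' i)
      (fun i => x' i && y' i) _ _ (fun i => by simp [← hx, ← hy]) (fun i => by simp [← hx, ← hy])
      (fun i => by simp) (fun i => by rw [subState_G, hc])
      (subWire_cases ?_ ?_ ?_ ?_) <;> intro i hi
    exacts [rfl, rfl, (hi i rfl).elim, by simp]
  have h4 := h2 c
  have h4' : Maps (cnots subY subX) (subState (fun i => x i ^^ y i) y c) (subState x y c) := by
    refine maps_cnots subY_subX_injective (fun i => by simp) (subWire_cases ?_ ?_ ?_ ?_) <;>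
      intro i hi
    exacts [(hi i rfl).elim, rfl, by simp, by simp]
  exact ((h1.append (h2 _)).append h3).append h4'

theorem maps_subtraction (x y : Fin n → Bool) :
    (subtraction n).Maps (subState x y fun _ => false)
      (subState (bits n (val x + 2 ^ n - val y)) y fun _ => false) := by
  obtain ⟨x', hx⟩ : ∃ x' : ℕ → Bool, ∀ i : Fin n, x' i = x i :=
    ⟨fun i => (val x).testBit i, testBit_val x⟩
  obtain ⟨y', hy⟩ : ∃ y' : ℕ → Bool, ∀ i : Fin n, y' i = y i :=
    ⟨fun i => (val y).testBit i, testBit_val y⟩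
  have hz : (fun i : Fin n => diff x' y' i) = bits n (val x + 2 ^ n - val y) := by
    have h1 := val_eq_sum_range (fun i : Fin n => diff x' y' i) (diff x' y') fun _ => rfl
    have h2 := sum_diff x' y' n
    rw [← h1, ← val_eq_sum_range y y' hy, ← val_eq_sum_range x x' hx] at h2
    have h3 := val_lt y
    rw [← bits_val fun i : Fin n => diff x' y' i, ← bits_mod n (val x + _ - _), ← bits_mod]
    congr 1
    rcases hb : carryIn (fun i => !x' i ^^ y' i) (fun i => !x' i && y' i) n with _ | _ <;>
      rw [hb] at h2 <;> simp only [Bool.toNat_false, Bool.toNat_true, zero_mul, one_mul] at h2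
    · have : val x + 2 ^ n - val y = val (fun i : Fin n => diff x' y' i) + 2 ^ n := by omega
      rw [this, Nat.add_mod_right]
    · have : val x + 2 ^ n - val y = val (fun i : Fin n => diff x' y' i) := by omega
      rw [this]
  rw [← hz]
  have s1 : Maps (nots subX) (subState x y fun _ => false)
      (subState (fun i => !x i) y fun _ => false) := by
    refine maps_nots subX_injective (fun i => rfl) (subWire_cases ?_ ?_ ?_ ?_) <;> intro i hi
    exacts [(hi i rfl).elim, rfl, by simp, by simp]
  have s2 := maps_addCarries (fun i => !x i) y (fun i => borrow x' y' i) (fun i => !x' i) y'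
    (fun i => by rw [hx]) hy fun i => rfl
  have s3 : Maps (nots subX) (subState (fun i => !x i) y fun i => borrow x' y' i)
      (subState x y fun i => borrow x' y' i) := by
    refine maps_nots subX_injective (fun i => by simp) (subWire_cases ?_ ?_ ?_ ?_) <;> intro i hi
    exacts [(hi i rfl).elim, rfl, by simp, by simp]
  have s4 : Maps (cnots subY subX) (subState x y fun i => borrow x' y' i)
      (subState (fun i => x i ^^ y i) y fun i => borrow x' y' i) := by
    refine maps_cnots subY_subX_injective (fun i => by simp) (subWire_cases ?_ ?_ ?_ ?_) <;>
      intro i hi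
    exacts [(hi i rfl).elim, rfl, by simp, by simp]
  have s5 : Maps (cnots (fun i : Fin (n - 1) => subG (⟨i, by omega⟩ : Fin n))
      (fun i : Fin (n - 1) => subX (⟨i + 1, by omega⟩ : Fin n)))
      (subState (fun i => x i ^^ y i) y fun i => borrow x' y' i)
      (subState (fun i => diff x' y' i) y fun i => borrow x' y' i) := by
    refine maps_cnots subGX_injective (fun i => ?_) (subWire_cases ?_ ?_ ?_ ?_)
    · simp only [subState_X, subState_G, diff, carryIn, borrow, ← hx, ← hy, Bool.xor_assoc]
    · intro i hi
      have h0 : (i : ℕ) = 0 := by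
        by_contra h0
        exact hi ⟨i - 1, by omega⟩ (congrArg subX (Fin.ext (by simp; omega)))
      simp only [subState_X, ← hx, ← hy, h0]
      simp [diff, carryIn]
    all_goals intro i hi; simp
  have s6 := (maps_addCarries (fun i => diff x' y' i) y (fun i => borrow x' y' i) (diff x' y') y'
    (fun i => rfl) hy fun i => (carry_diff x' y' i).symm).reversed
  exact ((((s1.append s2).append s3).append s4).append s5).append s6

theorem addCarries_wellFormed (n : ℕ) : (addCarries n).WellFormed :=
  (((tofs_wellFormed subXYG_injective).append (cnots_wellFormed subY_subX_injective)).append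
    (carries_wellFormed n _ _ _ subXGP_injective)).append (cnots_wellFormed subY_subX_injective)

theorem subtraction_wellFormed (n : ℕ) : (subtraction n).WellFormed :=
  (((((nots_wellFormed subX_injective).append (addCarries_wellFormed n)).append
    (nots_wellFormed subX_injective)).append (cnots_wellFormed subY_subX_injective)).append
    (cnots_wellFormed subGX_injective)).append (addCarries_wellFormed n).reversed

theorem size_addCarries (n : ℕ) : (addCarries n).size ≤ 61 * n := by
  have := size_carries n (subX (n := n)) subG subP
  simp only [addCarries, size_append, size_tofs, size_cnots]
  omega

theorem size_subtraction (n : ℕ) : (subtraction n).size ≤ 140 * n := by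
  have := size_addCarries n
  simp only [subtraction, size_append, size_nots, size_cnots, size_reversed]
  omega

theorem depth_addCarries (n : ℕ) : (addCarries n).depth ≤ 17 + 44 * Nat.log 2 n := by
  have h := depth_carries n (subX (n := n)) subG subP
  have h' := depth_tofs (subX (n := n)) subY subG
  simp only [addCarries, depth_append, depth_cnots]
  omega

theorem depth_subtraction (n : ℕ) : (subtraction n).depth ≤ 46 + 88 * Nat.log 2 n := by
  have h := depth_addCarries n
  have h' := depth_nots (subX (n := n))
  simp only [subtraction, depth_append, depth_cnots, depth_reversed]
  omega

end Subtraction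

end Circuit

/-! ### Basis states and logarithms -/

theorem tensor_apply {ι κ : Type} (ψ : State ι) (φ : State κ) (z : ι ⊕ κ → Bool) :
    tensor ψ φ z = ψ (fun i => z (Sum.inl i)) * φ (fun i => z (Sum.inr i)) := rfl

theorem tensor_ket_ket {ι κ : Type} [DecidableEq ι] [DecidableEq κ] [Fintype ι] [Fintype κ]
    (x : ι → Bool) (y : κ → Bool) : tensor (ket x) (ket y) = ket (Sum.elim x y) := by
  ext z
  rw [tensor_apply, ket_apply, ket_apply, ket_apply, ite_mul, one_mul, zero_mul, ← ite_and]
  refine if_congr ⟨fun h => ?_, fun h => ?_⟩ rfl rfl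
  · funext w
    cases w with
    | inl i => exact congrFun h.1 i
    | inr i => exact congrFun h.2 i
  · subst h; exact ⟨rfl, rfl⟩

theorem natLog_le (n : ℕ) (hn : 2 ≤ n) : (Nat.log 2 n : ℝ) ≤ 2 * Real.log n := by
  have h1 : ((2 ^ Nat.log 2 n : ℕ) : ℝ) ≤ n := by exact_mod_cast Nat.pow_log_le_self 2 (by omega)
  have h2 := Real.log_le_log (by positivity) h1
  rw [Nat.cast_pow, Real.log_pow] at h2
  have h3 := Real.log_two_gt_d9
  have h4 : (0 : ℝ) ≤ Nat.log 2 n := Nat.cast_nonneg _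
  push_cast at h2
  nlinarith

theorem half_le_log (n : ℕ) (hn : 2 ≤ n) : 1 / 2 ≤ Real.log n := by
  have h := Real.log_le_log two_pos (show (2 : ℝ) ≤ n by exact_mod_cast hn)
  have h3 := Real.log_two_gt_d9
  linarith

theorem subtraction_isSubtractionFamily :
    IsSubtractionFamily 300 (fun n => n + n) subtraction := by
  refine ⟨fun n => ⟨subtraction_wellFormed n, fun x y => ?_⟩, fun n hn => ⟨?_, ?_, ?_⟩⟩
  · have h := maps_subtraction x y
    have e : ∀ x y : Fin n → Bool, subState x y (fun _ => false) =
        Sum.elim x (Sum.elim y fun _ => false) := by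
      intro x y
      refine funext (subWire_cases ?_ ?_ ?_ ?_) <;> intro i
      exacts [rfl, rfl, subState_G _ _ _ i, subState_P _ _ _ i]
    rw [Maps, e, e] at h
    simpa only [zeroKet, tensor_ket_ket] using h
  · push_cast; linarith [(Nat.cast_nonneg n : (0 : ℝ) ≤ n)]
  · have h : ((subtraction n).size : ℝ) ≤ 140 * n := by exact_mod_cast size_subtraction n
    linarith [(Nat.cast_nonneg n : (0 : ℝ) ≤ n)]
  · have h : ((subtraction n).depth : ℝ) ≤ 46 + 88 * Nat.log 2 n := by
      exact_mod_cast depth_subtraction n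
    have h1 := natLog_le n hn
    have h2 := half_le_log n hn
    linarith

/-! ### Fourier states -/

section Fourier

variable {n : ℕ}

/-- The unit complex number of argument `2 π t`. -/
noncomputable def cis (t : ℝ) : ℂ := Complex.exp (2 * Real.pi * Complex.I * t)

theorem cis_add (s t : ℝ) : cis (s + t) = cis s * cis t := by
  rw [cis, cis, cis, ← Complex.exp_add]; congr 1; push_cast; ring

@[simp] theorem cis_zero : cis 0 = 1 := by simp [cis]

theorem cis_nat (m : ℕ) : cis m = 1 := by
  have := Complex.exp_nat_mul_two_pi_mul_I m
  rw [cis, ← this]; congr 1; push_cast; ring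

theorem cis_eq_exp (t : ℝ) : cis t = Complex.exp (Complex.I * ((2 * Real.pi * t : ℝ) : ℂ)) := by
  rw [cis]; congr 1; push_cast; ring

theorem norm_cis (t : ℝ) : ‖cis t‖ = 1 := by
  rw [cis_eq_exp, mul_comm, Complex.norm_exp_ofReal_mul_I]

theorem norm_cis_sub_one_le (t : ℝ) : ‖cis t - 1‖ ≤ 2 * Real.pi * |t| := by
  rw [cis_eq_exp]
  refine (Real.norm_exp_I_mul_ofReal_sub_one_le).trans ?_
  rw [Real.norm_eq_abs, abs_mul, abs_of_pos Real.two_pi_pos]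

theorem phase_eq_cis (k : ℕ) : phase k = cis (1 / 2 ^ k) := by
  rw [phase, cis]; congr 1; push_cast; ring

theorem cis_sum {τ : Type*} (s : Finset τ) (f : τ → ℝ) :
    cis (∑ i ∈ s, f i) = ∏ i ∈ s, cis (f i) := by
  classical
  induction s using Finset.induction_on with
  | empty => simp
  | insert a s ha ih => rw [Finset.sum_insert ha, Finset.prod_insert ha, cis_add, ih]

/-- The normalisation factor of `n` qubits. -/
noncomputable def nrm (n : ℕ) : ℂ := ((1 / Real.sqrt (2 ^ n) : ℝ) : ℂ)

theorem nrm_eq_pow (n : ℕ) : nrm n = (1 / ((Real.sqrt 2 : ℝ) : ℂ)) ^ n := by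
  rw [nrm, ← Complex.ofReal_one, ← Complex.ofReal_div, ← Complex.ofReal_pow]
  congr 1
  rw [div_pow, one_pow]
  congr 1
  rw [Real.sqrt_eq_iff_mul_self_eq (by positivity) (by positivity), ← mul_pow,
    Real.mul_self_sqrt (by norm_num)]

theorem norm_nrm_sq (n : ℕ) : ‖nrm n‖ ^ 2 = 1 / 2 ^ n := by
  rw [nrm, Complex.norm_real, Real.norm_eq_abs, sq_abs, div_pow, Real.sq_sqrt (by positivity),
    one_pow]

theorem nrm_mul_self (n : ℕ) : nrm n * nrm n * 2 ^ n = 1 := by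
  rw [nrm, ← Complex.ofReal_mul, div_mul_div_comm, Real.mul_self_sqrt (by positivity)]
  push_cast
  field_simp

theorem fourier_apply (j x : Fin n → Bool) :
    fourier j x = nrm n * cis (((val x * val j : ℕ) : ℝ) / 2 ^ n) := by
  have h : fourier j x = nrm n * ∑ y, (ket j : State (Fin n)) y *
    Complex.exp (2 * Real.pi * Complex.I * ((val x * val y : ℕ) : ℂ) / 2 ^ n) := rfl
  rw [h, Finset.sum_eq_single j]
  · rw [ket_apply, if_pos rfl, one_mul, cis]
    congr 2; push_cast; ring
  · intro y _ hy; rw [ket_apply, if_neg hy, zero_mul]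
  · intro h; exact absurd (Finset.mem_univ j) h

theorem qft_apply (α : State (Fin n)) (x : Fin n → Bool) :
    qft n α x = ∑ j, α j * fourier j x := by
  have h : qft n α x = nrm n * ∑ y, α y *
    Complex.exp (2 * Real.pi * Complex.I * ((val x * val y : ℕ) : ℂ) / 2 ^ n) := rfl
  rw [h, Finset.mul_sum]
  refine Finset.sum_congr rfl fun j _ => ?_
  rw [fourier_apply, cis, mul_left_comm]
  congr 3; push_cast; ring_nf

theorem state_apply_sum {ι : Type} {τ : Type*} (s : Finset τ) (f : τ → State ι) (x : ι → Bool) :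
    (∑ i ∈ s, f i) x = ∑ i ∈ s, f i x := by
  simp

theorem qft_eq_sum (α : State (Fin n)) : qft n α = ∑ j, α j • fourier j := by
  ext x
  rw [qft_apply, state_apply_sum]
  rfl

theorem eq_sum_ket {ι : Type} [DecidableEq ι] [Fintype ι] (ψ : State ι) :
    ψ = ∑ x, ψ x • ket x := by
  ext z
  rw [state_apply_sum]
  simp [ket_apply]

/-- The phases of Fourier states are products of phases over pairs of bits. (For `n ≤ a + b` the
exponent `n - a - b` is `0`, and `phase 0 = 1`.) -/
theorem cis_val_mul_val (x y : Fin n → Bool) : cis (((val x * val y : ℕ) : ℝ) / 2 ^ n) =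
    ∏ a, ∏ b, if x a && y b then phase (n - a - b) else 1 := by
  have h : ((val x * val y : ℕ) : ℝ) / 2 ^ n =
      ∑ a : Fin n, ∑ b : Fin n,
        if x a && y b then (2 ^ (a : ℕ) * 2 ^ (b : ℕ) : ℝ) / 2 ^ n else 0 := by
    rw [val, val, Finset.sum_mul_sum, Nat.cast_sum, Finset.sum_div]
    refine Finset.sum_congr rfl fun a _ => ?_
    rw [Nat.cast_sum, Finset.sum_div]
    refine Finset.sum_congr rfl fun b _ => ?_
    cases x a <;> cases y b <;> simp
  rw [h, cis_sum]
  refine Finset.prod_congr rfl fun a _ => ?_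
  rw [cis_sum]
  refine Finset.prod_congr rfl fun b _ => ?_
  split_ifs
  · rcases Nat.lt_or_ge (a + b : ℕ) n with hab | hab
    · rw [phase_eq_cis]
      congr 1
      rw [div_eq_div_iff (by positivity) (by positivity), one_mul, ← pow_add, ← pow_add]
      congr 1; omega
    · have e : n - (a : ℕ) - b = 0 := by omega
      have e' : (2 ^ (a : ℕ) * 2 ^ (b : ℕ) : ℝ) / 2 ^ n = ((2 ^ (a + b - n : ℕ) : ℕ) : ℝ) := by
        push_cast
        rw [div_eq_iff (by positivity), ← pow_add, ← pow_add]
        congr 1; omega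
      rw [e, e', cis_nat, phase_eq_cis]
      simpa using (cis_nat 1).symm
  · exact cis_zero

/-! ### Layers of Hadamard gates -/

/-- The uniform superposition. -/
noncomputable def uniform (n : ℕ) : State (Fin n) := WithLp.toLp 2 fun _ => nrm n

theorem uniform_apply (x : Fin n → Bool) : uniform n x = nrm n := rfl

theorem hadamards_relabel {κ : Type} (f : Fin n → κ) :
    (hadamards fun p : Fin n => p).relabel f = hadamards f := by
  simp [hadamards, relabel, Gate.relabel]

theorem run_hadamards_zeroKet (n : ℕ) : (hadamards fun p : Fin n => p).run zeroKet = uniform n := by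
  have key : ∀ l : List (Fin n), l.Nodup → ∀ x : Fin n → Bool,
      acts (l.map fun p => Gate.had p) zeroKet x =
        (1 / ((Real.sqrt 2 : ℝ) : ℂ)) ^ l.length * if ∀ p, p ∉ l → x p = false then 1 else 0 := by
    intro l
    induction l using List.reverseRecOn with
    | nil =>
      intro _ x
      rw [List.map_nil, acts_nil, zeroKet_apply, List.length_nil, pow_zero, one_mul]
      exact if_congr (by simp [funext_iff]) rfl rfl
    | append_singleton l p ih =>
      intro hl x
      rw [List.nodup_append] at hl
      have hp : p ∉ l := fun h => hl.2.2 p h p (by simp) rfl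
      have hneg : ¬ ∀ q, q ∉ l → Function.update x p true q = false := fun h => by
        have := h p hp
        rw [Function.update_self] at this
        exact Bool.noConfusion this
      rw [List.map_append, acts_append, List.map_singleton, acts_cons, acts_nil, had_act_apply,
        ih hl.1, ih hl.1, if_neg hneg, mul_zero, mul_zero, add_zero,
        List.length_append, List.length_singleton, pow_succ, mul_div_right_comm, div_eq_mul_one_div]
      congr 1
      refine if_congr ⟨fun h q hq => ?_, fun h q hq => ?_⟩ rfl rfl
      · have hqp : q ≠ p := fun e => hq (by simp [e])
        have := h q fun hq' => hq (by simp [hq'])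
        rwa [Function.update_of_ne hqp] at this
      · by_cases hqp : q = p
        · rw [hqp, Function.update_self]
        · rw [Function.update_of_ne hqp]
          exact h q (by simp [hq, hqp])
  ext x
  rw [run_eq_acts, hadamards, List.flatten_singleton, key _ (List.nodup_finRange n), uniform_apply,
    nrm_eq_pow, List.length_finRange, if_pos (fun p hp => absurd (List.mem_finRange p) hp), mul_one]

theorem reversed_hadamards_run {κ : Type} [DecidableEq κ] (f : Fin n → κ) (ψ : State κ) :
    (hadamards f).reversed.run ψ = (hadamards f).run ψ := by
  rw [run_eq_acts, flatten_reversed, run_eq_acts, hadamards, List.flatten_singleton, List.map_map]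
  have : (Gate.inv ∘ fun p => Gate.had (f p)) = fun p => Gate.had (f p) := rfl
  rw [this, acts, acts]
  refine (List.reverse_perm _).foldl_eq' (fun g hg h hh φ => ?_) ψ
  obtain ⟨p, -, rfl⟩ := List.mem_map.1 (List.mem_reverse.1 hg)
  obtain ⟨q, -, rfl⟩ := List.mem_map.1 (List.mem_reverse.1 hh)
  by_cases hpq : f p = f q
  · rw [hpq]
  · refine Gate.act_comm _ _ (fun w hw hw' => ?_) φ
    simp only [Gate.wires, List.mem_singleton] at hw hw'
    exact hpq (hw'.symm.trans hw |>.symm ▸ rfl)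

theorem run_hadamards_uniform (n : ℕ) :
    (hadamards fun p : Fin n => p).run (uniform n) = zeroKet := by
  rw [← reversed_hadamards_run, reversed_run_eq_iff, run_hadamards_zeroKet]

/-! ### The exact QFT circuit -/

/-- The gates of the exact QFT are indexed by the pairs `a ≤ b`. -/
def qftGate {L : ℕ} (p : Fin L × Fin L) : Gate (Fin L) :=
  if p.1 = p.2 then Gate.had p.1 else Gate.crot ((p.2 : ℕ) - p.1 + 1) p.2 p.1

/-- The pairs `a ≤ b` in the order in which the exact QFT treats them. -/
def qftPairs (L : ℕ) : List (Fin L × Fin L) :=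
  (List.range (2 * L - 1)).flatMap fun m => (List.finRange L).flatMap fun (a : Fin L) =>
    (List.finRange L).flatMap fun (b : Fin L) => if (a : ℕ) + b = m ∧ a ≤ b then [(a, b)] else []

theorem exactQFT_flatten (L : ℕ) : (exactQFT L).flatten = (qftPairs L).map qftGate := by
  rw [exactQFT, qftPairs, ← List.flatMap_def, List.map_flatMap]
  congr 1; funext m
  rw [List.map_flatMap]
  congr 1; funext a
  rw [List.map_flatMap]
  congr 1; funext b
  by_cases h1 : (a : ℕ) + b = m <;> rcases lt_trichotomy a b with h2 | h2 | h2
  · simp [h1, h2, h2.ne, h2.le, qftGate]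
  · subst h2; simp [h1, qftGate]
  · simp [h2.ne', h2.not_gt, h2.not_ge]
  all_goals simp [h1]

theorem mem_qftPairs {L : ℕ} (p : Fin L × Fin L) : p ∈ qftPairs L ↔ p.1 ≤ p.2 := by
  obtain ⟨a, b⟩ := p
  simp only [qftPairs, List.mem_flatMap, List.mem_range, List.mem_finRange, true_and]
  constructor
  · rintro ⟨m, hm, a', b', h⟩
    split_ifs at h with h'
    · rw [List.mem_singleton] at h; cases h; exact h'.2
    · simp at h
  · intro h
    exact ⟨a + b, by have := a.2; have := b.2; omega, a, b, by simp [show a ≤ b from h]⟩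

theorem qftPairs_pairwise (L : ℕ) : (qftPairs L).Pairwise fun p q =>
    p ≠ q ∧ (p.1 : ℕ) + p.2 ≤ (q.1 : ℕ) + q.2 := by
  have mem : ∀ {m : ℕ} {a b : Fin L} {p : Fin L × Fin L},
      p ∈ (if (a : ℕ) + b = m ∧ a ≤ b then [(a, b)] else []) → p = (a, b) ∧ (a : ℕ) + b = m := by
    intro m a b p hp
    split_ifs at hp with h
    · exact ⟨List.mem_singleton.1 hp, h.1⟩
    · simp at hp
  rw [qftPairs, List.pairwise_flatMap]
  refine ⟨fun m _ => ?_, List.pairwise_lt_range.imp fun {m m'} hm p hp q hq => ?_⟩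
  · rw [List.pairwise_flatMap]
    refine ⟨fun a _ => ?_, (List.nodup_finRange L).imp fun {a a'} ha p hp q hq => ?_⟩
    · rw [List.pairwise_flatMap]
      refine ⟨fun b _ => ?_, (List.nodup_finRange L).imp fun {b b'} hb p hp q hq => ?_⟩
      · split_ifs <;> simp
      · obtain ⟨rfl, h1⟩ := mem hp
        obtain ⟨rfl, h2⟩ := mem hq
        exact ⟨fun h => hb (Prod.ext_iff.1 h).2, by simp only; omega⟩
    · obtain ⟨b, -, hp⟩ := List.mem_flatMap.1 hp
      obtain ⟨b', -, hq⟩ := List.mem_flatMap.1 hq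
      obtain ⟨rfl, h1⟩ := mem hp
      obtain ⟨rfl, h2⟩ := mem hq
      exact ⟨fun h => ha (Prod.ext_iff.1 h).1, by simp only; omega⟩
  · obtain ⟨a, -, hp⟩ := List.mem_flatMap.1 hp
    obtain ⟨a', -, hq⟩ := List.mem_flatMap.1 hq
    obtain ⟨b, -, hp⟩ := List.mem_flatMap.1 hp
    obtain ⟨b', -, hq⟩ := List.mem_flatMap.1 hq
    obtain ⟨rfl, h1⟩ := mem hp
    obtain ⟨rfl, h2⟩ := mem hq
    refine ⟨fun h => ?_, by simp only; omega⟩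
    have h3 := (Prod.ext_iff.1 h).1
    have h4 := (Prod.ext_iff.1 h).2
    simp only at h3 h4
    subst h3 h4
    omega

/-- The contribution of one gate of the exact QFT to the amplitude of `y` for the input `x`. -/
noncomputable def qftFactor {L : ℕ} (x y : Fin L → Bool) (p : Fin L × Fin L) : ℂ :=
  (if p.1 = p.2 then 1 / ((Real.sqrt 2 : ℝ) : ℂ) else 1) *
    if y p.1 && x p.2 then phase ((p.2 : ℕ) - p.1 + 1) else 1

/-- After any initial part of the exact QFT, the qubits without a Hadamard gate so far still hold
their input, and the amplitudes are products over the gates. -/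
theorem acts_qftGate {L : ℕ} (x : Fin L → Bool) (D : List (Fin L × Fin L))
    (hle : ∀ p ∈ D, p.1 ≤ p.2)
    (hD : D.Pairwise fun p q => p ≠ q ∧ (p.1 : ℕ) + p.2 ≤ (q.1 : ℕ) + q.2) (y : Fin L → Bool) :
    acts (D.map qftGate) (ket x) y =
      (if ∀ b, (b, b) ∉ D → y b = x b then 1 else 0) * (D.map (qftFactor x y)).prod := by
  induction D using List.reverseRecOn generalizing y with
  | nil =>
    rw [List.map_nil, acts_nil, ket_apply, List.map_nil, List.prod_nil, mul_one]
    exact if_congr (by simp [funext_iff]) rfl rfl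
  | append_singleton D p ih =>
    obtain ⟨a, b⟩ := p
    rw [List.pairwise_append] at hD
    have hD' : ∀ q ∈ D, q ≠ (a, b) ∧ (q.1 : ℕ) + q.2 ≤ a + b := fun q hq => hD.2.2 q hq _ (by simp)
    have hle' : ∀ q ∈ D, q.1 ≤ q.2 := fun q hq => hle q (by simp [hq])
    have hab : a ≤ b := hle (a, b) (by simp)
    have ih := ih hle' hD.1
    rw [List.map_append, acts_append, List.map_singleton, acts_cons, acts_nil, List.map_append,
      List.prod_append, List.map_singleton, List.prod_singleton]
    by_cases hab' : a = b
    · subst hab'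
      have hnot : (a, a) ∉ D := fun h => (hD' _ h).1 rfl
      have hprod : ∀ v, (D.map (qftFactor x (Function.update y a v))).prod =
          (D.map (qftFactor x y)).prod := by
        intro v
        congr 1
        refine List.map_congr_left fun q hq => ?_
        have hqa : q.1 ≠ a := fun h => by
          have h1 := hD' q hq
          have h2 := hle' q hq
          have h3 : q.2 = a := by
            apply le_antisymm _ (h ▸ h2)
            rw [Fin.le_def]; have := h1.2; rw [h] at this; omega
          exact h1.1 (Prod.ext h h3)
        rw [qftFactor, qftFactor, Function.update_of_ne hqa]
      have hind : ∀ v, (∀ b, (b, b) ∉ D → Function.update y a v b = x b) ↔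
          v = x a ∧ ∀ b, (b, b) ∉ D ++ [(a, a)] → y b = x b := by
        intro v
        constructor
        · intro h
          refine ⟨by simpa using h a hnot, fun b hb => ?_⟩
          have hba : b ≠ a := fun e => hb (by simp [e])
          have := h b fun hb' => hb (by simp [hb'])
          rwa [Function.update_of_ne hba] at this
        · rintro ⟨rfl, h⟩ b hb
          by_cases hba : b = a
          · rw [hba, Function.update_self]
          · rw [Function.update_of_ne hba]
            exact h b (by simp [hb, hba])
      have hg : qftGate (a, a) = Gate.had a := by simp [qftGate]
      rw [hg, had_act_apply, ih, ih, hprod, hprod, qftFactor, if_pos rfl, Nat.sub_self, zero_add,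
        phase_one]
      by_cases hP : ∀ b, (b, b) ∉ D ++ [(a, a)] → y b = x b
      · simp only [hind, eq_true hP, and_true, if_true]
        cases hxa : x a <;> cases hya : y a <;> simp <;> ring
      · simp only [hind, eq_false hP, and_false, if_false]
        simp
    · have hlt : a < b := lt_of_le_of_ne hab hab'
      have hb : (b, b) ∉ D := fun h => by
        have := (hD' _ h).2
        simp only at this
        rw [Fin.lt_def] at hlt; omega
      have hg : qftGate (a, b) = Gate.crot ((b : ℕ) - a + 1) b a := by simp [qftGate, hab']
      have hact : (Gate.crot ((b : ℕ) - a + 1) b a).act (acts (D.map qftGate) (ket x)) y =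
        (if y b && y a then phase ((b : ℕ) - a + 1) else 1) * acts (D.map qftGate) (ket x) y := rfl
      have hind : (∀ c, (c, c) ∉ D ++ [(a, b)] → y c = x c) ↔ ∀ c, (c, c) ∉ D → y c = x c := by
        refine forall_congr' fun c => ?_
        have : (c, c) ≠ (a, b) := fun h => hab' (by cases h; rfl)
        simp [this]
      rw [hg, hact, ih, if_congr hind rfl rfl, qftFactor, if_neg hab', one_mul]
      by_cases h : ∀ c, (c, c) ∉ D → y c = x c
      · rw [if_pos h, h b hb, Bool.and_comm]; ring
      · rw [if_neg h]; ring

theorem val_rev_sub {L : ℕ} (a b : Fin L) (h : a ≤ b) : L - (a : ℕ) - b.rev = (b : ℕ) - a + 1 := by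
  rw [Fin.val_rev, Fin.le_def] at *; omega

/-- The exact circuit performs the QFT, up to the reversal of the order of the input bits. -/
theorem exactQFT_run_ket {L : ℕ} (x : Fin L → Bool) :
    (exactQFT L).run (ket x) = fourier fun q => x q.rev := by
  ext y
  have hnd : (qftPairs L).Nodup := (qftPairs_pairwise L).imp fun h => h.1
  rw [run_eq_acts, exactQFT_flatten, acts_qftGate x _ (fun p hp => (mem_qftPairs p).1 hp)
    (qftPairs_pairwise L), if_pos (fun b hb => absurd ((mem_qftPairs (b, b)).2 le_rfl) hb), one_mul,
    ← List.prod_toFinset _ hnd]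
  have hset : (qftPairs L).toFinset = Finset.univ.filter fun p : Fin L × Fin L => p.1 ≤ p.2 := by
    ext p; simp [mem_qftPairs]
  rw [hset, Finset.prod_filter, Fintype.prod_prod_type, fourier_apply, nrm_eq_pow, cis_val_mul_val]
  have hcard : (1 / ((Real.sqrt 2 : ℝ) : ℂ)) ^ L = ∏ _a : Fin L, (1 / ((Real.sqrt 2 : ℝ) : ℂ)) := by
    simp
  rw [hcard, ← Finset.prod_mul_distrib]
  refine Finset.prod_congr rfl fun a _ => ?_
  have hdiag : (1 / ((Real.sqrt 2 : ℝ) : ℂ)) =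
      ∏ b : Fin L, if a = b then (1 / ((Real.sqrt 2 : ℝ) : ℂ)) else 1 := by
    rw [Finset.prod_ite_eq]; simp
  rw [hdiag, ← Equiv.prod_comp Fin.revPerm fun b => if y a && x b.rev then phase (L - a - b) else 1,
    ← Finset.prod_mul_distrib]
  refine Finset.prod_congr rfl fun b _ => ?_
  simp only [Fin.revPerm_apply, Fin.rev_rev]
  by_cases hab : a ≤ b
  · rw [if_pos hab, qftFactor, val_rev_sub a b hab]
  · have e : L - (a : ℕ) - (b.rev : ℕ) = 0 := by
      rw [Fin.val_rev]; rw [Fin.le_def] at hab; omega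
    have e' : phase 0 = 1 := by simp [phase, Complex.exp_two_pi_mul_I]
    have e'' : ¬ a = b := fun h => hab h.le
    rw [if_neg hab, e, e', if_neg e'']
    simp

theorem exactQFT_wellFormed (L : ℕ) : (exactQFT L).WellFormed := by
  intro s hs
  simp only [exactQFT, List.mem_map] at hs
  obtain ⟨m, -, rfl⟩ := hs
  simp only [List.flatMap_assoc]
  have mem : ∀ a b w : Fin L, w ∈ (if (a : ℕ) + b = m then if a = b then [Gate.had a]
      else if a < b then [Gate.crot ((b : ℕ) - a + 1) b a] else [] else []).flatMap Gate.wires →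
      (a : ℕ) + b = m ∧ a ≤ b ∧ (w = a ∨ w = b) := by
    intro a b w hw
    split_ifs at hw with h1 h2 h3
    · exact ⟨h1, h2.le, Or.inl (by simpa [Gate.wires] using hw)⟩
    · exact ⟨h1, h3.le, by simpa [Gate.wires, or_comm] using hw⟩
    all_goals simp at hw
  rw [List.nodup_flatMap]
  refine ⟨fun a _ => ?_, (List.nodup_finRange L).imp fun {a a'} ha w hw hw' => ?_⟩
  · rw [List.nodup_flatMap]
    refine ⟨fun b _ => ?_, (List.nodup_finRange L).imp fun {b b'} hb w hw hw' => ?_⟩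
    · split_ifs with h1 h2 h3
      · simp [Gate.wires]
      · simp [Gate.wires, Ne.symm h2]
      all_goals simp
    · have h1 := mem _ _ _ hw
      have h2 := mem _ _ _ hw'
      exact hb (Fin.ext (by omega))
  · obtain ⟨b, -, hw⟩ := List.mem_flatMap.1 hw
    obtain ⟨b', -, hw'⟩ := List.mem_flatMap.1 hw'
    have h1 := mem _ _ _ hw
    have h2 := mem _ _ _ hw'
    simp only [Fin.le_def, Fin.ext_iff] at h1 h2
    exact ha (Fin.ext (by omega))

theorem depth_exactQFT (L : ℕ) : (exactQFT L).depth = 2 * L - 1 := by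
  simp [exactQFT, depth]

theorem size_exactQFT_le (L : ℕ) : (exactQFT L).size ≤ L * L := by
  have h : (exactQFT L).size = (qftPairs L).length := by
    rw [size, ← List.length_flatten, exactQFT_flatten, List.length_map]
  have hnd : (qftPairs L).Nodup := (qftPairs_pairwise L).imp fun h => h.1
  rw [h]
  simpa using hnd.length_le_card

theorem rev_comp_rev {L : ℕ} (x : Fin L → Bool) : (fun q : Fin L => x q.rev.rev) = x := by
  simp

/-- The Fourier transform is an isometry, being performed by a circuit up to the order of bits. -/
theorem norm_qft (α : State (Fin n)) : ‖qft n α‖ = ‖α‖ := by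
  have h : qft n α = (exactQFT n).run (∑ j, α j • ket fun q : Fin n => j q.rev) := by
    rw [qft_eq_sum, run_sum]
    refine Finset.sum_congr rfl fun j _ => ?_
    rw [run_smul, exactQFT_run_ket, rev_comp_rev]
  have h' : (∑ j, α j • ket fun q : Fin n => j q.rev) =
      (WithLp.toLp 2 fun x => α fun q => x q.rev : State (Fin n)) := by
    ext x
    rw [state_apply_sum]
    change ∑ j, α j * (ket fun q : Fin n => j q.rev) x = α fun q => x q.rev
    rw [Finset.sum_eq_single fun q => x q.rev]
    · rw [ket_apply, if_pos (by simp), mul_one]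
    · intro j _ hj
      rw [ket_apply, if_neg, mul_zero]
      rintro rfl
      exact hj (by simp)
    · intro h; exact absurd (Finset.mem_univ _) h
  rw [h, norm_run, h', EuclideanSpace.norm_eq, EuclideanSpace.norm_eq]
  congr 1
  exact Equiv.sum_comp (Equiv.arrowCongr Fin.revPerm (Equiv.refl Bool)) fun x => ‖α x‖ ^ 2

end Fourier

/-! ### Circuits on tensor factors -/

section Tensor

variable {ι κ : Type} [DecidableEq ι] [DecidableEq κ]

theorem run_relabel_inr (C : Circuit κ) (ψ : State ι) (φ : State κ) :
    (C.relabel Sum.inr).run (tensor ψ φ) = tensor ψ (C.run φ) := by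
  ext z
  rw [tensor_apply]
  refine run_relabel_apply_of_slice Sum.inr_injective C fun x => ?_
  have h1 : (fun i => Function.extend Sum.inr x z (Sum.inl i)) = fun i => z (Sum.inl i) :=
    funext fun i => Function.extend_apply' _ _ _ (by simp)
  have h2 : (fun i => Function.extend Sum.inr x z (Sum.inr i)) = x :=
    funext fun i => Sum.inr_injective.extend_apply _ _ i
  rw [tensor_apply, h1, h2]

theorem run_relabel_inl (C : Circuit ι) (ψ : State ι) (φ : State κ) :
    (C.relabel Sum.inl).run (tensor ψ φ) = tensor (C.run ψ) φ := by
  ext z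
  rw [tensor_apply, mul_comm]
  refine run_relabel_apply_of_slice Sum.inl_injective C fun x => ?_
  have h1 : (fun i => Function.extend Sum.inl x z (Sum.inr i)) = fun i => z (Sum.inr i) :=
    funext fun i => Function.extend_apply' _ _ _ (by simp)
  have h2 : (fun i => Function.extend Sum.inl x z (Sum.inl i)) = x :=
    funext fun i => Sum.inl_injective.extend_apply _ _ i
  rw [tensor_apply, h1, h2, mul_comm]

theorem norm_tensor [Fintype ι] [Fintype κ] (ψ : State ι) (φ : State κ) :
    ‖tensor ψ φ‖ = ‖ψ‖ * ‖φ‖ := by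
  rw [EuclideanSpace.norm_eq, EuclideanSpace.norm_eq, EuclideanSpace.norm_eq,
    ← Real.sqrt_mul (by positivity), Finset.sum_mul_sum, ← Fintype.sum_prod_type']
  congr 1
  refine Fintype.sum_equiv (Equiv.sumArrowEquivProdArrow ι κ Bool) _ _ fun z => ?_
  rw [tensor_apply, norm_mul, mul_pow]
  rfl

theorem norm_ket [Fintype ι] (x : ι → Bool) : ‖(ket x : State ι)‖ = 1 := by
  rw [ket, EuclideanSpace.single, PiLp.norm_single, norm_one]

theorem norm_zeroKet [Fintype ι] : ‖(zeroKet : State ι)‖ = 1 := norm_ket _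

theorem norm_fourier {n : ℕ} (j : Fin n → Bool) : ‖fourier j‖ = 1 := by
  rw [fourier, norm_qft, norm_ket]

/-- Gates that multiply the amplitudes by functions of the basis state do so jointly. -/
theorem acts_flatMap_diagonal {τ : Type*} (l : List τ) (f : τ → List (Gate ι))
    (d : τ → (ι → Bool) → ℂ) (h : ∀ i ψ y, acts (f i) ψ y = d i y * ψ y) (ψ : State ι)
    (y : ι → Bool) : acts (l.flatMap f) ψ y = (l.map fun i => d i y).prod * ψ y := by
  induction l generalizing ψ with
  | nil => simp
  | cons i l ih =>
    rw [List.flatMap_cons, acts_append, ih, h, List.map_cons, List.prod_cons]; ring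

end Tensor

/-! ### Approximate Fourier state computation -/

section AQFS

variable {n : ℕ}

theorem norm_prod_sub_prod_le {τ : Type*} (s : Finset τ) (f g : τ → ℂ)
    (hf : ∀ i ∈ s, ‖f i‖ = 1) (hg : ∀ i ∈ s, ‖g i‖ = 1) :
    ‖∏ i ∈ s, f i - ∏ i ∈ s, g i‖ ≤ ∑ i ∈ s, ‖f i - g i‖ := by
  classical
  induction s using Finset.induction_on with
  | empty => simp
  | insert a s ha ih =>
    have ih := ih (fun i hi => hf i (Finset.mem_insert_of_mem hi))
      fun i hi => hg i (Finset.mem_insert_of_mem hi)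
    rw [Finset.prod_insert ha, Finset.prod_insert ha, Finset.sum_insert ha]
    have e : f a * ∏ i ∈ s, f i - g a * ∏ i ∈ s, g i =
        (f a - g a) * ∏ i ∈ s, f i + g a * (∏ i ∈ s, f i - ∏ i ∈ s, g i) := by ring
    have h1 : ‖∏ i ∈ s, f i‖ = 1 := by
      rw [norm_prod]
      exact Finset.prod_eq_one fun i hi => hf i (Finset.mem_insert_of_mem hi)
    rw [e]
    refine (norm_add_le _ _).trans ?_
    rw [norm_mul, norm_mul, h1, hg a (Finset.mem_insert_self a s), mul_one, one_mul]
    gcongr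

/-- The phase that bit `n - p - (r + 1)` of `j` contributes to qubit `p` of the Fourier state,
when that qubit has the value `b`. -/
noncomputable def fourierPhase (n j : ℕ) (b : Bool) (p r : ℕ) : ℂ :=
  if j.testBit (n - (r + 1) - p) && b then phase (r + 1) else 1

theorem norm_fourierPhase (n j : ℕ) (b : Bool) (p r : ℕ) : ‖fourierPhase n j b p r‖ = 1 := by
  rw [fourierPhase]; split_ifs <;> simp [norm_phase]

theorem norm_fourierPhase_sub_one_le (n j : ℕ) (b : Bool) (p r : ℕ) :
    ‖fourierPhase n j b p r - 1‖ ≤ 2 * Real.pi / 2 ^ (r + 1) := by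
  rw [fourierPhase]
  split_ifs
  · rw [phase_eq_cis]
    refine (norm_cis_sub_one_le _).trans (le_of_eq ?_)
    rw [abs_of_pos (by positivity)]; ring
  · rw [sub_self, norm_zero]; positivity

/-- Fourier states are product states: every qubit collects the phases of the bits of `j`, and
those with `r < k` are the ones that the truncated circuit produces. -/
theorem fourier_apply_eq_prod (j y : Fin n → Bool) :
    fourier j y = nrm n * ∏ p : Fin n, ∏ r ∈ Finset.range (n - p),
      fourierPhase n (val j) (y p) p r := by
  rw [fourier_apply, cis_val_mul_val]
  congr 1
  refine Finset.prod_congr rfl fun p _ => ?_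
  have h1 : (∏ b : Fin n, if y p && j b then phase (n - p - b) else 1) =
      ∏ b ∈ Finset.range n, if y p && (val j).testBit b then phase (n - p - b) else 1 := by
    rw [Finset.prod_range]
    simp only [testBit_val]
  rw [h1, ← Finset.prod_subset (Finset.range_subset_range.2 (Nat.sub_le n p)),
    ← Finset.prod_range_reflect]
  · refine Finset.prod_congr rfl fun r hr => ?_
    rw [Finset.mem_range] at hr
    rw [fourierPhase, Bool.and_comm]
    have e1 : n - (p : ℕ) - 1 - r = n - (r + 1) - p := by omega
    have e2 : n - (p : ℕ) - (n - (r + 1) - p) = r + 1 := by omega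
    rw [e1, e2]
  · intro b _ hb
    rw [Finset.mem_range, not_lt] at hb
    have e : n - (p : ℕ) - b = 0 := by omega
    have e' : phase 0 = 1 := by simp [phase, Complex.exp_two_pi_mul_I]
    rw [e, e', ite_self]

theorem run_aqfs_apply (k : ℕ) (α : State (Fin n)) (z : Fin n ⊕ Fin n → Bool) :
    (aqfs n k).run (tensor α zeroKet) z = α (fun p => z (Sum.inl p)) * (nrm n * ∏ p : Fin n,
      ∏ r ∈ Finset.range (min k (n - p)),
        fourierPhase n (val fun p => z (Sum.inl p)) (z (Sum.inr p)) p r) := by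
  rw [aqfs, run_append, ← hadamards_relabel, run_relabel_inr, run_hadamards_zeroKet, run_eq_acts,
    ← List.flatMap_def,
    acts_flatMap_diagonal _ _ (fun r z => ((List.finRange n).map fun p : Fin n =>
      if r + 1 + (p : ℕ) ≤ n then
        fourierPhase n (val fun p => z (Sum.inl p)) (z (Sum.inr p)) p r else 1).prod),
    tensor_apply, uniform_apply]
  · rw [mul_comm, mul_assoc]
    congr 2
    have h1 : ∀ f : ℕ → ℂ, ((List.range k).map f).prod = ∏ r ∈ Finset.range k, f r := fun f => rfl
    rw [h1]
    simp only [← Fin.prod_univ_def]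
    rw [Finset.prod_comm]
    refine Finset.prod_congr rfl fun p _ => ?_
    rw [← Finset.prod_filter]
    refine Finset.prod_congr (Finset.ext fun r => ?_) fun _ _ => rfl
    simp only [Finset.mem_filter, Finset.mem_range]
    omega
  · intro r ψ y
    refine acts_flatMap_diagonal _ _ (fun (p : Fin n) z => if r + 1 + (p : ℕ) ≤ n then
        fourierPhase n (val fun p => z (Sum.inl p)) (z (Sum.inr p)) p r else 1)
      (fun p ψ y => ?_) ψ y
    split_ifs with h
    · have e := testBit_val (fun p => y (Sum.inl p)) ⟨n - (r + 1) - p, by omega⟩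
      simp only at e
      rw [fourierPhase, e]
      rfl
    · rw [one_mul]; rfl

/-- The omitted phases, of sizes `c / 2 ^ (r + 1)`, add up to a geometric tail. -/
theorem norm_prod_Ico_sub_one_le (f : ℕ → ℂ) (hf : ∀ r, ‖f r‖ = 1) (c : ℝ)
    (hc : ∀ r, ‖f r - 1‖ ≤ c / 2 ^ (r + 1)) {k m : ℕ} (hkm : k ≤ m) :
    ‖∏ r ∈ Finset.Ico k m, f r - 1‖ ≤ c / 2 ^ k - c / 2 ^ m := by
  induction m, hkm using Nat.le_induction with
  | base => simp
  | succ m hkm ih =>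
    rw [Finset.prod_Ico_succ_top hkm]
    have e : (∏ r ∈ Finset.Ico k m, f r) * f m - 1 =
        (∏ r ∈ Finset.Ico k m, f r - 1) * f m + (f m - 1) := by ring
    rw [e]
    refine (norm_add_le _ _).trans ?_
    rw [norm_mul, hf, mul_one]
    have h2 : c / 2 ^ m = c / 2 ^ (m + 1) + c / 2 ^ (m + 1) := by rw [pow_succ]; ring
    linarith [hc m]

/-- Every amplitude is wrong by a factor whose distance from `1` is at most `2 π n / 2 ^ k`; since
the exact amplitudes are products of `α j` and a constant up to phases, the bound carries over to
the norm. -/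
theorem norm_aqfs_sub_le (k : ℕ) (α : State (Fin n)) :
    ‖(aqfs n k).run (tensor α zeroKet) - ∑ j, α j • tensor (ket j) (fourier j)‖ ≤
      2 * Real.pi * n / 2 ^ k * ‖α‖ := by
  have hsum : ∀ z, (∑ j, α j • tensor (ket j) (fourier j)) z =
      α (fun p => z (Sum.inl p)) * fourier (fun p => z (Sum.inl p)) fun p => z (Sum.inr p) := by
    intro z
    rw [state_apply_sum, Finset.sum_eq_single fun p => z (Sum.inl p)]
    · rw [PiLp.smul_apply, tensor_apply, ket_apply, if_pos rfl, one_mul, smul_eq_mul]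
    · intro j _ hj
      rw [PiLp.smul_apply, tensor_apply, ket_apply, if_neg (Ne.symm hj), zero_mul, smul_zero]
    · intro h; exact absurd (Finset.mem_univ _) h
  -- pointwise bound by the product state of `α` and a constant
  have hpt : ∀ z, ‖((aqfs n k).run (tensor α zeroKet) -
      ∑ j, α j • tensor (ket j) (fourier j)) z‖ ≤
        2 * Real.pi * n / 2 ^ k * ‖tensor α (uniform n) z‖ := by
    intro z
    rw [PiLp.sub_apply, hsum, run_aqfs_apply, fourier_apply_eq_prod, ← mul_sub, ← mul_sub,
      tensor_apply, uniform_apply, norm_mul, norm_mul, norm_mul, mul_comm (2 * _ * _ / _ : ℝ),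
      mul_assoc]
    refine mul_le_mul_of_nonneg_left (mul_le_mul_of_nonneg_left ?_ (norm_nonneg _)) (norm_nonneg _)
    refine (norm_prod_sub_prod_le _ _ _ (fun p _ => ?_) fun p _ => ?_).trans
      ((Finset.sum_le_sum (g := fun _ => 2 * Real.pi / 2 ^ k) fun p _ => ?_).trans (le_of_eq ?_))
    · rw [norm_prod]; exact Finset.prod_eq_one fun r _ => norm_fourierPhase _ _ _ _ _
    · rw [norm_prod]; exact Finset.prod_eq_one fun r _ => norm_fourierPhase _ _ _ _ _
    · rcases le_total k (n - p) with h | h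
      · rw [min_eq_left h, ← Finset.prod_range_mul_prod_Ico _ h, norm_sub_rev, ← mul_sub_one,
          norm_mul, norm_prod, Finset.prod_eq_one fun r _ => norm_fourierPhase _ _ _ _ _, one_mul]
        refine (norm_prod_Ico_sub_one_le _ (fun r => norm_fourierPhase _ _ _ _ _) _
          (fun r => norm_fourierPhase_sub_one_le _ _ _ _ _) h).trans (sub_le_self _ (by positivity))
      · rw [min_eq_right h, sub_self, norm_zero]; positivity
    · rw [Finset.sum_const, Finset.card_univ, Fintype.card_fin, nsmul_eq_mul]; ring
  have hu : ‖uniform n‖ = 1 := by rw [← run_hadamards_zeroKet, norm_run, norm_zeroKet]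
  have hn : ‖tensor α (uniform n)‖ = ‖α‖ := by rw [norm_tensor, hu, mul_one]
  rw [← hn, EuclideanSpace.norm_eq, EuclideanSpace.norm_eq,
    ← Real.sqrt_sq (show 0 ≤ 2 * Real.pi * n / 2 ^ k by positivity),
    ← Real.sqrt_mul (by positivity), Finset.mul_sum]
  refine Real.sqrt_le_sqrt (Finset.sum_le_sum fun z _ => ?_)
  rw [← mul_pow]
  exact pow_le_pow_left₀ (norm_nonneg _) (hpt z) 2

theorem aqfs_wellFormed (n k : ℕ) : (aqfs n k).WellFormed := by
  refine (hadamards_wellFormed Sum.inr_injective).append fun s hs => ?_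
  obtain ⟨r, -, rfl⟩ := List.mem_map.1 hs
  rw [List.flatMap_assoc, List.nodup_flatMap]
  refine ⟨fun p _ => ?_, (List.nodup_finRange n).imp fun {p q} hpq w hw hw' => ?_⟩
  · split_ifs <;> simp [Gate.wires]
  · dsimp only at hw hw'
    split_ifs at hw hw' with h h'
    · simp only [List.flatMap_singleton, Gate.wires, List.mem_cons, List.not_mem_nil,
        or_false] at hw hw'
      rcases hw with rfl | rfl <;> rcases hw' with e | e
      · have := Fin.mk.inj (Sum.inl.inj e)
        exact hpq (Fin.ext (by omega))
      · cases e
      · cases e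
      · exact hpq (Sum.inr.inj e)
    all_goals simp at hw hw'

theorem size_aqfs_le (n k : ℕ) : (aqfs n k).size ≤ n * (k + 1) := by
  have h : ∀ r : ℕ, ((List.finRange n).flatMap fun (p : Fin n) =>
      if h : (r + 1) + (p : ℕ) ≤ n then
        [Gate.crot (r + 1) (Sum.inl ⟨n - (r + 1) - p, by omega⟩ : Fin n ⊕ Fin n) (Sum.inr p)]
      else []).length ≤ n := by
    intro r
    rw [List.length_flatMap]
    refine (List.sum_le_card_nsmul _ 1 fun x hx => ?_).trans (by simp)
    obtain ⟨p, -, rfl⟩ := List.mem_map.1 hx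
    split_ifs <;> simp
  rw [aqfs, size_append, size_hadamards, size, List.map_map]
  have := List.sum_le_card_nsmul ((List.range k).map (List.length ∘ fun r =>
    (List.finRange n).flatMap fun (p : Fin n) => if h : (r + 1) + (p : ℕ) ≤ n then
        [Gate.crot (r + 1) (Sum.inl ⟨n - (r + 1) - p, by omega⟩ : Fin n ⊕ Fin n) (Sum.inr p)]
      else [])) n fun x hx => by
        obtain ⟨r, -, rfl⟩ := List.mem_map.1 hx
        exact h r
  rw [List.length_map, List.length_range, smul_eq_mul] at this
  linarith

theorem depth_aqfs (n k : ℕ) : (aqfs n k).depth = k + 1 := by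
  simp [aqfs, depth, hadamards]

end AQFS

/-! ### Arithmetic modulo `2 ^ n` on registers -/

section Arithmetic

variable {n : ℕ}

/-- Addition modulo `2 ^ n`. -/
def addBits (x y : Fin n → Bool) : Fin n → Bool := bits n (val x + val y)

/-- Subtraction modulo `2 ^ n`. -/
def subBits (x y : Fin n → Bool) : Fin n → Bool := bits n (val x + 2 ^ n - val y)

theorem addBits_subBits (x y : Fin n → Bool) : addBits (subBits x y) y = x := by
  have hy := val_lt y
  rw [addBits, subBits, ← bits_mod, val_bits, Nat.mod_add_mod, bits_mod,
    Nat.sub_add_cancel (by omega), ← bits_mod, Nat.add_mod_right, bits_mod, bits_val]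

theorem subBits_addBits (x y : Fin n → Bool) : subBits (addBits x y) y = x := by
  have hy := val_lt y
  have e : (val x + val y) % 2 ^ n + 2 ^ n - val y = (val x + val y) % 2 ^ n + (2 ^ n - val y) := by
    omega
  rw [addBits, subBits, val_bits, e, ← bits_mod, Nat.mod_add_mod]
  have e' : val x + val y + (2 ^ n - val y) = val x + 2 ^ n := by omega
  rw [e', Nat.add_mod_right, bits_mod, bits_val]

/-- Addition of `y`, as a permutation. -/
def addEquiv (y : Fin n → Bool) : (Fin n → Bool) ≃ (Fin n → Bool) where
  toFun x := addBits x y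
  invFun x := subBits x y
  left_inv x := subBits_addBits x y
  right_inv x := addBits_subBits x y

theorem addBits_comm (x y : Fin n → Bool) : addBits x y = addBits y x := by
  rw [addBits, addBits, Nat.add_comm]

theorem cis_mod (n m : ℕ) : cis ((m : ℝ) / 2 ^ n) = cis (((m % 2 ^ n : ℕ) : ℝ) / 2 ^ n) := by
  have h : (m : ℝ) / 2 ^ n = ((m / 2 ^ n : ℕ) : ℝ) + ((m % 2 ^ n : ℕ) : ℝ) / 2 ^ n := by
    have h := Nat.div_add_mod m (2 ^ n)
    rw [div_eq_iff (by positivity), add_mul, div_mul_cancel₀ _ (by positivity)]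
    exact_mod_cast (by rw [mul_comm]; exact h.symm)
  rw [h, cis_add, cis_nat, one_mul]

theorem cis_congr {n a b : ℕ} (h : a ≡ b [MOD 2 ^ n]) :
    cis ((a : ℝ) / 2 ^ n) = cis ((b : ℝ) / 2 ^ n) := by
  rw [cis_mod, h, ← cis_mod]

theorem val_addBits_modEq (x y : Fin n → Bool) : val (addBits x y) ≡ val x + val y [MOD 2 ^ n] := by
  rw [addBits, val_bits]; exact Nat.mod_modEq _ _

/-- The function `x, j ↦ e ^ (2 π i x j / 2 ^ n)`. -/
noncomputable def chi (x j : Fin n → Bool) : ℂ := cis (((val x * val j : ℕ) : ℝ) / 2 ^ n)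

theorem fourier_eq_chi (j x : Fin n → Bool) : fourier j x = nrm n * chi x j := fourier_apply j x

theorem chi_add_left (x y j : Fin n → Bool) : chi (addBits x y) j = chi x j * chi y j := by
  rw [chi, chi, chi, ← cis_add, ← add_div, ← Nat.cast_add, ← Nat.add_mul]
  exact cis_congr ((val_addBits_modEq x y).mul_right _)

theorem chi_comm (x j : Fin n → Bool) : chi x j = chi j x := by
  rw [chi, chi, mul_comm]

theorem chi_add_right (x j s : Fin n → Bool) : chi x (addBits j s) = chi x j * chi x s := by
  rw [chi_comm, chi_add_left, chi_comm j, chi_comm s]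

end Arithmetic

/-! ### Subtraction circuits and the copying of Fourier states -/

section Copy

variable {n a : ℕ}

/-- A state of two registers, together with clean ancillas. -/
noncomputable def pairState (a : ℕ) (F : (Fin n → Bool) → (Fin n → Bool) → ℂ) :
    State (Fin n ⊕ (Fin n ⊕ Fin a)) :=
  WithLp.toLp 2 fun z => F (fun i => z (Sum.inl i)) (fun i => z (Sum.inr (Sum.inl i))) *
    (zeroKet : State (Fin a)) fun i => z (Sum.inr (Sum.inr i))

theorem pairState_apply (F : (Fin n → Bool) → (Fin n → Bool) → ℂ)
    (z : Fin n ⊕ (Fin n ⊕ Fin a) → Bool) : pairState a F z =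
      F (fun i => z (Sum.inl i)) (fun i => z (Sum.inr (Sum.inl i))) *
        (zeroKet : State (Fin a)) fun i => z (Sum.inr (Sum.inr i)) := rfl

/-- The action that a subtraction family requires of its circuits. -/
def Subtracts (S : Circuit (Fin n ⊕ (Fin n ⊕ Fin a))) : Prop :=
  ∀ x y : Fin n → Bool, S.run (tensor (ket x) (tensor (ket y) zeroKet)) =
    tensor (ket (bits n (val x + 2 ^ n - val y))) (tensor (ket y) zeroKet)

theorem Subtracts.run_pairState {S : Circuit (Fin n ⊕ (Fin n ⊕ Fin a))} (hS : Subtracts S)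
    (F : (Fin n → Bool) → (Fin n → Bool) → ℂ) :
    S.run (pairState a F) = pairState a fun x y => F (addBits x y) y := by
  have hmaps : ∀ x y : Fin n → Bool, S.Maps (Sum.elim x (Sum.elim y fun _ => false))
      (Sum.elim (subBits x y) (Sum.elim y fun _ => false)) := by
    intro x y
    have := hS x y
    rwa [zeroKet, tensor_ket_ket, tensor_ket_ket, tensor_ket_ket] at this
  have elim : ∀ z : Fin n ⊕ (Fin n ⊕ Fin a) → Bool,
      (fun i => z (Sum.inr (Sum.inr i))) = (fun _ => false) →
      z = Sum.elim (fun i => z (Sum.inl i))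
        (Sum.elim (fun i => z (Sum.inr (Sum.inl i))) fun _ => false) := by
    intro z hz
    funext w
    rcases w with i | i | i
    exacts [rfl, rfl, congrFun hz i]
  ext z
  by_cases hz : (fun i => z (Sum.inr (Sum.inr i))) = fun _ => false
  · have h := hmaps (addBits (fun i => z (Sum.inl i)) fun i => z (Sum.inr (Sum.inl i)))
      fun i => z (Sum.inr (Sum.inl i))
    rw [subBits_addBits, ← elim z hz] at h
    rw [h.run_apply, pairState_apply, pairState_apply, hz]
    simp only [Sum.elim_inl, Sum.elim_inr]
  · -- no basis state with clean ancillas is mapped to one with other contents of the ancillas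
    rw [pairState_apply, zeroKet_apply, if_neg hz, mul_zero, eq_sum_ket (pairState a F), run_sum,
      state_apply_sum]
    refine Finset.sum_eq_zero fun w _ => ?_
    rw [run_smul, PiLp.smul_apply, smul_eq_mul, pairState_apply, zeroKet_apply]
    by_cases hw : (fun i => w (Sum.inr (Sum.inr i))) = fun _ => false
    · have h := hmaps (fun i => w (Sum.inl i)) fun i => w (Sum.inr (Sum.inl i))
      rw [← elim w hw, Maps] at h
      have hne : z ≠ Sum.elim (subBits (fun i => w (Sum.inl i)) fun i => w (Sum.inr (Sum.inl i)))
          (Sum.elim (fun i => w (Sum.inr (Sum.inl i))) fun _ => false) :=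
        fun e => hz (by rw [e]; rfl)
      rw [h, ket_apply, if_neg hne, mul_zero]
    · rw [if_neg hw, mul_zero, zero_mul]

theorem Subtracts.reversed_run_pairState {S : Circuit (Fin n ⊕ (Fin n ⊕ Fin a))}
    (hS : Subtracts S) (F : (Fin n → Bool) → (Fin n → Bool) → ℂ) :
    S.reversed.run (pairState a F) = pairState a fun x y => F (subBits x y) y := by
  rw [reversed_run_eq_iff, hS.run_pairState]
  simp only [subBits_addBits]

theorem tensor_zeroKet_eq (ψ φ : State (Fin n)) :
    tensor ψ (tensor φ (zeroKet : State (Fin a))) = pairState a fun x y => ψ x * φ y := by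
  ext z
  rw [tensor_apply, tensor_apply, pairState_apply, mul_assoc]

/-- Subtracting a uniformly random `y` from `x` multiplies the amplitude `chi x j` of the Fourier
state by `chi y j`, which is the Fourier state of `j` in the second register. -/
theorem run_copy {S : Circuit (Fin n ⊕ (Fin n ⊕ Fin a))} (hS : Subtracts S) (j : Fin n → Bool) :
    (copy n a S).run (tensor (fourier j) (tensor zeroKet zeroKet)) =
      tensor (fourier j) (tensor (fourier j) zeroKet) := by
  have e : (hadamards fun p => Sum.inr (Sum.inl p) : Circuit (Fin n ⊕ (Fin n ⊕ Fin a))) =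
      ((hadamards fun p : Fin n => p).relabel Sum.inl).relabel Sum.inr := by
    rw [relabel_relabel, hadamards_relabel]; rfl
  rw [copy, run_append, e, run_relabel_inr, run_relabel_inl, run_hadamards_zeroKet,
    tensor_zeroKet_eq, hS.run_pairState, tensor_zeroKet_eq]
  congr 1
  funext x y
  rw [fourier_eq_chi, fourier_eq_chi, fourier_eq_chi, chi_add_left, uniform_apply]
  ring

theorem IsSubtractionFamily.subtracts {C : ℝ} {a : ℕ → ℕ}
    {S : ∀ n : ℕ, Circuit (Fin n ⊕ (Fin n ⊕ Fin (a n)))} (h : IsSubtractionFamily C a S) (n : ℕ) :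
    Subtracts (S n) := (h.1 n).2

theorem copy_wellFormed {S : Circuit (Fin n ⊕ (Fin n ⊕ Fin a))} (hS : S.WellFormed) :
    (copy n a S).WellFormed :=
  (hadamards_wellFormed (Sum.inr_injective.comp Sum.inl_injective)).append hS

theorem size_copy (S : Circuit (Fin n ⊕ (Fin n ⊕ Fin a))) : (copy n a S).size = n + S.size := by
  rw [copy, size_append, size_hadamards]

theorem depth_copy (S : Circuit (Fin n ⊕ (Fin n ⊕ Fin a))) : (copy n a S).depth = 1 + S.depth := by
  rw [copy, depth_append, depth_hadamards]

end Copy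

/-! ### Tail estimate for phase estimation -/

section Tail

theorem norm_cis_sub_one (t : ℝ) : ‖cis t - 1‖ = 2 * |Real.sin (Real.pi * t)| := by
  rw [cis_eq_exp, Complex.norm_exp_I_mul_ofReal_sub_one, Real.norm_eq_abs, abs_mul, abs_two]
  congr 3; ring

theorem four_mul_le_norm_cis_sub_one {u : ℝ} (h0 : 0 ≤ u) (h1 : u ≤ 1 / 2) :
    4 * u ≤ ‖cis u - 1‖ := by
  have hpi := Real.pi_pos
  have h := Real.mul_le_sin (x := Real.pi * u) (by positivity) (by nlinarith)
  have e : 2 / Real.pi * (Real.pi * u) = 2 * u := by field_simp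
  rw [e] at h
  rw [norm_cis_sub_one]
  linarith [le_abs_self (Real.sin (Real.pi * u))]

theorem cis_neg (t : ℝ) : cis (-t) = (starRingEnd ℂ) (cis t) := by
  rw [cis, cis, ← Complex.exp_conj]
  congr 1
  simp [Complex.conj_ofNat]

theorem norm_cis_neg_sub_one (t : ℝ) : ‖cis (-t) - 1‖ = ‖cis t - 1‖ := by
  rw [norm_cis_sub_one, norm_cis_sub_one, mul_neg, Real.sin_neg, abs_neg]

theorem cis_nat_mul (v : ℕ) (t : ℝ) : cis (v * t) = cis t ^ v := by
  rw [cis, cis, ← Complex.exp_nat_mul]; congr 1; push_cast; ring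

/-- Geometric sums of roots of unity are bounded by the inverse distance of the angle from `0`. -/
theorem norm_sum_cis_sq_le (Q : ℕ) {t : ℝ} (h0 : t ≠ 0) (h1 : |t| < 1) :
    ‖∑ v ∈ Finset.range Q, cis (v * t)‖ ^ 2 ≤ 1 / 4 * (1 / |t| ^ 2 + 1 / (1 - |t|) ^ 2) := by
  have hgeom : ‖∑ v ∈ Finset.range Q, cis (v * t)‖ * ‖cis t - 1‖ ≤ 2 := by
    rw [← norm_mul]
    simp only [cis_nat_mul]
    rw [geom_sum_mul]
    refine (norm_sub_le _ _).trans ?_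
    rw [norm_pow, norm_cis, one_pow, norm_one]; norm_num
  have key : ∀ u : ℝ, 0 < u → 4 * u ≤ ‖cis t - 1‖ →
      ‖∑ v ∈ Finset.range Q, cis (v * t)‖ ^ 2 ≤ 1 / 4 * (1 / u ^ 2) := by
    intro u hu h
    set g := ‖∑ v ∈ Finset.range Q, cis (v * t)‖
    have hg : 0 ≤ g := norm_nonneg _
    have h2 : g * (2 * u) ≤ 1 := by nlinarith
    have h3 : (g * (2 * u)) ^ 2 ≤ 1 := pow_le_one₀ (by positivity) h2
    rw [one_div_mul_one_div, le_div_iff₀ (by positivity)]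
    nlinarith
  have habs : ‖cis t - 1‖ = ‖cis |t| - 1‖ := by
    rcases abs_choice t with h | h <;> rw [h]
    rw [norm_cis_neg_sub_one]
  have hpos : 0 < |t| := abs_pos.2 h0
  rcases le_total |t| (1 / 2) with h | h
  · refine (key |t| hpos ?_).trans ?_
    · rw [habs]; exact four_mul_le_norm_cis_sub_one hpos.le h
    · have : 0 ≤ 1 / (1 - |t|) ^ 2 := by positivity
      linarith
  · refine (key (1 - |t|) (by linarith) ?_).trans ?_
    · have e : ‖cis |t| - 1‖ = ‖cis (1 - |t|) - 1‖ := by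
        rw [sub_eq_add_neg 1 |t|, cis_add]
        have : cis 1 = 1 := by simpa using cis_nat 1
        rw [this, one_mul, norm_cis_neg_sub_one]
      rw [habs, e]; exact four_mul_le_norm_cis_sub_one (by linarith) (by linarith)
    · have : 0 ≤ 1 / |t| ^ 2 := by positivity
      linarith

/-- A tail of the series of inverse squares, by telescoping `1 / (c + s) - 1 / (c + s + 1)`. -/
theorem sum_inv_sq_le {c : ℝ} (hc : 0 < c) (R : ℕ) (x : ℕ → ℝ)
    (hx : ∀ s < R, (c + 1 + s) / 3 ≤ x s) : ∑ s ∈ Finset.range R, 1 / x s ^ 2 ≤ 9 / c := by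
  have h : ∀ R : ℕ, ∑ s ∈ Finset.range R, 9 / (c + 1 + s) ^ 2 ≤ 9 / c - 9 / (c + R) := by
    intro R
    induction R with
    | zero => simp
    | succ R ih =>
      rw [Finset.sum_range_succ]
      have h1 : 9 / (c + 1 + R) ^ 2 ≤ 9 / (c + R) - 9 / (c + (R + 1 : ℕ)) := by
        push_cast
        rw [div_sub_div _ _ (by positivity) (by positivity),
          div_le_div_iff₀ (by positivity) (by positivity)]
        have : (0 : ℝ) ≤ R := Nat.cast_nonneg R
        nlinarith
      linarith
  refine (Finset.sum_le_sum fun s hs => ?_).trans ((h R).trans (sub_le_self _ (by positivity)))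
  have h1 := hx s (Finset.mem_range.1 hs)
  have h2 : 0 < (c + 1 + s) / 3 := by positivity
  have h3 : 9 / (c + 1 + s) ^ 2 = 1 / ((c + 1 + s) / 3) ^ 2 := by field_simp; norm_num
  rw [h3]
  exact one_div_le_one_div_of_le (by positivity) (pow_le_pow_left₀ h2.le h1 2)

/-- Phase estimation with `2 k` bits gives the wrong leading `k` bits with small probability,
unless the remaining part of the phase is close to an integer. Here `N = 2 ^ k`, the phase is
`t / N ^ 2`, and the leading and the trailing bits of the integral part of `t` are `B` and `b`. -/
theorem phase_estimation_tail {N B b : ℕ} (hN : 2 ≤ N) (hB : B < N) (hb : N ≤ b ^ 2)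
    (hb' : N ≤ (N - b) ^ 2) {t : ℝ} (ht : ((B * N + b : ℕ) : ℝ) ≤ t)
    (ht' : t < ((B * N + b : ℕ) : ℝ) + 1) :
    ∑ m ∈ Finset.range (N * N) with m / N ≠ B,
      ‖∑ v ∈ Finset.range (N * N), cis (v * ((t - m) / (N * N)))‖ ^ 2 ≤
        9 * (N * N) ^ 2 / Real.sqrt N := by
  have hN0 : (0 : ℝ) < N := by exact_mod_cast (by omega : 0 < N)
  have hsN : 0 < Real.sqrt N := Real.sqrt_pos.2 hN0
  -- both `b` and `v = N - b` are at least `√N`, and at least `2`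
  have two_le : ∀ c : ℕ, N ≤ c ^ 2 → 2 ≤ c := by
    intro c hc
    by_contra h
    have : c ≤ 1 := by omega
    have : c ^ 2 ≤ 1 := by nlinarith
    omega
  have sqrt_le : ∀ c : ℕ, N ≤ c ^ 2 → Real.sqrt N ≤ c := by
    intro c hc
    rw [Real.sqrt_le_left (Nat.cast_nonneg c)]
    exact_mod_cast hc
  obtain ⟨v, hv⟩ : ∃ v, N = b + v := ⟨N - b, by have := two_le _ hb'; omega⟩
  have hvb : N - b = v := by omega
  rw [hvb] at hb'
  have hb2 := two_le b hb
  have hv2 := two_le v hb'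
  have hbR : (2 : ℝ) ≤ b := by exact_mod_cast hb2
  have hvR : (2 : ℝ) ≤ v := by exact_mod_cast hv2
  have hNR : (N : ℝ) = b + v := by exact_mod_cast hv
  obtain ⟨D, hD⟩ : ∃ D, N = B + 1 + D := ⟨N - (B + 1), by omega⟩
  have hQ : N * N = B * N + N + D * N := by
    calc N * N = (B + 1 + D) * N := by rw [← hD]
      _ = _ := by ring
  have hQR : (N : ℝ) * N = B * N + N + D * N := by exact_mod_cast hQ
  push_cast at ht ht'
  have hDN : (0 : ℝ) ≤ D * N := by positivity
  have hBN : (0 : ℝ) ≤ B * N := by positivity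
  have hNN : (0 : ℝ) < N * N := by positivity
  set f : ℕ → ℝ := fun m =>
    ‖∑ v ∈ Finset.range (N * N), cis (v * ((t - m) / (N * N)))‖ ^ 2 with hf
  have hterm : ∀ m : ℕ, t ≠ m → |t - m| < N * N →
      f m ≤ ((N * N : ℝ)) ^ 2 / 4 * (1 / |t - m| ^ 2 + 1 / (N * N - |t - m|) ^ 2) := by
    intro m h0 h1
    have e : |(t - m) / (N * N)| = |t - m| / (N * N) := by rw [abs_div, abs_of_pos hNN]
    have h := norm_sum_cis_sq_le (N * N) (t := (t - m) / (N * N))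
      (div_ne_zero (sub_ne_zero.2 h0) hNN.ne') (by rw [e, div_lt_one hNN]; exact h1)
    rw [e] at h
    refine h.trans (le_of_eq ?_)
    have h2 : 1 - |t - m| / (N * N) = (N * N - |t - m|) / (N * N) := by
      rw [sub_div, div_self hNN.ne']
    have h3 : |t - m| ≠ 0 := abs_ne_zero.2 (sub_ne_zero.2 h0)
    have h4 : (N * N : ℝ) - |t - m| ≠ 0 := by linarith
    rw [h2, div_pow, div_pow]
    field_simp
  have hsplit : ∑ m ∈ Finset.range (N * N) with m / N ≠ B, f m ≤
      ∑ s ∈ Finset.range (B * N), f (B * N - 1 - s) +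
        ∑ s ∈ Finset.range (D * N), f (B * N + N + s) := by
    rw [Finset.sum_range_reflect, Finset.range_eq_Ico, Finset.range_eq_Ico]
    have e2 : ∑ s ∈ Finset.range (D * N), f (B * N + N + s) =
        ∑ m ∈ Finset.Ico (B * N + N) (N * N), f m := by
      rw [Finset.sum_Ico_eq_sum_range]
      congr 2; omega
    rw [e2, ← Finset.sum_union]
    · refine Finset.sum_le_sum_of_subset_of_nonneg (fun m hm => ?_) fun _ _ _ => by positivity
      rw [Finset.mem_filter, Finset.mem_Ico] at hm
      rw [Finset.mem_union, Finset.mem_Ico, Finset.mem_Ico]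
      by_contra hcon
      push Not at hcon
      refine hm.2 (Nat.div_eq_of_lt_le ?_ ?_)
      · exact hcon.1 (Nat.zero_le m)
      · by_contra h
        have : (B + 1) * N = B * N + N := by ring
        exact absurd (hcon.2 (by omega)) (by omega)
    · rw [Finset.disjoint_left]
      intro m h1 h2
      rw [Finset.mem_Ico] at h1 h2
      omega
  have low : ∑ s ∈ Finset.range (B * N), f (B * N - 1 - s) ≤
      (N * N : ℝ) ^ 2 / 4 * (9 / b + 9 / v) := by
    have hcast : ∀ s < B * N, ((B * N - 1 - s : ℕ) : ℝ) = B * N - 1 - s := by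
      intro s hs
      rw [Nat.sub_sub, Nat.cast_sub (by omega)]; push_cast; ring
    have hs0 : ∀ s : ℕ, s < B * N → (s : ℝ) + 1 ≤ B * N := fun s hs => by exact_mod_cast hs
    have h1 := sum_inv_sq_le (c := b) (by linarith) (B * N)
      (fun s => |t - (B * N - 1 - s : ℕ)|) fun s hs => by
        rw [hcast s hs]
        refine le_trans ?_ (le_abs_self _)
        have : (0 : ℝ) ≤ s := Nat.cast_nonneg s
        linarith
    have h2 := sum_inv_sq_le (c := v) (by linarith) (B * N)
      (fun s => N * N - |t - (s : ℕ)|) fun s hs => by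
        have h := hs0 s hs
        have : (0 : ℝ) ≤ s := Nat.cast_nonneg s
        rw [abs_of_nonneg (by linarith)]
        linarith
    rw [← Finset.sum_range_reflect] at h2
    refine (Finset.sum_le_sum (g := fun s => ((N * N : ℝ)) ^ 2 / 4 *
      (1 / |t - (B * N - 1 - s : ℕ)| ^ 2 + 1 / (N * N - |t - (B * N - 1 - s : ℕ)|) ^ 2))
      fun s hs => ?_).trans
      (le_trans (le_of_eq ?_) (mul_le_mul_of_nonneg_left (add_le_add h1 h2) (by positivity)))
    · rw [Finset.mem_range] at hs
      have h := hs0 s hs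
      have : (0 : ℝ) ≤ s := Nat.cast_nonneg s
      refine hterm _ ?_ ?_
      · rw [hcast s hs]; intro h'; linarith
      · rw [hcast s hs, abs_lt]; constructor <;> linarith
    · rw [← Finset.mul_sum, Finset.sum_add_distrib]
  have high : ∑ s ∈ Finset.range (D * N), f (B * N + N + s) ≤
      (N * N : ℝ) ^ 2 / 4 * (9 / v + 9 / b) := by
    have hs0 : ∀ s : ℕ, s < D * N → (s : ℝ) + 1 ≤ D * N := fun s hs => by exact_mod_cast hs
    have h1 := sum_inv_sq_le (c := v) (by linarith) (D * N)
      (fun s => |t - (B * N + N + s : ℕ)|) fun s hs => by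
        push_cast
        refine le_trans ?_ (neg_le_abs _)
        have : (0 : ℝ) ≤ s := Nat.cast_nonneg s
        linarith
    have h2 := sum_inv_sq_le (c := b) (by linarith) (D * N)
      (fun s => N * N - |t - (B * N + N + (D * N - 1 - s) : ℕ)|) fun s hs => by
        have h := hs0 s hs
        have : (0 : ℝ) ≤ s := Nat.cast_nonneg s
        have e : ((D * N - 1 - s : ℕ) : ℝ) = D * N - 1 - s := by
          rw [Nat.sub_sub, Nat.cast_sub (by omega)]; push_cast; ring
        push_cast [e]
        rw [abs_of_nonpos (by linarith)]
        linarith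
    rw [Finset.sum_range_reflect (fun s => 1 / (N * N - |t - (B * N + N + s : ℕ)|) ^ 2)] at h2
    refine (Finset.sum_le_sum (g := fun s => ((N * N : ℝ)) ^ 2 / 4 *
      (1 / |t - (B * N + N + s : ℕ)| ^ 2 + 1 / (N * N - |t - (B * N + N + s : ℕ)|) ^ 2))
      fun s hs => ?_).trans
      (le_trans (le_of_eq ?_) (mul_le_mul_of_nonneg_left (add_le_add h1 h2) (by positivity)))
    · rw [Finset.mem_range] at hs
      have h := hs0 s hs
      have : (0 : ℝ) ≤ s := Nat.cast_nonneg s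
      refine hterm _ ?_ ?_
      · push_cast; intro h'; linarith
      · push_cast; rw [abs_lt]; constructor <;> linarith
    · rw [← Finset.mul_sum, Finset.sum_add_distrib]
  have hb9 : 9 / (b : ℝ) ≤ 9 / Real.sqrt N :=
    div_le_div_of_nonneg_left (by norm_num) hsN (sqrt_le b hb)
  have hv9 : 9 / (v : ℝ) ≤ 9 / Real.sqrt N :=
    div_le_div_of_nonneg_left (by norm_num) hsN (sqrt_le v hb')
  have hfin : (N * N : ℝ) ^ 2 / 4 * (9 / v + 9 / b) ≤ (N * N : ℝ) ^ 2 / 4 * (18 / Real.sqrt N) := by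
    refine mul_le_mul_of_nonneg_left ?_ (by positivity)
    have : 18 / Real.sqrt N = 9 / Real.sqrt N + 9 / Real.sqrt N := by ring
    linarith
  have e : 9 * (N * N : ℝ) ^ 2 / Real.sqrt N = (N * N : ℝ) ^ 2 / 4 * (18 / Real.sqrt N) +
      (N * N : ℝ) ^ 2 / 4 * (18 / Real.sqrt N) := by ring
  rw [e]
  rw [add_comm (9 / (b : ℝ))] at low
  linarith

end Tail

/-! ### Phase estimation on a window -/

section Window

/-- The inverse QFT of a state with linear phases is a geometric sum. -/
theorem reversed_exactQFT_run_apply (L : ℕ) (φ : ℝ) {w : State (Fin L)}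
    (hw : ∀ x, w x = cis (val x * φ)) (x : Fin L → Bool) :
    (exactQFT L).reversed.run w x = nrm L *
      ∑ v ∈ Finset.range (2 ^ L), cis (v * (φ - (val fun q => x (Fin.rev q)) / 2 ^ L)) := by
  have h1 : ∀ ψ : State (Fin L), ψ x = inner ℂ (ket x) ψ := by
    intro ψ; rw [ket, EuclideanSpace.inner_single_left]; simp
  rw [h1, ← inner_run (exactQFT L), run_reversed, exactQFT_run_ket, PiLp.inner_apply,
    ← sum_val L (fun v : ℕ => cis (v * (φ - (val fun q => x (Fin.rev q)) / 2 ^ L))),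
    Finset.mul_sum]
  refine Finset.sum_congr rfl fun y _ => ?_
  rw [RCLike.inner_apply, fourier_apply, hw, map_mul, ← cis_neg]
  have e : (starRingEnd ℂ) (nrm L) = nrm L := by rw [nrm, Complex.conj_ofReal]
  rw [e, mul_left_comm, ← cis_add]
  congr 2
  push_cast
  ring

theorem sum_rev {L : ℕ} (F : (Fin L → Bool) → ℝ) :
    ∑ x : Fin L → Bool, F (fun q => x q.rev) = ∑ x, F x :=
  Equiv.sum_comp (Equiv.arrowCongr Fin.revPerm (Equiv.refl Bool)) F

/-- The estimate `x` of a window that starts at qubit `s` disagrees with `j` in one of its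
leading `k` bits. -/
def WindowWrong {n : ℕ} (j : Fin n → Bool) (k s L : ℕ) (x : Fin L → Bool) : Prop :=
  ∃ q : Fin L, (q : ℕ) < k ∧ x q ≠ (val j).testBit (n - 1 - (s + q))

/-- A window that is cut off by the end of the register gives an exact estimate. -/
theorem reversed_exactQFT_run_eq_zero {n : ℕ} (j : Fin n → Bool) (k : ℕ) {s L : ℕ} (hL : n = s + L)
    {w : State (Fin L)} (hw : ∀ x, w x = cis (val x * (2 ^ s * val j / 2 ^ n)))
    {x : Fin L → Bool} (hx : WindowWrong j k s L x) : (exactQFT L).reversed.run w x = 0 := by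
  have e : w = (nrm L)⁻¹ • fourier (bits L (val j)) := by
    have hn : nrm L ≠ 0 := fun h => by simpa [h] using nrm_mul_self L
    ext y
    rw [PiLp.smul_apply, fourier_apply, smul_eq_mul, inv_mul_cancel_left₀ hn, hw]
    have h1 : (val y : ℝ) * (2 ^ s * val j / 2 ^ n) = ((val y * val j : ℕ) : ℝ) / 2 ^ L := by
      have h2 : (2 : ℝ) ^ n = 2 ^ s * 2 ^ L := by rw [← pow_add, ← hL]
      rw [h2]; push_cast; field_simp
    rw [h1]
    refine cis_congr ?_
    rw [val_bits]
    exact (Nat.mod_modEq _ _).symm.mul_left _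
  have e' : (exactQFT L).run (ket fun q => bits L (val j) (Fin.rev q)) =
      fourier (bits L (val j)) := by
    rw [exactQFT_run_ket, rev_comp_rev]
  rw [e, run_smul, (reversed_run_eq_iff _ _ _).2 e', PiLp.smul_apply, ket_apply, if_neg, smul_zero]
  rintro rfl
  obtain ⟨q, -, hq⟩ := hx
  refine hq ?_
  have := q.isLt
  change (val j).testBit q.rev = _
  rw [Fin.val_rev]
  congr 1
  omega

/-- A block of a good `j` has distance at least `2 ^ (k / 2)` from the multiples of `2 ^ k`, in the
form in which the tail estimate uses it. -/
theorem sq_le_of_notMem_bad {n k : ℕ} {j : Fin n → Bool} (hj : j ∉ bad n k) {i M : ℕ}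
    (hM : n = (i + 1) * k + M) :
    2 ^ k ≤ (val j / 2 ^ M % 2 ^ k) ^ 2 ∧ 2 ^ k ≤ (2 ^ k - val j / 2 ^ M % 2 ^ k) ^ 2 := by
  have h : ¬ (min (val j / 2 ^ M % 2 ^ k) (2 ^ k - val j / 2 ^ M % 2 ^ k)) ^ 2 < 2 ^ k := by
    intro h
    classical
    refine hj ((Finset.mem_filter (p := fun j : Fin n → Bool => ∃ i : ℕ, (i + 1) * k ≤ n ∧
      (min (val j / 2 ^ (n - (i + 1) * k) % 2 ^ k)
        (2 ^ k - val j / 2 ^ (n - (i + 1) * k) % 2 ^ k)) ^ 2 < 2 ^ k)).2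
      ⟨Finset.mem_univ _, i, by omega, ?_⟩)
    have e : n - (i + 1) * k = M := by omega
    rwa [e]
  push Not at h
  exact ⟨h.trans (Nat.pow_le_pow_left (min_le_left _ _) 2),
    h.trans (Nat.pow_le_pow_left (min_le_right _ _) 2)⟩

open scoped Classical in
/-- A window of `2 k` qubits gives the right leading `k` bits with high probability, unless the
bits of `j` that follow them form a bad block. -/
theorem sum_reversed_exactQFT_run_le {n k i : ℕ} (hk : 1 ≤ k) {j : Fin n → Bool}
    (hj : j ∉ bad n k) {L : ℕ} (hL : L = min (2 * k) (n - i * k)) (hi : i * k < n)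
    {w : State (Fin L)} (hw : ∀ x, w x = cis (val x * (2 ^ (i * k) * val j / 2 ^ n))) :
    ∑ x with WindowWrong j k (i * k) L x, ‖(exactQFT L).reversed.run w x‖ ^ 2 ≤
      9 / Real.sqrt (2 ^ k) * 2 ^ L := by
  rcases le_total (n - i * k) (2 * k) with h | h
  · rw [min_eq_right h] at hL
    rw [Finset.sum_eq_zero]
    · positivity
    · intro x hx
      rw [reversed_exactQFT_run_eq_zero j k (by omega) hw (Finset.mem_filter.1 hx).2]
      simp
  · rw [min_eq_left h] at hL
    obtain ⟨M, hM⟩ : ∃ M, n = i * k + 2 * k + M := ⟨n - (i * k + 2 * k), by omega⟩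
    set J := val j with hJ
    set N := 2 ^ k with hN
    set B := J / 2 ^ (M + k) % 2 ^ k with hB
    set b := J / 2 ^ M % 2 ^ k with hb
    set t : ℝ := ((J % (2 ^ M * 2 ^ (2 * k)) : ℕ) : ℝ) / 2 ^ M with ht
    obtain ⟨hb1, hb2⟩ := sq_le_of_notMem_bad hj (i := i + 1) (M := M) (by rw [hM]; ring)
    have hLN : (2 : ℕ) ^ L = N * N := by rw [hL, hN, ← pow_add]; congr 1; omega
    have hLNR : (2 : ℝ) ^ L = N * N := by exact_mod_cast hLN
    have hfl : J % (2 ^ M * 2 ^ (2 * k)) / 2 ^ M = B * N + b := by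
      rw [Nat.mod_mul_right_div_self, two_mul, pow_add, Nat.mod_mul, Nat.div_div_eq_div_mul,
        ← pow_add]
      ring
    have h2M : (0 : ℝ) < 2 ^ M := by positivity
    have ht1 : ((B * N + b : ℕ) : ℝ) ≤ t := by
      rw [← hfl, ht, le_div_iff₀ h2M]
      exact_mod_cast Nat.div_mul_le_self _ _
    have ht2 : t < ((B * N + b : ℕ) : ℝ) + 1 := by
      rw [← hfl, ht, div_lt_iff₀ h2M]
      exact_mod_cast Nat.lt_mul_of_div_lt (Nat.lt_succ_self _) (by positivity)
    have tail := phase_estimation_tail (N := N) (B := B) (b := b) (t := t)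
      (by rw [hN]; calc 2 = 2 ^ 1 := rfl
            _ ≤ 2 ^ k := Nat.pow_le_pow_right (by norm_num) hk)
      (Nat.mod_lt _ (by positivity)) hb1 hb2 ht1 ht2
    have hw' : ∀ x, w x = cis (val x * (t / (N * N))) := by
      intro x
      have e1 : (val x : ℝ) * (2 ^ (i * k) * J / 2 ^ n) =
          ((val x * J : ℕ) : ℝ) / 2 ^ (M + 2 * k) := by
        have : (2 : ℝ) ^ n = 2 ^ (i * k) * 2 ^ (M + 2 * k) := by
          rw [← pow_add]; congr 1; omega
        rw [this]; push_cast; field_simp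
      have e2 : (val x : ℝ) * (t / (N * N)) =
          ((val x * (J % (2 ^ M * 2 ^ (2 * k))) : ℕ) : ℝ) / 2 ^ (M + 2 * k) := by
        have : (2 : ℝ) ^ (M + 2 * k) = 2 ^ M * (N * N) := by rw [← hLNR, ← pow_add, hL]
        rw [ht, this]; push_cast; field_simp
      rw [hw, e1, e2]
      refine cis_congr ?_
      rw [pow_add]
      exact (Nat.mod_modEq _ _).symm.mul_left _
    have hterm : ∀ x, WindowWrong j k (i * k) L x → (val fun q => x (Fin.rev q)) / N ≠ B := by
      rintro x ⟨q, hqk, hq⟩ h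
      have hqL := q.isLt
      have h1 : x q = (val fun q => x (Fin.rev q)).testBit (q.rev : Fin L) := by
        rw [testBit_val, Fin.rev_rev]
      have h2 : ((q.rev : Fin L) : ℕ) = (k - 1 - q) + k := by rw [Fin.val_rev]; omega
      refine hq ?_
      rw [h1, h2, ← Nat.testBit_div_two_pow, ← hN, h, hB, Nat.testBit_mod_two_pow,
        Nat.testBit_div_two_pow]
      have h3 : k - 1 - (q : ℕ) < k := by omega
      have h4 : k - 1 - (q : ℕ) + (M + k) = n - 1 - (i * k + q) := by omega
      rw [h4]
      simp [h3, hJ]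
    calc ∑ x with WindowWrong j k (i * k) L x, ‖(exactQFT L).reversed.run w x‖ ^ 2
        ≤ ∑ x with (val fun q : Fin L => x (Fin.rev q)) / N ≠ B,
            ‖(exactQFT L).reversed.run w x‖ ^ 2 :=
          Finset.sum_le_sum_of_subset_of_nonneg
            (fun x hx => Finset.mem_filter.2 ⟨Finset.mem_univ _,
              hterm x (Finset.mem_filter.1 hx).2⟩) fun _ _ _ => by positivity
      _ = 1 / (N * N) * ∑ m ∈ Finset.range (N * N) with m / N ≠ B,
            ‖∑ v ∈ Finset.range (N * N), cis (v * ((t - m) / (N * N)))‖ ^ 2 := by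
          rw [Finset.sum_filter, Finset.sum_filter, Finset.mul_sum, ← hLN, ← sum_val L fun m =>
            1 / ((N : ℝ) * N) * if m / N ≠ B then
              ‖∑ v ∈ Finset.range (2 ^ L), cis (v * ((t - m) / (N * N)))‖ ^ 2 else 0,
            ← sum_rev]
          refine Finset.sum_congr rfl fun x _ => ?_
          rw [mul_ite, mul_zero]
          simp only [rev_comp_rev]
          refine if_congr Iff.rfl ?_ rfl
          rw [reversed_exactQFT_run_apply L _ hw', norm_mul, mul_pow, norm_nrm_sq, hLNR]
          simp only [rev_comp_rev, sub_div]
      _ ≤ 1 / (N * N) * (9 * (N * N) ^ 2 / Real.sqrt N) := by gcongr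
      _ = 9 / Real.sqrt (2 ^ k) * 2 ^ L := by
          have : (0 : ℝ) < N := by rw [hN]; positivity
          have e : Real.sqrt (2 ^ k) = Real.sqrt N := by rw [hN]; push_cast; rfl
          rw [hLNR, e]
          field_simp

end Window

/-! ### Structure of the phase estimation circuit -/

section Windows

variable {n : ℕ}

/-- The three Fourier registers of phase estimation. -/
abbrev FourierWire (n : ℕ) : Type := Fin n ⊕ (Fin n ⊕ Fin n)

/-- Qubit `p` of the first (`i` even) or of the second (`i` odd) of three Fourier registers. -/
def fourierCopy (i : ℕ) (p : Fin n) : FourierWire n :=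
  if i % 2 = 0 then Sum.inl p else Sum.inr (Sum.inl p)

theorem fpeCopy_eq (i : ℕ) (p : Fin n) : (fpeCopy i p : FPEWire n) = Sum.inr (fourierCopy i p) := by
  unfold fpeCopy fourierCopy
  split_ifs <;> rfl

theorem fourierCopy_injective (i : ℕ) : Function.Injective (fourierCopy i : Fin n → _) := by
  intro p q h
  unfold fourierCopy at h
  split_ifs at h
  · exact Sum.inl.inj h
  · exact Sum.inl.inj (Sum.inr.inj h)

theorem fourierCopy_eq_iff {i i' : ℕ} {p q : Fin n} :
    (fourierCopy i p : FourierWire n) = fourierCopy i' q ↔ i % 2 = i' % 2 ∧ p = q := by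
  unfold fourierCopy
  split_ifs <;> simp <;> omega

/-- The place of window `i` in a register. -/
def windowPos (n k i : ℕ) (q : Fin (min (2 * k) (n - i * k))) : Fin n :=
  ⟨i * k + q, by have := q.isLt; omega⟩

theorem windowPos_injective (n k i : ℕ) : Function.Injective (windowPos n k i) := by
  intro p q h
  have := Fin.mk.inj h
  exact Fin.ext (by omega)

/-- The place of window `i` in the Fourier registers. -/
def windowWire (n k i : ℕ) (q : Fin (min (2 * k) (n - i * k))) : FourierWire n :=
  fourierCopy i (windowPos n k i q)

theorem windowWire_injective (n k i : ℕ) : Function.Injective (windowWire n k i) :=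
  (fourierCopy_injective i).comp (windowPos_injective n k i)

theorem windowWire_disjoint (n k : ℕ) {i i' : ℕ} (hii : i ≠ i') :
    Disjoint (Set.range (windowWire n k i)) (Set.range (windowWire n k i')) := by
  rw [Set.disjoint_left]
  rintro _ ⟨q, rfl⟩ ⟨q', h⟩
  obtain ⟨hpar, hpos⟩ := fourierCopy_eq_iff.1 h
  have hpos' : i' * k + q' = i * k + q := Fin.mk.inj hpos
  have hq := q.isLt
  have hq' := q'.isLt
  rcases Nat.lt_or_gt_of_ne hii with hlt | hlt
  · have := Nat.mul_le_mul_right k (by omega : i + 2 ≤ i')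
    rw [add_mul] at this
    omega
  · have := Nat.mul_le_mul_right k (by omega : i' + 2 ≤ i)
    rw [add_mul] at this
    omega

/-- The window transforms as a circuit on the Fourier registers alone. -/
def windows (n k : ℕ) : Circuit (FourierWire n) :=
  ((List.range n).map fun i =>
    (exactQFT (min (2 * k) (n - i * k))).relabel (windowWire n k i)).foldr par []

theorem relabel_foldr_par {ι κ : Type} {τ : Type*} (g : ι → κ) (l : List τ) (f : τ → Circuit ι) :
    ((l.map f).foldr par []).relabel g = (l.map fun i => (f i).relabel g).foldr par [] := by
  induction l with
  | nil => rfl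
  | cons i l ih => rw [List.map_cons, List.foldr_cons, relabel_par, ih]; rfl

theorem windowQFTs_eq (n k : ℕ) : windowQFTs n k = (windows n k).relabel Sum.inr := by
  rw [windows, relabel_foldr_par, windowQFTs]
  congr 2
  funext i
  rw [relabel_relabel]
  congr 1
  funext q
  exact fpeCopy_eq i _

theorem windows_wellFormed (n k : ℕ) : (windows n k).WellFormed :=
  wellFormed_foldr_par _ List.nodup_range _ (fun i => Set.range (windowWire n k i))
    (fun _ _ => (exactQFT_wellFormed _).relabel (windowWire_injective n k _))
    (fun _ _ => relabel_on_range _ _) fun _ _ _ _ h => windowWire_disjoint n k h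

theorem windowQFTs_wellFormed (n k : ℕ) : (windowQFTs n k).WellFormed := by
  rw [windowQFTs_eq]; exact (windows_wellFormed n k).relabel Sum.inr_injective

theorem xor_wires_injective (n k : ℕ) : Function.Injective
    (Sum.elim (fun p : Fin n => (fpeCopy ((p : ℕ) / k) p : FPEWire n))
      fun p : Fin n => Sum.inl p.rev) := by
  rintro (p | p) (q | q) h
  · simp only [Sum.elim_inl, fpeCopy_eq] at h
    rw [(fourierCopy_eq_iff.1 (Sum.inr.inj h)).2]
  · simp [fpeCopy_eq] at h
  · simp [fpeCopy_eq] at h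
  · rw [Fin.rev_injective (Sum.inl.inj h)]

theorem fpe_wellFormed (n k : ℕ) : (fpe n k).WellFormed :=
  ((windowQFTs_wellFormed n k).reversed.append
    (cnots_wellFormed (xor_wires_injective n k))).append (windowQFTs_wellFormed n k)

/-- Every qubit lies in at most two windows. -/
theorem sum_window_length_le (n k m : ℕ) :
    ((List.range m).map fun i => min (2 * k) (n - i * k)).sum ≤ 2 * min n (m * k) := by
  induction m with
  | zero => simp
  | succ m ih =>
    rw [List.range_succ, List.map_append, List.sum_append, List.map_singleton, List.sum_singleton,
      add_mul]
    omega

theorem size_windows_le (n k : ℕ) : (windows n k).size ≤ 4 * (n * k) := by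
  rw [windows, size_foldr_par]
  have h : ∀ i ∈ List.range n, ((exactQFT (min (2 * k) (n - i * k))).relabel
      (windowWire n k i)).size ≤ 2 * k * min (2 * k) (n - i * k) := by
    intro i _
    rw [size_relabel]
    exact (size_exactQFT_le _).trans (Nat.mul_le_mul_right _ (min_le_left _ _))
  refine (List.sum_le_sum h).trans ?_
  rw [List.sum_map_mul_left]
  calc _ ≤ 2 * k * (2 * min n (n * k)) := Nat.mul_le_mul_left _ (sum_window_length_le n k n)
    _ ≤ 2 * k * (2 * n) := by gcongr; exact min_le_left _ _
    _ = 4 * (n * k) := by ring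

theorem size_fpe_le {k : ℕ} (hk : 1 ≤ k) (n : ℕ) : (fpe n k).size ≤ 11 * (n * k) := by
  have h := size_windows_le n k
  have h' := Nat.le_mul_of_pos_right n hk
  rw [fpe, size_append, size_append, size_reversed, windowQFTs_eq, size_relabel, size_cnots]
  omega

theorem depth_windows_le {k : ℕ} (hk : 1 ≤ k) (n : ℕ) : (windows n k).depth ≤ 4 * k - 1 :=
  depth_foldr_par_le _ _ _ fun i _ => by
    rw [depth_relabel, depth_exactQFT]
    have := min_le_left (2 * k) (n - i * k)
    omega

theorem depth_fpe_le {k : ℕ} (hk : 1 ≤ k) (n : ℕ) : (fpe n k).depth ≤ 8 * k + 1 := by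
  have h := depth_windows_le hk n
  rw [fpe, depth_append, depth_append, depth_reversed, windowQFTs_eq, depth_relabel, depth_cnots]
  omega

theorem windows_on (n k : ℕ) :
    (windows n k).On (Set.range fun p => Sum.inr (Sum.inr p))ᶜ := by
  refine on_foldr_par (on_nil _) _ _ fun i _ => (relabel_on_range _ _).mono ?_
  rintro _ ⟨q, rfl⟩ ⟨p, hp⟩
  unfold windowWire fourierCopy at hp
  split_ifs at hp
  all_goals simp at hp

end Windows

/-! ### Bad blocks -/

section BadBlocks

/-- Few residues are close to a multiple of `N`. -/
theorem card_near_multiple_le {N : ℕ} (hN : 1 ≤ N) :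
    (((Finset.range N).filter fun b => (min b (N - b)) ^ 2 < N).card : ℝ) ≤ 4 * Real.sqrt N := by
  have hsub : ((Finset.range N).filter fun b => (min b (N - b)) ^ 2 < N) ⊆
      Finset.range (N.sqrt + 1) ∪ (Finset.range (N.sqrt + 1)).image fun c => N - c := by
    intro b hb
    rw [Finset.mem_filter, Finset.mem_range] at hb
    rw [Finset.mem_union, Finset.mem_image]
    have h : min b (N - b) ≤ N.sqrt := Nat.le_sqrt'.2 hb.2.le
    rcases min_le_iff.1 h with h | h
    · exact Or.inl (Finset.mem_range.2 (by omega))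
    · exact Or.inr ⟨N - b, Finset.mem_range.2 (by omega), by omega⟩
  have h1 := (Finset.card_le_card hsub).trans
    ((Finset.card_union_le _ _).trans (add_le_add le_rfl Finset.card_image_le))
  rw [Finset.card_range] at h1
  have h2 : (1 : ℝ) ≤ Real.sqrt N := Real.one_le_sqrt.2 (by exact_mod_cast hN)
  have h3 := Real.nat_sqrt_le_real_sqrt (a := N)
  have h4 : (((Finset.range N).filter fun b => (min b (N - b)) ^ 2 < N).card : ℝ) ≤
      (N.sqrt + 1) + (N.sqrt + 1) := by exact_mod_cast h1
  linarith

open scoped Classical in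
/-- Each block of `k` bits is uniformly distributed. -/
theorem card_block_mem_le {n k i M : ℕ} (hM : n = (i + 1) * k + M) (T : Finset ℕ) :
    (Finset.univ.filter fun j : Fin n → Bool => val j / 2 ^ M % 2 ^ k ∈ T).card ≤
      T.card * 2 ^ (n - k) := by
  rw [← Finset.card_range (2 ^ (n - k)), ← Finset.card_product]
  refine Finset.card_le_card_of_injOn
    (fun j => (val j / 2 ^ M % 2 ^ k, val j / 2 ^ M / 2 ^ k * 2 ^ M + val j % 2 ^ M))
    (fun j hj => ?_) fun j _ j' _ h => ?_
  · refine Finset.mem_product.2 ⟨(Finset.mem_filter.1 hj).2, Finset.mem_range.2 ?_⟩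
    have h1 : val j / 2 ^ M / 2 ^ k < 2 ^ (i * k) := by
      rw [Nat.div_div_eq_div_mul, ← pow_add, Nat.div_lt_iff_lt_mul (by positivity), ← pow_add]
      have e : i * k + (M + k) = n := by rw [hM]; ring
      rw [e]; exact val_lt j
    have h2 := Nat.mod_lt (val j) (show 0 < 2 ^ M by positivity)
    have e : n - k = i * k + M := by rw [hM, add_mul]; omega
    rw [e, pow_add]
    calc val j / 2 ^ M / 2 ^ k * 2 ^ M + val j % 2 ^ M
        < val j / 2 ^ M / 2 ^ k * 2 ^ M + 2 ^ M := Nat.add_lt_add_left h2 _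
      _ = (val j / 2 ^ M / 2 ^ k + 1) * 2 ^ M := by ring
      _ ≤ _ := Nat.mul_le_mul_right _ h1
  · obtain ⟨h1, h2⟩ := Prod.mk.inj h
    have hp : 0 < 2 ^ M := by positivity
    have hlo : val j % 2 ^ M = val j' % 2 ^ M := by
      have := congrArg (· % 2 ^ M) h2
      simpa [Nat.mul_add_mod_self_right] using this
    have hhi : val j / 2 ^ M / 2 ^ k = val j' / 2 ^ M / 2 ^ k := by
      rw [hlo] at h2
      exact Nat.eq_of_mul_eq_mul_right hp (Nat.add_right_cancel h2)
    have hq : val j / 2 ^ M = val j' / 2 ^ M := by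
      rw [← Nat.div_add_mod (val j / 2 ^ M) (2 ^ k), ← Nat.div_add_mod (val j' / 2 ^ M) (2 ^ k),
        hhi]
      exact congrArg _ h1
    refine val_injective ?_
    rw [← Nat.div_add_mod (val j) (2 ^ M), ← Nat.div_add_mod (val j') (2 ^ M), hq, hlo]

/-- There are at most `n` blocks, each of them bad for at most `4 * 2 ^ (k / 2)` of its `2 ^ k`
values. -/
theorem card_bad_le {k : ℕ} (hk : 1 ≤ k) (n : ℕ) :
    ((bad n k).card : ℝ) ≤ 4 * (n / Real.sqrt (2 ^ k)) * 2 ^ n := by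
  classical
  set T := (Finset.range (2 ^ k)).filter fun b => (min b (2 ^ k - b)) ^ 2 < 2 ^ k with hT
  have hsub : bad n k ⊆ ((Finset.range n).filter fun i => (i + 1) * k ≤ n).biUnion fun i =>
      Finset.univ.filter fun j : Fin n → Bool => val j / 2 ^ (n - (i + 1) * k) % 2 ^ k ∈ T := by
    intro j hj
    obtain ⟨i, hi, h⟩ := (Finset.mem_filter.1 hj).2
    refine Finset.mem_biUnion.2 ⟨i, Finset.mem_filter.2 ⟨Finset.mem_range.2 ?_, hi⟩,
      Finset.mem_filter.2 ⟨Finset.mem_univ _, Finset.mem_filter.2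
        ⟨Finset.mem_range.2 (Nat.mod_lt _ (by positivity)), h⟩⟩⟩
    have := Nat.le_mul_of_pos_right (i + 1) hk
    omega
  rcases Nat.lt_or_ge n k with hnk | hnk
  · have : bad n k = ∅ := by
      refine Finset.subset_empty.1 (hsub.trans ?_)
      intro j hj
      obtain ⟨i, hi, -⟩ := Finset.mem_biUnion.1 hj
      have h1 := (Finset.mem_filter.1 hi).2
      rw [add_mul] at h1
      omega
    rw [this, Finset.card_empty, Nat.cast_zero]
    positivity
  have h1 : (bad n k).card ≤ n * (T.card * 2 ^ (n - k)) := by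
    refine (Finset.card_le_card hsub).trans ((Finset.card_biUnion_le_card_mul _ _ _
      fun i hi => ?_).trans (Nat.mul_le_mul_right _ ((Finset.card_filter_le _ _).trans
        (Finset.card_range n).le)))
    have := (Finset.mem_filter.1 hi).2
    exact card_block_mem_le (i := i) (by omega) T
  have h2 := card_near_multiple_le (N := 2 ^ k) Nat.one_le_two_pow
  rw [← hT] at h2
  push_cast at h2
  have hs : (0 : ℝ) < Real.sqrt (2 ^ k) := by positivity
  have hss : Real.sqrt (2 ^ k) * Real.sqrt (2 ^ k) = 2 ^ k := Real.mul_self_sqrt (by positivity)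
  have e : (2 : ℝ) ^ n = 2 ^ k * 2 ^ (n - k) := by rw [← pow_add]; congr 1; omega
  calc ((bad n k).card : ℝ) ≤ n * (T.card * 2 ^ (n - k)) := by exact_mod_cast h1
    _ ≤ n * (4 * Real.sqrt (2 ^ k) * 2 ^ (n - k)) := by gcongr
    _ = 4 * (n / Real.sqrt (2 ^ k)) * 2 ^ n := by
      generalize Real.sqrt (2 ^ k) = r at hs hss
      rw [e, ← hss]; field_simp

end BadBlocks

/-! ### Error of phase estimation -/

section FPE

variable {ι κ : Type} [DecidableEq ι] [DecidableEq κ] [Fintype ι] [Fintype κ]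

theorem norm_sq_eq_sum (ψ : State ι) : ‖ψ‖ ^ 2 = ∑ z, ‖ψ z‖ ^ 2 := EuclideanSpace.norm_sq_eq ψ

theorem sum_sum_assign {M : Type*} [AddCommMonoid M] (F : (ι ⊕ κ → Bool) → M) :
    ∑ z, F z = ∑ d, ∑ m, F (Sum.elim d m) := by
  rw [← Fintype.sum_prod_type']
  exact (Equiv.sum_comp (Equiv.sumArrowEquivProdArrow ι κ Bool).symm F).symm

open scoped Classical in
/-- The probability of an event does not change when a circuit runs on qubits that the event does
not involve. -/
theorem sum_filter_run {C : Circuit ι} {s : Set ι} (hC : C.On s) (P : (ι → Bool) → Prop)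
    (hP : ∀ w ∈ s, ∀ x b, P (Function.update x w b) ↔ P x) (ψ : State ι) :
    ∑ x with P x, ‖C.run ψ x‖ ^ 2 = ∑ x with P x, ‖ψ x‖ ^ 2 := by
  set φ : State ι := WithLp.toLp 2 fun x => (if P x then 1 else 0) * ψ x with hφ
  have h1 := run_mul hC (fun x => if P x then (1 : ℂ) else 0)
    (fun w hw x b => by simp only [hP w hw x b]) (ψ := ψ) (φ := φ) fun x => rfl
  have h2 : ∀ χ χ' : State ι, (∀ x, χ' x = (if P x then (1 : ℂ) else 0) * χ x) →
      ‖χ'‖ ^ 2 = ∑ x with P x, ‖χ x‖ ^ 2 := by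
    intro χ χ' h
    rw [norm_sq_eq_sum, Finset.sum_filter]
    refine Finset.sum_congr rfl fun x _ => ?_
    rw [h]
    split_ifs <;> simp
  rw [← h2 _ _ h1, norm_run, h2 ψ φ fun _ => rfl]

open scoped Classical in
/-- The probability of an event that concerns only the qubits of a relabelled circuit is bounded
slice by slice. -/
theorem sum_filter_run_relabel_le {f : ι → κ} (hf : Function.Injective f) (C : Circuit ι)
    (Ψ : State κ) (P : (ι → Bool) → Prop) {ε : ℝ}
    (h : ∀ z, ∑ x with P x, ‖C.run (slice f Ψ z) x‖ ^ 2 ≤ ε * ∑ x, ‖slice f Ψ z x‖ ^ 2) :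
    ∑ z with P (z ∘ f), ‖(C.relabel f).run Ψ z‖ ^ 2 ≤ ε * ‖Ψ‖ ^ 2 := by
  have h1 := sum_extend hf fun z x => if P x then ‖C.run (slice f Ψ z) x‖ ^ 2 else 0
  have h2 := sum_extend hf fun z _ => ‖Ψ z‖ ^ 2
  simp only [slice_extend hf, ← run_relabel_apply hf, Finset.sum_const, nsmul_eq_mul,
    ← Finset.mul_sum] at h1 h2
  have h3 : ∑ z, ∑ x, (if P x then ‖C.run (slice f Ψ z) x‖ ^ 2 else 0) ≤
      ε * ∑ z, ∑ x, ‖Ψ (Function.extend f x z)‖ ^ 2 := by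
    rw [Finset.mul_sum]
    refine Finset.sum_le_sum fun z _ => ?_
    rw [← Finset.sum_filter]
    exact h z
  rw [← h1, h2, mul_left_comm] at h3
  have hpos : (0 : ℝ) < (Finset.univ : Finset (ι → Bool)).card := by
    exact_mod_cast Finset.card_pos.2 Finset.univ_nonempty
  rw [Finset.sum_filter, norm_sq_eq_sum]
  exact le_of_mul_le_mul_left h3 hpos

/-- States with disjoint supports are orthogonal. -/
theorem norm_sum_sq_of_disjoint {τ : Type*} [Fintype τ] (E : τ → State ι) (g : (ι → Bool) → τ)
    (h : ∀ j z, g z ≠ j → E j z = 0) : ‖∑ j, E j‖ ^ 2 = ∑ j, ‖E j‖ ^ 2 := by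
  simp only [norm_sq_eq_sum, state_apply_sum]
  rw [Finset.sum_comm]
  refine Finset.sum_congr rfl fun z _ => ?_
  rw [Finset.sum_eq_single (g z) (fun j _ hj => h j z hj.symm) (by simp),
    Finset.sum_eq_single (g z) (fun j _ hj => by rw [h j z hj.symm]; simp) (by simp)]

variable {n : ℕ}

theorem val_extend {L s : ℕ} {pos : Fin L → Fin n} (hpos : ∀ q, (pos q : ℕ) = s + q)
    (x : Fin L → Bool) (u : Fin n → Bool) :
    val (Function.extend pos x u) =
      val (Function.extend pos (fun _ => false) u) + 2 ^ s * val x := by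
  have hinj : Function.Injective pos := by
    intro p q h
    have := congrArg Fin.val h
    rw [hpos, hpos] at this
    exact Fin.ext (by omega)
  have h1 : 2 ^ s * val x =
      ∑ p : Fin n, Function.extend pos (fun q => if x q then 2 ^ (s + (q : ℕ)) else 0) 0 p := by
    rw [val, Finset.mul_sum]
    refine Fintype.sum_of_injective pos hinj _ _ (fun p hp => ?_) fun q => ?_
    · rw [Function.extend_apply' _ _ _ hp, Pi.zero_apply]
    · rw [hinj.extend_apply, mul_ite, mul_zero, pow_add]
  rw [h1, val, val, ← Finset.sum_add_distrib]
  refine Finset.sum_congr rfl fun p _ => ?_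
  by_cases hp : ∃ q, pos q = p
  · obtain ⟨q, rfl⟩ := hp
    simp only [hinj.extend_apply, hpos]
    simp
  · simp only [Function.extend_apply' _ _ _ hp, Pi.zero_apply, add_zero]

/-- On a window of consecutive qubits a Fourier state has linear phases. -/
theorem exists_fourier_extend {L s : ℕ} {pos : Fin L → Fin n} (hpos : ∀ q, (pos q : ℕ) = s + q)
    (j u : Fin n → Bool) : ∃ c : ℂ, ∀ x, fourier j (Function.extend pos x u) =
      c * cis (val x * (2 ^ s * val j / 2 ^ n)) := by
  refine ⟨nrm n * cis (((val (Function.extend pos (fun _ => false) u) * val j : ℕ) : ℝ) / 2 ^ n),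
    fun x => ?_⟩
  rw [fourier_apply, val_extend hpos, mul_assoc, ← cis_add]
  congr 2
  push_cast
  ring

theorem extend_inl_comp {α β γ : Type} (g : α → β) (x : α → Bool) (z : β ⊕ γ → Bool) :
    (fun p => Function.extend (fun q => (Sum.inl (g q) : β ⊕ γ)) x z (Sum.inl p)) =
      Function.extend g x fun p => z (Sum.inl p) := by
  classical
  funext p
  simp only [Function.extend_def, Sum.inl.injEq]

theorem extend_inr_comp {α β γ : Type} (g : α → β) (x : α → Bool) (z : γ ⊕ β → Bool) :
    (fun p => Function.extend (fun q => (Sum.inr (g q) : γ ⊕ β)) x z (Sum.inr p)) =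
      Function.extend g x fun p => z (Sum.inr p) := by
  classical
  funext p
  simp only [Function.extend_def, Sum.inr.injEq]

theorem extend_inl_comp_inr {α β γ : Type} (g : α → β) (x : α → Bool) (z : β ⊕ γ → Bool) :
    (fun p => Function.extend (fun q => (Sum.inl (g q) : β ⊕ γ)) x z (Sum.inr p)) =
      fun p => z (Sum.inr p) := by
  funext p
  rw [Function.extend_apply']
  rintro ⟨q, hq⟩
  cases hq

theorem extend_inr_comp_inl {α β γ : Type} (g : α → β) (x : α → Bool) (z : γ ⊕ β → Bool) :
    (fun p => Function.extend (fun q => (Sum.inr (g q) : γ ⊕ β)) x z (Sum.inl p)) =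
      fun p => z (Sum.inl p) := by
  funext p
  rw [Function.extend_apply']
  rintro ⟨q, hq⟩
  cases hq

theorem exists_slice_window (k i : ℕ) (j : Fin n → Bool) (φ : State (Fin n))
    (z : FourierWire n → Bool) : ∃ c : ℂ, ∀ x,
    slice (windowWire n k i) (tensor (fourier j) (tensor (fourier j) φ)) z x =
      c * cis (val x * (2 ^ (i * k) * val j / 2 ^ n)) := by
  have hpos : ∀ q, (windowPos n k i q : ℕ) = i * k + q := fun _ => rfl
  by_cases hi : i % 2 = 0
  · have e : windowWire n k i = fun q => Sum.inl (windowPos n k i q) := by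
      funext q; rw [windowWire, fourierCopy, if_pos hi]
    obtain ⟨c, hc⟩ := exists_fourier_extend hpos j fun p => z (Sum.inl p)
    refine ⟨c * (tensor (fourier j) φ) fun p => z (Sum.inr p), fun x => ?_⟩
    rw [slice_apply, e, tensor_apply, extend_inl_comp, extend_inl_comp_inr, hc]
    ring
  · have e : windowWire n k i = fun q => Sum.inr (Sum.inl (windowPos n k i q)) := by
      funext q; rw [windowWire, fourierCopy, if_neg hi]
    obtain ⟨c, hc⟩ := exists_fourier_extend hpos j fun p => z (Sum.inr (Sum.inl p))
    refine ⟨fourier j (fun p => z (Sum.inl p)) * (c * φ fun p => z (Sum.inr (Sum.inr p))),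
      fun x => ?_⟩
    rw [slice_apply, e, tensor_apply, extend_inr_comp_inl, extend_inr_comp, tensor_apply,
      extend_inl_comp, extend_inl_comp_inr, hc]
    ring

open scoped Classical in
/-- The probability that window `i` gives a wrong estimate. -/
theorem sum_window_wrong_le {k i : ℕ} (hk : 1 ≤ k) {j : Fin n → Bool} (hj : j ∉ bad n k)
    (hi : i * k < n) (φ : State (Fin n)) :
    ∑ m with WindowWrong j k (i * k) _ (m ∘ windowWire n k i),
      ‖(windows n k).reversed.run (tensor (fourier j) (tensor (fourier j) φ)) m‖ ^ 2 ≤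
        9 / Real.sqrt (2 ^ k) * ‖φ‖ ^ 2 := by
  have hin : i ∈ List.range n := List.mem_range.2 (by
    have := Nat.le_mul_of_pos_right i hk
    omega)
  obtain ⟨D, hD, hrun⟩ := exists_run_foldr_par (List.range n) List.nodup_range
    (fun i => (exactQFT (min (2 * k) (n - i * k))).relabel (windowWire n k i))
    (fun i => Set.range (windowWire n k i)) (fun i _ => relabel_on_range _ _)
    (fun _ _ _ _ h => windowWire_disjoint n k h) hin
  set ρ : State (FourierWire n) := tensor (fourier j) (tensor (fourier j) φ) with hρ
  set W := (exactQFT (min (2 * k) (n - i * k))).reversed with hW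
  have h1 : (windows n k).reversed.run ρ =
      D.reversed.run ((W.relabel (windowWire n k i)).run ρ) := by
    rw [reversed_run_eq_iff, windows, hrun, run_reversed, hW, ← relabel_reversed, run_reversed]
  rw [h1, sum_filter_run hD.reversed]
  · refine (sum_filter_run_relabel_le (windowWire_injective n k i) W ρ _
      (ε := 9 / Real.sqrt (2 ^ k)) fun z => ?_).trans (le_of_eq ?_)
    · obtain ⟨c, hc⟩ := exists_slice_window k i j φ z
      set w : State (Fin (min (2 * k) (n - i * k))) :=
        WithLp.toLp 2 fun x => cis (val x * (2 ^ (i * k) * val j / 2 ^ n)) with hw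
      have e : slice (windowWire n k i) ρ z = c • w := by
        ext x; exact hc x
      have h2 := sum_reversed_exactQFT_run_le hk hj rfl hi (w := w) fun x => rfl
      have h3 : ∑ x, ‖(c • w) x‖ ^ 2 = ‖c‖ ^ 2 * 2 ^ min (2 * k) (n - i * k) := by
        have : ∀ x, ‖(c • w) x‖ ^ 2 = ‖c‖ ^ 2 := by
          intro x
          rw [PiLp.smul_apply, norm_smul, hw]
          change (‖c‖ * ‖cis _‖) ^ 2 = _
          rw [norm_cis, mul_one]
        simp only [this, Finset.sum_const, Finset.card_univ, Fintype.card_fun, Fintype.card_bool,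
          Fintype.card_fin, nsmul_eq_mul]
        push_cast; ring
      rw [e, run_smul, h3]
      simp only [PiLp.smul_apply, norm_smul, mul_pow, ← Finset.mul_sum]
      refine (mul_le_mul_of_nonneg_left h2 (by positivity)).trans (le_of_eq ?_)
      ring
    · rw [hρ, norm_tensor, norm_tensor, norm_fourier, one_mul, one_mul]
  · intro v hv x b
    have : Function.update x v b ∘ windowWire n k i = x ∘ windowWire n k i := by
      funext q
      exact Function.update_of_ne (fun h => hv ⟨q, h⟩) _ _
    rw [this]

/-- The estimate of `j` that is read off from the windows. -/
def estimate (n k : ℕ) (m : FourierWire n → Bool) (p : Fin n) : Bool :=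
  m (fourierCopy ((p.rev : ℕ) / k) p.rev)

theorem exists_windowWrong {k : ℕ} (hk : 1 ≤ k) {j : Fin n → Bool} {m : FourierWire n → Bool}
    (h : estimate n k m ≠ j) :
    ∃ i, i * k < n ∧ WindowWrong j k (i * k) _ (m ∘ windowWire n k i) := by
  obtain ⟨p, hp⟩ := Function.ne_iff.1 h
  set r : Fin n := p.rev with hr
  have hrn := r.isLt
  have h1 : (r : ℕ) / k * k + (r : ℕ) % k = r := by rw [mul_comm]; exact Nat.div_add_mod _ _
  have h2 := Nat.mod_lt (r : ℕ) (show 0 < k by omega)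
  refine ⟨(r : ℕ) / k, by omega, ⟨(r : ℕ) % k, by omega⟩, h2, ?_⟩
  have e1 : windowPos n k ((r : ℕ) / k) ⟨(r : ℕ) % k, by omega⟩ = r := Fin.ext h1
  have e2 : n - 1 - ((r : ℕ) / k * k + (r : ℕ) % k) = (p : ℕ) := by
    rw [h1, hr, Fin.val_rev]; omega
  change m (windowWire n k _ _) ≠ (val j).testBit (n - 1 - ((r : ℕ) / k * k + (r : ℕ) % k))
  rw [windowWire, e1, e2, testBit_val]
  exact hp

theorem run_xor_apply (k : ℕ) (ψ : State (FPEWire n)) (z : FPEWire n → Bool) :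
    (cnots (fun p : Fin n => (fpeCopy ((p : ℕ) / k) p : FPEWire n)) (fun p => Sum.inl p.rev)).run
      ψ z = ψ (Sum.elim (fun p => z (Sum.inl p) ^^ estimate n k (fun w => z (Sum.inr w)) p)
        fun w => z (Sum.inr w)) := by
  refine (maps_cnots (xor_wires_injective n k) (fun p => ?_) fun w hw => ?_).run_apply ψ
  · rw [fpeCopy_eq, Sum.elim_inl, Sum.elim_inr, estimate, Fin.rev_rev, Bool.xor_assoc,
      Bool.xor_self, Bool.xor_false]
  · rcases w with p | w
    · exact absurd (congrArg Sum.inl (Fin.rev_rev p)) (hw p.rev)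
    · rfl

open scoped Classical in
/-- The error of phase estimation is controlled by the probability of a wrong estimate. -/
theorem norm_fpe_sub_sq_le (k : ℕ) (j : Fin n → Bool) (ρ : State (FourierWire n)) :
    ‖(fpe n k).run (tensor (ket j) ρ) - tensor zeroKet ρ‖ ^ 2 ≤
      2 * ∑ m with estimate n k m ≠ j, ‖(windows n k).reversed.run ρ m‖ ^ 2 := by
  set θ := (windows n k).reversed.run ρ with hθ
  have h1 : ∀ ψ : State (Fin n), (windowQFTs n k).reversed.run (tensor ψ ρ) = tensor ψ θ := by
    intro ψ
    rw [windowQFTs_eq, relabel_reversed, run_relabel_inr]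
  have h2 : tensor zeroKet ρ = (windowQFTs n k).run (tensor zeroKet θ) := by
    rw [← h1, run_reversed]
  rw [h2, fpe, run_append, run_append, h1, ← run_sub, norm_run, norm_sq_eq_sum, sum_sum_assign,
    Finset.sum_comm, Finset.sum_filter, Finset.mul_sum]
  refine Finset.sum_le_sum fun m _ => ?_
  have hxor : ∀ d : Fin n → Bool, (fun p => d p ^^ estimate n k m p) = j ↔
      d = fun p => j p ^^ estimate n k m p := by
    intro d
    constructor
    · rintro rfl; funext p; simp
    · rintro rfl; funext p; simp
  have hterm : ∀ d : Fin n → Bool,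
      ‖((cnots (fun p : Fin n => (fpeCopy ((p : ℕ) / k) p : FPEWire n))
        (fun p => Sum.inl p.rev)).run (tensor (ket j) θ) - tensor zeroKet θ :
          State (FPEWire n)) (Sum.elim d m)‖ ^ 2 =
        ((if d = fun p => j p ^^ estimate n k m p then (1 : ℝ) else 0) -
          if d = fun _ => false then 1 else 0) ^ 2 * ‖θ m‖ ^ 2 := by
    intro d
    rw [PiLp.sub_apply, run_xor_apply, tensor_apply, tensor_apply, ket_apply, zeroKet_apply]
    simp only [Sum.elim_inl, Sum.elim_inr, hxor]
    rw [← sub_mul, norm_mul, mul_pow]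
    congr 1
    change ‖(if _ then (1 : ℂ) else 0) - (if d = fun _ => false then 1 else 0)‖ ^ 2 = _
    split_ifs <;> simp
  simp only [hterm, ← Finset.sum_mul]
  by_cases h : estimate n k m = j
  · rw [if_neg (not_not.2 h), mul_zero, h]
    simp
  · rw [if_pos h]
    refine mul_le_mul_of_nonneg_right ?_ (by positivity)
    calc _ ≤ ∑ d : Fin n → Bool, ((if d = fun p => j p ^^ estimate n k m p then (1 : ℝ) else 0) +
          if d = fun _ => false then 1 else 0) :=
        Finset.sum_le_sum fun d _ => by split_ifs <;> norm_num
      _ = 2 := by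
        rw [Finset.sum_add_distrib, Finset.sum_ite_eq', Finset.sum_ite_eq']
        norm_num

/-- The union bound. -/
theorem sum_filter_le_of_exists {τ σ : Type*} [Fintype σ] (s : Finset τ) {P : σ → Prop}
    [DecidablePred P] (Q : τ → σ → Prop) [∀ i, DecidablePred (Q i)]
    (h : ∀ m, P m → ∃ i ∈ s, Q i m) {f : σ → ℝ} (hf : ∀ m, 0 ≤ f m) :
    ∑ m with P m, f m ≤ ∑ i ∈ s, ∑ m with Q i m, f m := by
  simp only [Finset.sum_filter]
  rw [Finset.sum_comm]
  have h0 : ∀ i m, 0 ≤ if Q i m then f m else 0 := fun i m => by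
    split_ifs
    exacts [hf m, le_rfl]
  refine Finset.sum_le_sum fun m _ => ?_
  split_ifs with hm
  · obtain ⟨i, hi, hQ⟩ := h m hm
    exact (if_pos hQ).symm.le.trans
      (Finset.single_le_sum (f := fun i => if Q i m then f m else 0) (fun i _ => h0 i m) hi)
  · exact Finset.sum_nonneg fun i _ => h0 i m

/-- Phase estimation succeeds, up to a small error, on a good `j`. -/
theorem norm_fpe_ket_sub_sq_le {k : ℕ} (hk : 1 ≤ k) {j : Fin n → Bool} (hj : j ∉ bad n k)
    (φ : State (Fin n)) :
    ‖(fpe n k).run (tensor (ket j) (tensor (fourier j) (tensor (fourier j) φ))) -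
      tensor zeroKet (tensor (fourier j) (tensor (fourier j) φ))‖ ^ 2 ≤
        18 * (n / Real.sqrt (2 ^ k)) * ‖φ‖ ^ 2 := by
  classical
  refine (norm_fpe_sub_sq_le k j _).trans ?_
  set ρ : State (FourierWire n) := tensor (fourier j) (tensor (fourier j) φ) with hρ
  have hU := sum_filter_le_of_exists ((Finset.range n).filter fun i => i * k < n)
    (P := fun m => estimate n k m ≠ j)
    (fun i m => WindowWrong j k (i * k) _ (m ∘ windowWire n k i)) (fun m hm => by
      obtain ⟨i, hi, h⟩ := exists_windowWrong hk hm
      have := Nat.le_mul_of_pos_right i hk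
      exact ⟨i, Finset.mem_filter.2 ⟨Finset.mem_range.2 (by omega), hi⟩, h⟩)
    (f := fun m => ‖(windows n k).reversed.run ρ m‖ ^ 2) (fun _ => sq_nonneg _)
  have hW := Finset.sum_le_sum (s := (Finset.range n).filter fun i => i * k < n) fun i hi =>
    sum_window_wrong_le hk hj (Finset.mem_filter.1 hi).2 φ
  calc 2 * ∑ m with estimate n k m ≠ j, ‖(windows n k).reversed.run ρ m‖ ^ 2
      ≤ 2 * ∑ i ∈ (Finset.range n).filter fun i => i * k < n, 9 / Real.sqrt (2 ^ k) * ‖φ‖ ^ 2 :=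
        mul_le_mul_of_nonneg_left (hU.trans hW) (by norm_num)
    _ ≤ 2 * (n * (9 / Real.sqrt (2 ^ k) * ‖φ‖ ^ 2)) := by
        rw [Finset.sum_const, nsmul_eq_mul]
        gcongr
        exact (Finset.card_filter_le _ _).trans (Finset.card_range n).le
    _ = _ := by ring

theorem fpe_on (n k : ℕ) :
    (fpe n k).On (Set.range fun p => Sum.inr (Sum.inr (Sum.inr p)))ᶜ := by
  have hw : (windowQFTs n k).On (Set.range fun p => Sum.inr (Sum.inr (Sum.inr p)))ᶜ := by
    rw [windowQFTs_eq]
    refine ((windows_on n k).relabel Sum.inr).mono ?_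
    rintro _ ⟨w, hw, rfl⟩ ⟨p, hp⟩
    exact hw ⟨p, Sum.inr.inj hp⟩
  refine (hw.reversed.append ?_).append hw
  rw [cnots_eq]
  refine on_foldr_par (fun s hs => ?_) _ _ fun p _ => (cnotC_on _ _).mono ?_
  · simp at hs
    simp [hs]
  · rintro w hw ⟨q, rfl⟩
    rcases hw with hw | hw
    · rw [fpeCopy_eq] at hw
      unfold fourierCopy at hw
      split_ifs at hw
      all_goals simp at hw
    · simp at hw

/-- The error vectors of phase estimation for different `j` are orthogonal, because the third
Fourier register, which is not touched, distinguishes them. -/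
theorem norm_sum_fpe_sub_sq (k : ℕ) (α : State (Fin n)) :
    ‖(fpe n k).run (∑ j, α j •
        tensor (ket j) (tensor (fourier j) (tensor (fourier j) (fourier j)))) -
      ∑ j, α j • tensor zeroKet (tensor (fourier j) (tensor (fourier j) (fourier j)))‖ ^ 2 =
    ∑ j, ‖α j‖ ^ 2 * ‖(fpe n k).run (tensor (ket j) (tensor (fourier j) (tensor (fourier j)
        (ket fun q => j (Fin.rev q))))) -
      tensor zeroKet
          (tensor (fourier j) (tensor (fourier j) (ket fun q => j (Fin.rev q))))‖ ^ 2 := by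
  set third : Fin n → FPEWire n := fun p => Sum.inr (Sum.inr (Sum.inr p)) with hthird
  set V : Circuit (FPEWire n) := (exactQFT n).relabel third with hV
  have hVrun : ∀ (ψ : State (Fin n)) (j : Fin n → Bool),
      V.run (tensor ψ (tensor (fourier j) (tensor (fourier j) (ket fun q => j (Fin.rev q))))) =
        tensor ψ (tensor (fourier j) (tensor (fourier j) (fourier j))) := by
    intro ψ j
    have e : V = (((exactQFT n).relabel Sum.inr).relabel Sum.inr).relabel Sum.inr := by
      rw [relabel_relabel, relabel_relabel]; rfl
    rw [e, run_relabel_inr, run_relabel_inr, run_relabel_inr, exactQFT_run_ket, rev_comp_rev]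
  have hcomm : ∀ ψ, (fpe n k).run (V.run ψ) = V.run ((fpe n k).run ψ) := fun ψ =>
    run_comm (fpe_on n k) (relabel_on_range _ third) disjoint_compl_left ψ
  set K : (Fin n → Bool) → State (FPEWire n) := fun j =>
    tensor (ket j) (tensor (fourier j) (tensor (fourier j) (ket fun q => j (Fin.rev q)))) with hK
  set K' : (Fin n → Bool) → State (FPEWire n) := fun j =>
    tensor zeroKet (tensor (fourier j) (tensor (fourier j) (ket fun q => j (Fin.rev q)))) with hK'
  have h1 : (fpe n k).run (∑ j, α j •
        tensor (ket j) (tensor (fourier j) (tensor (fourier j) (fourier j)))) -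
      ∑ j, α j • tensor zeroKet (tensor (fourier j) (tensor (fourier j) (fourier j))) =
      V.run (∑ j, α j • ((fpe n k).run (K j) - K' j)) := by
    simp only [← hVrun, run_sum, run_smul, hcomm, ← Finset.sum_sub_distrib, ← smul_sub, run_sub]
    rfl
  have hind : ∀ (ψ : State (Fin n)) (j : Fin n → Bool) (z : FPEWire n → Bool),
      (fun q => z (third (Fin.rev q))) ≠ j →
      (tensor ψ (tensor (fourier j) (tensor (fourier j) (ket fun q => j (Fin.rev q)))) :
        State (FPEWire n)) z = 0 := by
    intro ψ j z hz
    rw [tensor_apply, tensor_apply, tensor_apply, ket_apply, if_neg, mul_zero, mul_zero, mul_zero]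
    intro h
    refine hz (funext fun q => ?_)
    have := congrFun h q.rev
    simp only [Fin.rev_rev] at this
    exact this
  rw [h1, norm_run, norm_sum_sq_of_disjoint _ (fun z q => z (third (Fin.rev q)))]
  · simp only [norm_smul, mul_pow, hK, hK']
  · intro j z hz
    have h2 := run_mul (fpe_on n k)
      (fun z => if (fun q => z (third (Fin.rev q))) = j then (1 : ℂ) else 0)
      (fun w hw x b => by
        have : (fun q => Function.update x w b (third (Fin.rev q))) =
            fun q => x (third (Fin.rev q)) := by
          funext q
          exact Function.update_of_ne (fun h => hw ⟨q.rev, h⟩) _ _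
        rw [this]) (ψ := K j) (φ := K j) (fun x => by
          split_ifs with h
          · rw [one_mul]
          · rw [zero_mul]; exact hind _ _ _ h) z
    rw [PiLp.smul_apply, PiLp.sub_apply, h2, if_neg hz, zero_mul, hK']
    dsimp only
    rw [hind _ _ _ hz, sub_zero, smul_zero]

/-- Phase estimation on superpositions. -/
theorem norm_fpe_sub_sq_le_bad {k : ℕ} (hk : 1 ≤ k) (α : State (Fin n)) :
    ‖(fpe n k).run (∑ j, α j •
        tensor (ket j) (tensor (fourier j) (tensor (fourier j) (fourier j)))) -
      ∑ j, α j • tensor zeroKet (tensor (fourier j) (tensor (fourier j) (fourier j)))‖ ^ 2 ≤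
    18 * (n / Real.sqrt (2 ^ k) * ‖α‖ ^ 2 + ∑ j ∈ bad n k, ‖α j‖ ^ 2) := by
  classical
  rw [norm_sum_fpe_sub_sq, norm_sq_eq_sum α, Finset.mul_sum,
    ← Finset.univ_inter (bad n k), ← Finset.sum_ite_mem, ← Finset.sum_add_distrib, Finset.mul_sum]
  refine Finset.sum_le_sum fun j _ => ?_
  have hφ : ‖(ket fun q => j (Fin.rev q) : State (Fin n))‖ = 1 := norm_ket _
  have hρ : ‖(tensor (fourier j) (tensor (fourier j) (ket fun q => j (Fin.rev q))) :
      State (FourierWire n))‖ = 1 := by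
    rw [norm_tensor, norm_tensor, norm_fourier, hφ, one_mul, one_mul]
  split_ifs with hj
  · have h := norm_sub_le ((fpe n k).run (tensor (ket j) (tensor (fourier j) (tensor (fourier j)
        (ket fun q => j (Fin.rev q))))))
      (tensor zeroKet (tensor (fourier j) (tensor (fourier j) (ket fun q => j (Fin.rev q)))))
    rw [norm_run, norm_tensor, norm_tensor zeroKet, norm_ket, norm_zeroKet, hρ] at h
    have h2 := pow_le_pow_left₀ (norm_nonneg _) h 2
    have h3 : 0 ≤ (n / Real.sqrt (2 ^ k)) * ‖α j‖ ^ 2 := by positivity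
    have h4 := mul_le_mul_of_nonneg_left h2 (sq_nonneg ‖α j‖)
    have h5 := sq_nonneg ‖α j‖
    linarith
  · have h := mul_le_mul_of_nonneg_left
      (norm_fpe_ket_sub_sq_le hk hj (ket fun q => j (Fin.rev q))) (sq_nonneg ‖α j‖)
    rw [hφ] at h
    linarith

end FPE

/-! ### Circuits on some of the registers -/

section Pad

variable {ι κ : Type} [DecidableEq κ] [Fintype ι] [Fintype κ]

open scoped Classical in
/-- The state `φ` of some of the qubits, with all other qubits in state `0`. -/
noncomputable def pad (f : ι → κ) (φ : State ι) : State κ :=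
  WithLp.toLp 2 fun z => (if ∀ v, (∀ i, f i ≠ v) → z v = false then 1 else 0) * φ (z ∘ f)

open scoped Classical in
theorem pad_apply (f : ι → κ) (φ : State ι) (z : κ → Bool) : pad f φ z =
    (if ∀ v, (∀ i, f i ≠ v) → z v = false then 1 else 0) * φ (z ∘ f) := rfl

theorem pad_sub (f : ι → κ) (φ φ' : State ι) : pad f (φ - φ') = pad f φ - pad f φ' := by
  ext z
  rw [PiLp.sub_apply, pad_apply, pad_apply, pad_apply, PiLp.sub_apply, mul_sub]

theorem pad_sum {τ : Type*} (f : ι → κ) (s : Finset τ) (α : τ → ℂ) (φ : τ → State ι) :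
    pad f (∑ i ∈ s, α i • φ i) = ∑ i ∈ s, α i • pad f (φ i) := by
  ext z
  rw [pad_apply, state_apply_sum, state_apply_sum, Finset.mul_sum]
  refine Finset.sum_congr rfl fun i _ => ?_
  rw [PiLp.smul_apply, PiLp.smul_apply, pad_apply, smul_eq_mul, smul_eq_mul, mul_left_comm]

/-- A state is `pad f φ` if it vanishes unless the other qubits are `0`, and agrees with `φ`
there. -/
theorem eq_pad {f : ι → κ} {φ : State ι} {Ψ : State κ}
    (h1 : ∀ z, (∀ v, (∀ i, f i ≠ v) → z v = false) → Ψ z = φ (z ∘ f))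
    (h2 : ∀ z v, (∀ i, f i ≠ v) → z v = true → Ψ z = 0) : Ψ = pad f φ := by
  ext z
  rw [pad_apply]
  split_ifs with h
  · rw [h1 z h, one_mul]
  · push Not at h
    obtain ⟨v, hv, hz⟩ := h
    rw [h2 z v hv (by simpa using hz), zero_mul]

end Pad

section Registers

variable {ι κ : Type} [DecidableEq ι] [DecidableEq κ]

/-- If a state is a product of a function of the qubits that are not in the range of `f` and of a
state of those that are, a circuit placed by `f` acts on the second factor only. -/
theorem run_relabel_mul {f : ι → κ} (hf : Function.Injective f) (C : Circuit ι)
    (c : (κ → Bool) → ℂ)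
    (hc : ∀ z z' : κ → Bool, (∀ v, (∀ i, f i ≠ v) → z v = z' v) → c z = c z')
    {Ψ : State κ} {φ : State ι} (h : ∀ z, Ψ z = c z * φ (z ∘ f)) (z : κ → Bool) :
    (C.relabel f).run Ψ z = c z * C.run φ (z ∘ f) := by
  refine run_relabel_apply_of_slice hf C fun x => ?_
  have e : Function.extend f x z ∘ f = x := funext fun i => hf.extend_apply x z i
  rw [h, e, hc (Function.extend f x z) z fun v hv =>
    Function.extend_apply' _ _ _ fun ⟨i, hi⟩ => hv i hi]

variable [Fintype ι] [Fintype κ]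

theorem norm_pad {f : ι → κ} (hf : Function.Injective f) (φ : State ι) : ‖pad f φ‖ = ‖φ‖ := by
  rw [← sq_eq_sq₀ (norm_nonneg _) (norm_nonneg _), norm_sq_eq_sum, norm_sq_eq_sum]
  refine (Fintype.sum_of_injective (fun x => Function.extend f x fun _ => false) ?_ _ _ ?_ ?_).symm
  · intro x y h
    funext i
    have := congrFun h (f i)
    simpa only [hf.extend_apply] using this
  · intro z hz
    rw [pad_apply, if_neg, zero_mul, norm_zero, zero_pow two_ne_zero]
    intro h
    refine hz ⟨z ∘ f, funext fun v => ?_⟩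
    by_cases hv : ∃ i, f i = v
    · obtain ⟨i, rfl⟩ := hv; exact hf.extend_apply _ _ _
    · exact (Function.extend_apply' _ _ _ hv).trans (h v fun i hi => hv ⟨i, hi⟩).symm
  · intro x
    have e : (Function.extend f x fun _ => false) ∘ f = x :=
      funext fun i => hf.extend_apply x _ i
    rw [pad_apply, e, if_pos, one_mul]
    exact fun v hv => Function.extend_apply' _ _ _ fun ⟨i, hi⟩ => hv i hi

theorem run_pad {f : ι → κ} (hf : Function.Injective f) (C : Circuit ι) (φ : State ι) :
    (C.relabel f).run (pad f φ) = pad f (C.run φ) := by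
  ext z
  classical
  rw [pad_apply]
  refine run_relabel_mul hf C (fun z => if ∀ v, (∀ i, f i ≠ v) → z v = false then 1 else 0)
    (fun z z' h => if_congr ?_ rfl rfl) (fun z => ?_) z
  · exact forall₂_congr fun v hv => by rw [h v hv]
  · rw [pad_apply]

/-- Errors of a circuit that acts on some of the qubits may be estimated slice by slice. -/
theorem norm_run_relabel_sub_sq_le {f : ι → κ} (hf : Function.Injective f) (C : Circuit ι)
    (Ψ Φ : State κ) (P : (ι → Bool) → Prop) [DecidablePred P] {ε δ : ℝ}
    (h : ∀ z, ‖C.run (slice f Ψ z) - slice f Φ z‖ ^ 2 ≤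
      ε * ‖slice f Ψ z‖ ^ 2 + δ * ∑ x with P x, ‖slice f Ψ z x‖ ^ 2) :
    ‖(C.relabel f).run Ψ - Φ‖ ^ 2 ≤ ε * ‖Ψ‖ ^ 2 + δ * ∑ z with P (z ∘ f), ‖Ψ z‖ ^ 2 := by
  have hc : ∀ (x : ι → Bool) (z : κ → Bool), Function.extend f x z ∘ f = x :=
    fun x z => funext fun i => hf.extend_apply x z i
  have h1 := sum_extend hf fun z x => ‖(C.run (slice f Ψ z) - slice f Φ z) x‖ ^ 2
  have h2 := sum_extend hf fun z _ => ‖Ψ z‖ ^ 2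
  have h3 := sum_extend hf fun z _ => if P (z ∘ f) then ‖Ψ z‖ ^ 2 else 0
  have h4 : ∀ z, (C.run (slice f Ψ z) - slice f Φ z) (z ∘ f) = ((C.relabel f).run Ψ - Φ) z := by
    intro z
    rw [PiLp.sub_apply, PiLp.sub_apply, run_relabel_apply hf, slice_apply, extend_comp_self hf]
  simp only [slice_extend hf, h4, hc, Finset.sum_const, nsmul_eq_mul, ← Finset.mul_sum] at h1 h2 h3
  have hpos : (0 : ℝ) < (Finset.univ : Finset (ι → Bool)).card := by
    exact_mod_cast Finset.card_pos.2 Finset.univ_nonempty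
  rw [Finset.sum_filter, norm_sq_eq_sum, norm_sq_eq_sum]
  refine le_of_mul_le_mul_left ?_ hpos
  rw [h1, mul_add, mul_left_comm, mul_left_comm _ δ, ← h2, ← h3, Finset.mul_sum, Finset.mul_sum,
    ← Finset.sum_add_distrib]
  refine Finset.sum_le_sum fun z _ => ?_
  have := h z
  rwa [norm_sq_eq_sum, norm_sq_eq_sum, Finset.sum_filter] at this

theorem maps_cnots_extend {m : ℕ} {c t : Fin m → κ} (h : Function.Injective (Sum.elim c t))
    (z : κ → Bool) : (cnots c t).Maps z (Function.extend t (fun i => z (t i) ^^ z (c i)) z) := by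
  have ht : Function.Injective t := fun i j hij =>
    Sum.inr.inj (h (a₁ := Sum.inr i) (a₂ := Sum.inr j) hij)
  refine maps_cnots h (fun i => ht.extend_apply _ _ _) fun w hw => ?_
  exact Function.extend_apply' _ _ _ fun ⟨i, hi⟩ => hw i hi

/-- Three layers of controlled-nots exchange the registers `f` and `g`; the amplitude at `z` is the
old amplitude at the exchanged assignment `z'`. -/
theorem run_swaps_apply {m : ℕ} {f g : Fin m → κ} (h : Function.Injective (Sum.elim f g))
    (ψ : State κ) {z z' : κ → Bool} (hf : ∀ i, z' (f i) = z (g i)) (hg : ∀ i, z' (g i) = z (f i))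
    (hw : ∀ w, (∀ i, f i ≠ w) → (∀ i, g i ≠ w) → z' w = z w) :
    (swaps f g).run ψ z = ψ z' := by
  have h' : Function.Injective (Sum.elim g f) := by
    have e : Sum.elim g f = Sum.elim f g ∘ Sum.swap := by funext i; rcases i with i | i <;> rfl
    rw [e]; exact h.comp Sum.swap_leftInverse.injective
  have hfi : Function.Injective f := fun i j hij =>
    Sum.inl.inj (h (a₁ := Sum.inl i) (a₂ := Sum.inl j) hij)
  have hgi : Function.Injective g := fun i j hij =>
    Sum.inr.inj (h (a₁ := Sum.inr i) (a₂ := Sum.inr j) hij)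
  have hne : ∀ i j, f i ≠ g j := fun i j hij => by
    cases h (a₁ := Sum.inl i) (a₂ := Sum.inr j) hij
  refine Maps.run_apply (((maps_cnots_extend h z').append (maps_cnots_extend h' _)).append
    (maps_cnots h (fun i => ?_) fun w hgw => ?_)) ψ
  all_goals set z₁ := Function.extend g (fun i => z' (g i) ^^ z' (f i)) z' with hz₁
  all_goals have h1g : ∀ i, z₁ (g i) = (z' (g i) ^^ z' (f i)) := fun i => hgi.extend_apply _ _ _
  all_goals have h1 : ∀ w, (∀ i, g i ≠ w) → z₁ w = z' w := fun w hw =>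
    Function.extend_apply' _ _ _ fun ⟨i, hi⟩ => hw i hi
  all_goals set z₂ := Function.extend f (fun i => z₁ (f i) ^^ z₁ (g i)) z₁ with hz₂
  all_goals have h2f : ∀ i, z₂ (f i) = (z₁ (f i) ^^ z₁ (g i)) := fun i => hfi.extend_apply _ _ _
  all_goals have h2 : ∀ w, (∀ i, f i ≠ w) → z₂ w = z₁ w := fun w hw =>
    Function.extend_apply' _ _ _ fun ⟨i, hi⟩ => hw i hi
  · rw [h2f, h2 _ (fun j => hne j i), h1g, h1 _ (fun j => (hne i j).symm), ← hf]
    cases z' (g i) <;> cases z' (f i) <;> rfl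
  · by_cases hfw : ∃ i, f i = w
    · obtain ⟨i, rfl⟩ := hfw
      rw [h2f, h1g, h1 _ hgw, ← hg]
      cases z' (g i) <;> cases z' (f i) <;> rfl
    · have hfw' : ∀ i, f i ≠ w := fun i hi => hfw ⟨i, hi⟩
      rw [h2 w hfw', h1 w hgw, hw w hfw' hgw]

end Registers

section Swaps

theorem swaps_wellFormed {m : ℕ} {ν : Type} {f g : Fin m → ν}
    (h : Function.Injective (Sum.elim f g)) :
    (swaps f g).WellFormed := by
  have h' : Function.Injective (Sum.elim g f) := by
    have e : Sum.elim g f = Sum.elim f g ∘ Sum.swap := by funext i; rcases i with i | i <;> rfl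
    rw [e]; exact h.comp Sum.swap_leftInverse.injective
  exact ((cnots_wellFormed h).append (cnots_wellFormed h')).append (cnots_wellFormed h)

theorem size_swaps {m : ℕ} {ν : Type} (f g : Fin m → ν) : (swaps f g).size = 9 * m := by
  rw [swaps, size_append, size_append, size_cnots, size_cnots]; ring

theorem depth_swaps {m : ℕ} {ν : Type} (f g : Fin m → ν) : (swaps f g).depth = 9 := by
  rw [swaps, depth_append, depth_append, depth_cnots, depth_cnots]

end Swaps

/-! ### The circuit without a shift -/

section UQFT

variable {n : ℕ}

theorem norm_sum_ket_tensor_fourier (α : State (Fin n)) :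
    ‖∑ j, α j • (tensor (ket j) (fourier j) : State (Fin n ⊕ Fin n))‖ = ‖α‖ := by
  rw [← sq_eq_sq₀ (norm_nonneg _) (norm_nonneg _),
    norm_sum_sq_of_disjoint _ (fun z p => z (Sum.inl p)), norm_sq_eq_sum]
  · simp only [norm_smul, norm_tensor, norm_ket, norm_fourier, mul_one]
  · intro j z hz
    rw [PiLp.smul_apply, tensor_apply, ket_apply, if_neg hz, zero_mul, smul_zero]

/-- The error of approximate Fourier state computation, squared. -/
theorem norm_aqfs_sub_sq_le (k : ℕ) (α : State (Fin n)) :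
    ‖(aqfs n k).run (tensor α zeroKet) - ∑ j, α j • tensor (ket j) (fourier j)‖ ^ 2 ≤
      40 * (n / Real.sqrt (2 ^ k)) * ‖α‖ ^ 2 := by
  have hs : 0 < Real.sqrt (2 ^ k) := by positivity
  have hs1 : 1 ≤ Real.sqrt (2 ^ k) := Real.one_le_sqrt.2 (one_le_pow₀ (by norm_num))
  have hss : Real.sqrt (2 ^ k) * Real.sqrt (2 ^ k) = 2 ^ k := Real.mul_self_sqrt (by positivity)
  have hα := sq_nonneg ‖α‖
  rcases le_total (n / Real.sqrt (2 ^ k)) 1 with hy | hy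
  · have h := pow_le_pow_left₀ (norm_nonneg _) (norm_aqfs_sub_le k α) 2
    refine h.trans ?_
    rw [mul_pow]
    refine mul_le_mul_of_nonneg_right ?_ hα
    have hy0 : 0 ≤ n / Real.sqrt (2 ^ k) := by positivity
    have h1 : (n : ℝ) / 2 ^ k ≤ n / Real.sqrt (2 ^ k) :=
      div_le_div_of_nonneg_left (by positivity) hs (by nlinarith)
    have h2 : ((n : ℝ) / 2 ^ k) ^ 2 ≤ n / Real.sqrt (2 ^ k) :=
      (pow_le_pow_left₀ (by positivity) h1 2).trans (by nlinarith)
    have hpi : Real.pi ^ 2 ≤ 10 := by nlinarith [Real.pi_lt_d2, Real.pi_pos]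
    calc (2 * Real.pi * n / 2 ^ k) ^ 2 = 4 * Real.pi ^ 2 * ((n : ℝ) / 2 ^ k) ^ 2 := by ring
      _ ≤ 4 * 10 * (n / Real.sqrt (2 ^ k)) := by gcongr
      _ = _ := by ring
  · have h := norm_sub_le ((aqfs n k).run (tensor α zeroKet))
      (∑ j, α j • tensor (ket j) (fourier j))
    rw [norm_run, norm_tensor, norm_zeroKet, norm_sum_ket_tensor_fourier, mul_one] at h
    have h2 := pow_le_pow_left₀ (norm_nonneg _) h 2
    nlinarith

variable {a : ℕ}

theorem tensor_zeroKet_zeroKet {ι κ : Type} [DecidableEq ι] [DecidableEq κ] [Fintype ι]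
    [Fintype κ] : tensor (zeroKet : State ι) (zeroKet : State κ) = zeroKet := by
  rw [zeroKet, zeroKet, tensor_ket_ket, zeroKet]
  congr 1
  funext w
  rcases w with w | w <;> rfl

theorem zeroKet_eq_zero {ι : Type} [DecidableEq ι] [Fintype ι] {z : ι → Bool} {i : ι}
    (h : z i = true) : (zeroKet : State ι) z = 0 := by
  rw [zeroKet_apply, if_neg]
  intro h'
  rw [h'] at h
  cases h

/-- Product states of the registers of `uqft`. -/
noncomputable def uState (a : ℕ) (ψ φ₁ φ₂ φ₃ : State (Fin n)) : State (UWire n a) :=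
  tensor ψ (tensor (tensor φ₁ (tensor φ₂ φ₃)) zeroKet)

theorem uState_apply (ψ φ₁ φ₂ φ₃ : State (Fin n)) (z : UWire n a → Bool) :
    uState a ψ φ₁ φ₂ φ₃ z = ψ (fun p => z (Sum.inl p)) *
      (φ₁ (fun p => z (Sum.inr (Sum.inl (Sum.inl p)))) *
        (φ₂ (fun p => z (Sum.inr (Sum.inl (Sum.inr (Sum.inl p))))) *
          φ₃ fun p => z (Sum.inr (Sum.inl (Sum.inr (Sum.inr p))))) *
        (zeroKet : State (Fin a)) fun p => z (Sum.inr (Sum.inr p))) := rfl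

theorem tensor_zeroKet_eq_uState (ψ : State (Fin n)) :
    (tensor ψ zeroKet : State (UWire n a)) = uState a ψ zeroKet zeroKet zeroKet := by
  rw [uState, tensor_zeroKet_zeroKet, tensor_zeroKet_zeroKet, tensor_zeroKet_zeroKet]

theorem fpeToU_injective : Function.Injective (fpeToU : FPEWire n → UWire n a) := by
  rintro (p | p) (q | q) h
  · rw [Sum.inl.inj h]
  · cases h
  · cases h
  · rw [Sum.inl.inj (Sum.inr.inj h)]

theorem dataFirst_injective : Function.Injective (Sum.elim (Sum.inl : Fin n → UWire n a)
    fun p => Sum.inr (Sum.inl (Sum.inl p))) := by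
  rintro (p | p) (q | q) h <;> simp_all

theorem place_first_second_injective : Function.Injective
    (place (fun p => Sum.inr (Sum.inl (Sum.inl p)) : Fin n → UWire n a)
      (fun p => Sum.inr (Sum.inl (Sum.inr (Sum.inl p)))) fun p => Sum.inr (Sum.inr p)) := by
  rintro (p | p | p) (q | q | q) h <;> simp_all [place]

theorem place_first_third_injective : Function.Injective
    (place (fun p => Sum.inr (Sum.inl (Sum.inl p)) : Fin n → UWire n a)
      (fun p => Sum.inr (Sum.inl (Sum.inr (Sum.inr p)))) fun p => Sum.inr (Sum.inr p)) := by
  rintro (p | p | p) (q | q | q) h <;> simp_all [place]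

theorem uState_eq_pad_fpeToU (ψ φ₁ φ₂ φ₃ : State (Fin n)) :
    uState a ψ φ₁ φ₂ φ₃ = pad fpeToU (tensor ψ (tensor φ₁ (tensor φ₂ φ₃))) := by
  refine eq_pad (fun z hz => ?_) fun z v hv hz => ?_
  · have e : (fun p => z (Sum.inr (Sum.inr p))) = fun _ : Fin a => false :=
      funext fun p => hz _ (by rintro (i | i) h <;> cases h)
    rw [uState_apply, e, zeroKet_apply, if_pos rfl, mul_one]
    rfl
  · rcases v with p | p | p
    · exact absurd rfl (hv (Sum.inl p))
    · exact absurd rfl (hv (Sum.inr p))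
    · rw [uState_apply, zeroKet_eq_zero (i := p) hz, mul_zero, mul_zero]

theorem uState_eq_pad_dataFirst (ψ φ : State (Fin n)) :
    uState a ψ φ zeroKet zeroKet = pad (Sum.elim Sum.inl fun p => Sum.inr (Sum.inl (Sum.inl p)))
      (tensor ψ φ) := by
  refine eq_pad (fun z hz => ?_) fun z v hv hz => ?_
  · have e1 : (fun p => z (Sum.inr (Sum.inr p))) = fun _ : Fin a => false :=
      funext fun p => hz _ (by rintro (i | i) h <;> cases h)
    have e2 : (fun p => z (Sum.inr (Sum.inl (Sum.inr (Sum.inl p))))) = fun _ : Fin n => false :=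
      funext fun p => hz _ (by rintro (i | i) h <;> cases h)
    have e3 : (fun p => z (Sum.inr (Sum.inl (Sum.inr (Sum.inr p))))) = fun _ : Fin n => false :=
      funext fun p => hz _ (by rintro (i | i) h <;> cases h)
    rw [uState_apply, e1, e2, e3, zeroKet_apply, zeroKet_apply, if_pos rfl, if_pos rfl, mul_one,
      mul_one, mul_one]
    rfl
  · rw [uState_apply]
    rcases v with p | ((p | p | p) | p)
    · exact absurd rfl (hv (Sum.inl p))
    · exact absurd rfl (hv (Sum.inr p))
    · rw [zeroKet_eq_zero (i := p) hz]; ring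
    · rw [zeroKet_eq_zero (z := fun p => z (Sum.inr (Sum.inl (Sum.inr (Sum.inr p))))) hz]; ring
    · rw [zeroKet_eq_zero (z := fun p => z (Sum.inr (Sum.inr p))) hz]; ring

/-- The two copies made by `uqft`. -/
def copies (n a : ℕ) (S : Circuit (Fin n ⊕ (Fin n ⊕ Fin a))) : Circuit (UWire n a) :=
  (copy n a S).relabel (place (fun p => Sum.inr (Sum.inl (Sum.inl p)))
      (fun p => Sum.inr (Sum.inl (Sum.inr (Sum.inl p)))) fun p => Sum.inr (Sum.inr p)) ++
    (copy n a S).relabel (place (fun p => Sum.inr (Sum.inl (Sum.inl p)))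
      (fun p => Sum.inr (Sum.inl (Sum.inr (Sum.inr p)))) fun p => Sum.inr (Sum.inr p))

theorem uqft_eq (k : ℕ) (S : Circuit (Fin n ⊕ (Fin n ⊕ Fin a))) : uqft n k a S =
    (aqfs n k).relabel (Sum.elim Sum.inl fun p => Sum.inr (Sum.inl (Sum.inl p))) ++ copies n a S ++
      (fpe n k).relabel fpeToU ++ (copies n a S).reversed ++
      swaps Sum.inl fun p => Sum.inr (Sum.inl (Sum.inl p)) := rfl

theorem run_copies {S : Circuit (Fin n ⊕ (Fin n ⊕ Fin a))} (hS : Subtracts S) (ψ : State (Fin n))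
    (j : Fin n → Bool) : (copies n a S).run (uState a ψ (fourier j) zeroKet zeroKet) =
      uState a ψ (fourier j) (fourier j) (fourier j) := by
  have h1 : ((copy n a S).relabel (place (fun p => Sum.inr (Sum.inl (Sum.inl p)))
      (fun p => Sum.inr (Sum.inl (Sum.inr (Sum.inl p)))) fun p => Sum.inr (Sum.inr p))).run
        (uState a ψ (fourier j) zeroKet zeroKet) = uState a ψ (fourier j) (fourier j) zeroKet := by
    ext z
    rw [run_relabel_mul place_first_second_injective (copy n a S)
      (fun z => ψ (fun p => z (Sum.inl p)) *
        (zeroKet : State (Fin n)) fun p => z (Sum.inr (Sum.inl (Sum.inr (Sum.inr p)))))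
      (fun z z' h => ?_) (φ := tensor (fourier j) (tensor zeroKet zeroKet)) (fun z => ?_) z,
      run_copy hS, uState_apply, tensor_apply, tensor_apply]
    · simp only [place, Function.comp_apply, Sum.elim_inl, Sum.elim_inr]
      ring
    · have e1 : (fun p => z (Sum.inl p)) = fun p => z' (Sum.inl p) :=
        funext fun p => h _ (by rintro (i | i | i) e <;> cases e)
      have e2 : (fun p => z (Sum.inr (Sum.inl (Sum.inr (Sum.inr p))))) =
          fun p => z' (Sum.inr (Sum.inl (Sum.inr (Sum.inr p)))) :=
        funext fun p => h _ (by rintro (i | i | i) e <;> cases e)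
      rw [e1, e2]
    · rw [uState_apply, tensor_apply, tensor_apply]
      simp only [place, Function.comp_apply, Sum.elim_inl, Sum.elim_inr]
      ring
  have h2 : ((copy n a S).relabel (place (fun p => Sum.inr (Sum.inl (Sum.inl p)))
      (fun p => Sum.inr (Sum.inl (Sum.inr (Sum.inr p)))) fun p => Sum.inr (Sum.inr p))).run
        (uState a ψ (fourier j) (fourier j) zeroKet) =
          uState a ψ (fourier j) (fourier j) (fourier j) := by
    ext z
    rw [run_relabel_mul place_first_third_injective (copy n a S)
      (fun z => ψ (fun p => z (Sum.inl p)) *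
        fourier j fun p => z (Sum.inr (Sum.inl (Sum.inr (Sum.inl p)))))
      (fun z z' h => ?_) (φ := tensor (fourier j) (tensor zeroKet zeroKet)) (fun z => ?_) z,
      run_copy hS, uState_apply, tensor_apply, tensor_apply]
    · simp only [place, Function.comp_apply, Sum.elim_inl, Sum.elim_inr]
      ring
    · have e1 : (fun p => z (Sum.inl p)) = fun p => z' (Sum.inl p) :=
        funext fun p => h _ (by rintro (i | i | i) e <;> cases e)
      have e2 : (fun p => z (Sum.inr (Sum.inl (Sum.inr (Sum.inl p))))) =
          fun p => z' (Sum.inr (Sum.inl (Sum.inr (Sum.inl p)))) :=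
        funext fun p => h _ (by rintro (i | i | i) e <;> cases e)
      rw [e1, e2]
    · rw [uState_apply, tensor_apply, tensor_apply]
      simp only [place, Function.comp_apply, Sum.elim_inl, Sum.elim_inr]
      ring
  rw [copies, run_append, h1, h2]

theorem run_swaps_uState (ψ φ : State (Fin n)) :
    (swaps Sum.inl fun p => Sum.inr (Sum.inl (Sum.inl p)) : Circuit (UWire n a)).run
      (uState a ψ φ zeroKet zeroKet) = uState a φ ψ zeroKet zeroKet := by
  ext z
  rw [run_swaps_apply dataFirst_injective _ (z' := Sum.elim
    (fun p => z (Sum.inr (Sum.inl (Sum.inl p)))) (Sum.elim (Sum.elim (fun p => z (Sum.inl p))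
      fun w => z (Sum.inr (Sum.inl (Sum.inr w)))) fun w => z (Sum.inr (Sum.inr w))))
    (fun _ => rfl) (fun _ => rfl), uState_apply, uState_apply]
  · simp only [Sum.elim_inl, Sum.elim_inr]
    ring
  · rintro (p | (p | p) | p) h1 h2
    · exact absurd rfl (h1 p)
    · exact absurd rfl (h2 p)
    · rfl
    · rfl

theorem uState_sum_left {τ : Type*} (s : Finset τ) (α : τ → ℂ) (ψ : τ → State (Fin n))
    (φ₁ φ₂ φ₃ : State (Fin n)) : ∑ i ∈ s, α i • uState a (ψ i) φ₁ φ₂ φ₃ =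
      uState a (∑ i ∈ s, α i • ψ i) φ₁ φ₂ φ₃ := by
  ext z
  rw [uState_apply, state_apply_sum, state_apply_sum, Finset.sum_mul]
  refine Finset.sum_congr rfl fun i _ => ?_
  rw [PiLp.smul_apply, PiLp.smul_apply, uState_apply, smul_eq_mul, smul_eq_mul]
  ring

/-- Copying and exchanging are exact, and circuits are isometries, so only the errors of `aqfs` and
`fpe` contribute; `(u + v) ^ 2 ≤ 2 u ^ 2 + 2 v ^ 2` combines them. -/
theorem norm_uqft_sub_sq_le {k : ℕ} (hk : 1 ≤ k) {S : Circuit (Fin n ⊕ (Fin n ⊕ Fin a))}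
    (hS : Subtracts S) (α : State (Fin n)) :
    ‖(uqft n k a S).run (tensor α zeroKet) - tensor (qft n α) zeroKet‖ ^ 2 ≤
      116 * (n / Real.sqrt (2 ^ k) * ‖α‖ ^ 2 + ∑ j ∈ bad n k, ‖α j‖ ^ 2) := by
  set y : ℝ := n / Real.sqrt (2 ^ k) with hy
  set A : Circuit (UWire n a) :=
    (aqfs n k).relabel (Sum.elim Sum.inl fun p => Sum.inr (Sum.inl (Sum.inl p))) with hA
  set T₁ : State (UWire n a) := ∑ j, α j • uState a (ket j) (fourier j) zeroKet zeroKet with hT₁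
  set T₂ : State (UWire n a) := ∑ j, α j • uState a (ket j) (fourier j) (fourier j) (fourier j)
    with hT₂
  set T₃ : State (UWire n a) := ∑ j, α j • uState a zeroKet (fourier j) (fourier j) (fourier j)
    with hT₃
  have h1 : ‖A.run (tensor α zeroKet) - T₁‖ ^ 2 ≤ 40 * y * ‖α‖ ^ 2 := by
    rw [tensor_zeroKet_eq_uState, uState_eq_pad_dataFirst, hA, run_pad dataFirst_injective, hT₁]
    simp only [uState_eq_pad_dataFirst]
    rw [← pad_sum, ← pad_sub, norm_pad dataFirst_injective]
    exact norm_aqfs_sub_sq_le k α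
  have h2 : (copies n a S).run T₁ = T₂ := by
    rw [hT₁, run_sum]
    simp only [run_smul, run_copies hS]
    rfl
  have h3 : ‖((fpe n k).relabel fpeToU).run T₂ - T₃‖ ^ 2 ≤
      18 * (y * ‖α‖ ^ 2 + ∑ j ∈ bad n k, ‖α j‖ ^ 2) := by
    rw [hT₂, hT₃]
    simp only [uState_eq_pad_fpeToU]
    rw [← pad_sum, ← pad_sum, run_pad fpeToU_injective, ← pad_sub, norm_pad fpeToU_injective]
    exact norm_fpe_sub_sq_le_bad hk α
  have h4 : tensor (qft n α) zeroKet =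
      (swaps Sum.inl fun p => Sum.inr (Sum.inl (Sum.inl p)) : Circuit (UWire n a)).run
        ((copies n a S).reversed.run T₃) := by
    have e : (copies n a S).reversed.run T₃ =
        ∑ j, α j • uState a zeroKet (fourier j) zeroKet zeroKet := by
      rw [reversed_run_eq_iff, run_sum]
      simp only [run_smul, run_copies hS]
      rfl
    rw [e, run_sum]
    simp only [run_smul, run_swaps_uState]
    rw [uState_sum_left, ← qft_eq_sum, tensor_zeroKet_eq_uState]
  have h5 : ‖(uqft n k a S).run (tensor α zeroKet) - tensor (qft n α) zeroKet‖ ≤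
      ‖A.run (tensor α zeroKet) - T₁‖ + ‖((fpe n k).relabel fpeToU).run T₂ - T₃‖ := by
    rw [h4, uqft_eq, run_append, run_append, run_append, run_append, ← run_sub, norm_run, ← run_sub,
      norm_run, ← hA]
    refine (norm_sub_le_norm_sub_add_norm_sub _ (((fpe n k).relabel fpeToU).run T₂) _).trans ?_
    rw [← run_sub, norm_run, ← h2, ← run_sub, norm_run]
  have h6 := pow_le_pow_left₀ (norm_nonneg _) h5 2
  have h7 : 0 ≤ ∑ j ∈ bad n k, ‖α j‖ ^ 2 := Finset.sum_nonneg fun _ _ => sq_nonneg _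
  nlinarith [sq_nonneg (‖A.run (tensor α zeroKet) - T₁‖ -
    ‖((fpe n k).relabel fpeToU).run T₂ - T₃‖)]

theorem copies_wellFormed {S : Circuit (Fin n ⊕ (Fin n ⊕ Fin a))} (hS : S.WellFormed) :
    (copies n a S).WellFormed :=
  ((copy_wellFormed hS).relabel place_first_second_injective).append
    ((copy_wellFormed hS).relabel place_first_third_injective)

theorem uqft_wellFormed (k : ℕ) {S : Circuit (Fin n ⊕ (Fin n ⊕ Fin a))} (hS : S.WellFormed) :
    (uqft n k a S).WellFormed := by
  rw [uqft_eq]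
  exact (((((aqfs_wellFormed n k).relabel dataFirst_injective).append
    (copies_wellFormed hS)).append ((fpe_wellFormed n k).relabel fpeToU_injective)).append
      (copies_wellFormed hS).reversed).append (swaps_wellFormed dataFirst_injective)

theorem size_uqft_le {k : ℕ} (hk : 1 ≤ k) (S : Circuit (Fin n ⊕ (Fin n ⊕ Fin a))) :
    (uqft n k a S).size ≤ 26 * (n * k) + 4 * S.size := by
  have h1 := size_aqfs_le n k
  have h2 := size_fpe_le hk n
  have h3 := Nat.le_mul_of_pos_right n hk
  rw [uqft_eq, size_append, size_append, size_append, size_append, size_reversed, size_relabel,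
    size_relabel, copies, size_append, size_relabel, size_relabel, size_copy, size_swaps]
  rw [mul_add] at h1
  omega

theorem depth_uqft_le {k : ℕ} (hk : 1 ≤ k) (S : Circuit (Fin n ⊕ (Fin n ⊕ Fin a))) :
    (uqft n k a S).depth ≤ 9 * k + 15 + 4 * S.depth := by
  have h2 := depth_fpe_le hk n
  rw [uqft_eq, depth_append, depth_append, depth_append, depth_append, depth_reversed,
    depth_relabel, depth_relabel, copies, depth_append, depth_relabel, depth_relabel, depth_copy,
    depth_swaps, depth_aqfs]
  omega

end UQFT

/-! ### The circuit with a random shift -/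

section PQFT

variable {n a : ℕ}

/-- States of the input and the shift register of `pqft`, all other qubits being `0`. -/
noncomputable def shiftedState (a : ℕ) (B : (Fin n → Bool) → (Fin n → Bool) → ℂ) :
    State (PWire n a) :=
  WithLp.toLp 2 fun z => B (fun p => z (Sum.inl p)) (fun p => z (Sum.inr (Sum.inl p))) *
    zeroKet fun w => z (Sum.inr (Sum.inr w))

/-- States of the input, the shift and the first Fourier register of `pqft`, all other qubits
being `0`. -/
noncomputable def pState (a : ℕ)
    (H : (Fin n → Bool) → (Fin n → Bool) → (Fin n → Bool) → ℂ) : State (PWire n a) :=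
  WithLp.toLp 2 fun z => H (fun p => z (Sum.inl p)) (fun p => z (Sum.inr (Sum.inl p)))
      (fun p => z (Sum.inr (Sum.inr (Sum.inl (Sum.inl p))))) *
    ((zeroKet : State (Fin n ⊕ Fin n)) (fun w => z (Sum.inr (Sum.inr (Sum.inl (Sum.inr w))))) *
      (zeroKet : State (Fin a)) fun p => z (Sum.inr (Sum.inr (Sum.inr p))))

theorem shiftedState_apply (B : (Fin n → Bool) → (Fin n → Bool) → ℂ) (z : PWire n a → Bool) :
    shiftedState a B z = B (fun p => z (Sum.inl p)) (fun p => z (Sum.inr (Sum.inl p))) *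
      (zeroKet : State ((Fin n ⊕ (Fin n ⊕ Fin n)) ⊕ Fin a)) fun w => z (Sum.inr (Sum.inr w)) := rfl

theorem pState_apply (H : (Fin n → Bool) → (Fin n → Bool) → (Fin n → Bool) → ℂ)
    (z : PWire n a → Bool) : pState a H z =
      H (fun p => z (Sum.inl p)) (fun p => z (Sum.inr (Sum.inl p)))
        (fun p => z (Sum.inr (Sum.inr (Sum.inl (Sum.inl p))))) *
      ((zeroKet : State (Fin n ⊕ Fin n)) (fun w => z (Sum.inr (Sum.inr (Sum.inl (Sum.inr w))))) *
        (zeroKet : State (Fin a)) fun p => z (Sum.inr (Sum.inr (Sum.inr p)))) := rfl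

theorem shiftedState_eq_pState (B : (Fin n → Bool) → (Fin n → Bool) → ℂ) :
    shiftedState a B = pState a fun x s y => B x s * (zeroKet : State (Fin n)) y := by
  ext z
  rw [shiftedState_apply, pState_apply, ← tensor_zeroKet_zeroKet, tensor_apply,
    ← tensor_zeroKet_zeroKet (ι := Fin n) (κ := Fin n ⊕ Fin n), tensor_apply]
  ring

theorem tensor_zeroKet_eq_pState (ψ : State (Fin n)) :
    (tensor ψ zeroKet : State (PWire n a)) =
      pState a fun x s y => ψ x * (zeroKet : State (Fin n)) y * (zeroKet : State (Fin n)) s := by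
  ext z
  rw [pState_apply, tensor_apply, ← tensor_zeroKet_zeroKet, tensor_apply,
    ← tensor_zeroKet_zeroKet (ι := Fin n ⊕ (Fin n ⊕ Fin n)) (κ := Fin a), tensor_apply,
    ← tensor_zeroKet_zeroKet (ι := Fin n) (κ := Fin n ⊕ Fin n), tensor_apply]
  ring

theorem shift_injective : Function.Injective (fun p => Sum.inr (Sum.inl p) : Fin n → PWire n a) :=
  Sum.inr_injective.comp Sum.inl_injective

theorem place_data_shift_injective : Function.Injective
    (place (Sum.inl : Fin n → PWire n a) (fun p => Sum.inr (Sum.inl p))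
      fun p => Sum.inr (Sum.inr (Sum.inr p))) := by
  rintro (p | p | p) (q | q | q) h <;> simp_all [place]

theorem place_first_data_injective : Function.Injective
    (place (fun p => Sum.inr (Sum.inr (Sum.inl (Sum.inl p))) : Fin n → PWire n a) Sum.inl
      fun p => Sum.inr (Sum.inr (Sum.inr p))) := by
  rintro (p | p | p) (q | q | q) h <;> simp_all [place]

theorem shiftFirst_injective : Function.Injective
    (Sum.elim (fun p => Sum.inr (Sum.inl p) : Fin n → PWire n a)
      fun p => Sum.inr (Sum.inr (Sum.inl (Sum.inl p)))) := by
  rintro (p | p) (q | q) h <;> simp_all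

theorem uToP_injective : Function.Injective (uToP : UWire n a → PWire n a) := by
  rintro (p | p) (q | q) h
  · rw [Sum.inl.inj h]
  · cases h
  · cases h
  · rw [Sum.inr.inj (Sum.inr.inj h)]

theorem run_shift_hadamards (G : (Fin n → Bool) → (Fin n → Bool) → ℂ) (φ : State (Fin n)) :
    (hadamards fun p => Sum.inr (Sum.inl p) : Circuit (PWire n a)).run
        (pState a fun x s y => G x y * φ s) =
      pState a fun x s y => G x y * (hadamards fun p : Fin n => p).run φ s := by
  ext z
  rw [← hadamards_relabel, run_relabel_apply_of_slice shift_injective _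
    (c := G (fun p => z (Sum.inl p)) (fun p => z (Sum.inr (Sum.inr (Sum.inl (Sum.inl p))))) *
      ((zeroKet : State (Fin n ⊕ Fin n)) (fun w => z (Sum.inr (Sum.inr (Sum.inl (Sum.inr w))))) *
        (zeroKet : State (Fin a)) fun p => z (Sum.inr (Sum.inr (Sum.inr p))))) (φ := φ)
    fun x => ?_, pState_apply]
  · simp only [Function.comp_def]
    ring
  · have e : ∀ v : PWire n a, (∀ p, Sum.inr (Sum.inl p) ≠ v) →
        Function.extend (fun p => Sum.inr (Sum.inl p) : Fin n → PWire n a) x z v = z v :=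
      fun v hv => Function.extend_apply' _ _ _ fun ⟨p, hp⟩ => hv p hp
    rw [pState_apply]
    simp only [shift_injective.extend_apply, e, ne_eq, reduceCtorEq, not_false_eq_true,
      implies_true, Sum.inr.injEq]
    ring

/-- The addition of the shift turns the amplitude at `(j, s)` into the amplitude at `(j + s, s)`. -/
theorem run_shift_add {S : Circuit (Fin n ⊕ (Fin n ⊕ Fin a))} (hS : Subtracts S)
    (H : (Fin n → Bool) → (Fin n → Bool) → (Fin n → Bool) → ℂ) :
    (S.reversed.relabel (place (Sum.inl : Fin n → PWire n a) (fun p => Sum.inr (Sum.inl p))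
      fun p => Sum.inr (Sum.inr (Sum.inr p)))).run (pState a H) =
      pState a fun x s y => H (subBits x s) s y := by
  ext z
  rw [run_relabel_apply_of_slice place_data_shift_injective _
    (c := (zeroKet : State (Fin n ⊕ Fin n)) fun w => z (Sum.inr (Sum.inr (Sum.inl (Sum.inr w)))))
    (φ := pairState a fun x s => H x s fun p => z (Sum.inr (Sum.inr (Sum.inl (Sum.inl p)))))
    fun x => ?_, hS.reversed_run_pairState, pairState_apply, pState_apply]
  · simp only [place, Function.comp_apply, Sum.elim_inl, Sum.elim_inr]
    ring
  · have e0 := fun v => place_data_shift_injective (n := n) (a := a).extend_apply x z v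
    have e1 : ∀ p, Function.extend _ x z (Sum.inl p) = x (Sum.inl p) := fun p => e0 (Sum.inl p)
    have e2 : ∀ p, Function.extend _ x z (Sum.inr (Sum.inl p)) = x (Sum.inr (Sum.inl p)) :=
      fun p => e0 (Sum.inr (Sum.inl p))
    have e3 : ∀ p, Function.extend _ x z (Sum.inr (Sum.inr (Sum.inr p))) =
      x (Sum.inr (Sum.inr p)) := fun p => e0 (Sum.inr (Sum.inr p))
    have e4 : ∀ w, Function.extend (place (Sum.inl : Fin n → PWire n a)
        (fun p => Sum.inr (Sum.inl p)) fun p => Sum.inr (Sum.inr (Sum.inr p))) x z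
          (Sum.inr (Sum.inr (Sum.inl w))) = z (Sum.inr (Sum.inr (Sum.inl w))) := fun w =>
      Function.extend_apply' _ _ _ (by rintro ⟨i | i | i, h⟩ <;> cases h)
    rw [pState_apply, pairState_apply]
    simp only [e1, e2, e3, e4]
    ring

theorem run_data_add {S : Circuit (Fin n ⊕ (Fin n ⊕ Fin a))} (hS : Subtracts S)
    (H : (Fin n → Bool) → (Fin n → Bool) → (Fin n → Bool) → ℂ) :
    (S.reversed.relabel (place (fun p => Sum.inr (Sum.inr (Sum.inl (Sum.inl p))) :
      Fin n → PWire n a) Sum.inl fun p => Sum.inr (Sum.inr (Sum.inr p)))).run (pState a H) =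
      pState a fun x s y => H x s (subBits y x) := by
  ext z
  rw [run_relabel_apply_of_slice place_first_data_injective _
    (c := (zeroKet : State (Fin n ⊕ Fin n)) fun w => z (Sum.inr (Sum.inr (Sum.inl (Sum.inr w)))))
    (φ := pairState a fun y x => H x (fun p => z (Sum.inr (Sum.inl p))) y)
    fun x => ?_, hS.reversed_run_pairState, pairState_apply, pState_apply]
  · simp only [place, Function.comp_apply, Sum.elim_inl, Sum.elim_inr]
    ring
  · have e0 := fun v => place_first_data_injective (n := n) (a := a).extend_apply x z v
    have e1 : ∀ p, Function.extend _ x z (Sum.inr (Sum.inr (Sum.inl (Sum.inl p)))) =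
      x (Sum.inl p) := fun p => e0 (Sum.inl p)
    have e2 : ∀ p, Function.extend _ x z (Sum.inl p) = x (Sum.inr (Sum.inl p)) :=
      fun p => e0 (Sum.inr (Sum.inl p))
    have e3 : ∀ p, Function.extend _ x z (Sum.inr (Sum.inr (Sum.inr p))) =
      x (Sum.inr (Sum.inr p)) := fun p => e0 (Sum.inr (Sum.inr p))
    have e4 : ∀ w, Function.extend (place (fun p => Sum.inr (Sum.inr (Sum.inl (Sum.inl p))) :
        Fin n → PWire n a) Sum.inl fun p => Sum.inr (Sum.inr (Sum.inr p))) x z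
          (Sum.inr (Sum.inr (Sum.inl (Sum.inr w)))) =
            z (Sum.inr (Sum.inr (Sum.inl (Sum.inr w)))) := fun w =>
      Function.extend_apply' _ _ _ (by rintro ⟨i | i | i, h⟩ <;> cases h)
    have e5 : ∀ w, Function.extend (place (fun p => Sum.inr (Sum.inr (Sum.inl (Sum.inl p))) :
        Fin n → PWire n a) Sum.inl fun p => Sum.inr (Sum.inr (Sum.inr p))) x z
          (Sum.inr (Sum.inl w)) = z (Sum.inr (Sum.inl w)) := fun w =>
      Function.extend_apply' _ _ _ (by rintro ⟨i | i | i, h⟩ <;> cases h)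
    rw [pState_apply, pairState_apply]
    simp only [e1, e2, e3, e4, e5]
    ring

theorem sum_norm_mul_zeroKet {κ : Type} [DecidableEq κ] [Fintype κ] (c : ℂ) :
    ∑ r : κ → Bool, ‖c * (zeroKet : State κ) r‖ ^ 2 = ‖c‖ ^ 2 := by
  simp only [norm_mul, mul_pow, ← Finset.mul_sum]
  rw [← norm_sq_eq_sum, norm_zeroKet, one_pow, mul_one]

/-- The probability of an event concerning the input register. -/
theorem sum_filter_shiftedState (B : (Fin n → Bool) → (Fin n → Bool) → ℂ)
    (P : (Fin n → Bool) → Prop) [DecidablePred P] :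
    ∑ z : PWire n a → Bool with P (fun p => z (Sum.inl p)), ‖shiftedState a B z‖ ^ 2 =
      ∑ x with P x, ∑ s, ‖B x s‖ ^ 2 := by
  rw [Finset.sum_filter, sum_sum_assign, Finset.sum_filter]
  refine Finset.sum_congr rfl fun x _ => ?_
  rw [sum_sum_assign]
  change ∑ s, ∑ r, (if P x then ‖B x s * (zeroKet : State _) r‖ ^ 2 else 0) = _
  split_ifs
  · simp only [sum_norm_mul_zeroKet]
  · simp only [Finset.sum_const_zero]

theorem norm_shiftedState_sq (B : (Fin n → Bool) → (Fin n → Bool) → ℂ) :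
    ‖shiftedState a B‖ ^ 2 = ∑ x, ∑ s, ‖B x s‖ ^ 2 := by
  have h := sum_filter_shiftedState (a := a) B fun _ => True
  rw [Finset.filter_true, Finset.filter_true] at h
  rw [norm_sq_eq_sum, h]

theorem sum_filter_tensor_zeroKet {κ : Type} [DecidableEq κ] [Fintype κ] (β : State (Fin n))
    (s : Finset (Fin n → Bool)) :
    ∑ x : Fin n ⊕ κ → Bool with (fun p => x (Sum.inl p)) ∈ s,
      ‖(tensor β zeroKet : State (Fin n ⊕ κ)) x‖ ^ 2 = ∑ j ∈ s, ‖β j‖ ^ 2 := by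
  rw [Finset.sum_filter, sum_sum_assign, ← Finset.univ_inter s, ← Finset.sum_ite_mem,
    Finset.univ_inter]
  refine Finset.sum_congr rfl fun x _ => ?_
  change ∑ r, (if x ∈ s then ‖β x * (zeroKet : State κ) r‖ ^ 2 else 0) = _
  split_ifs
  · rw [sum_norm_mul_zeroKet]
  · rw [Finset.sum_const_zero]

/-- The transform of the input register for each value of the shift. -/
theorem norm_uqft_shifted_sub_sq_le {k : ℕ} (hk : 1 ≤ k) {S : Circuit (Fin n ⊕ (Fin n ⊕ Fin a))}
    (hS : Subtracts S) (B : (Fin n → Bool) → (Fin n → Bool) → ℂ) :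
    ‖((uqft n k a S).relabel uToP).run (shiftedState a B) -
        shiftedState a fun x s => qft n (WithLp.toLp 2 fun x => B x s) x‖ ^ 2 ≤
      116 * (n / Real.sqrt (2 ^ k)) * ‖shiftedState a B‖ ^ 2 +
        116 * ∑ x ∈ bad n k, ∑ s, ‖B x s‖ ^ 2 := by
  have hslice : ∀ (B : (Fin n → Bool) → (Fin n → Bool) → ℂ) z, slice uToP (shiftedState a B) z =
      tensor (WithLp.toLp 2 fun x => B x fun p => z (Sum.inr (Sum.inl p))) zeroKet := by
    intro B z
    ext x
    have e0 := fun v => uToP_injective (n := n) (a := a).extend_apply x z v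
    have e1 : ∀ p, Function.extend uToP x z (Sum.inl p) = x (Sum.inl p) := fun p => e0 (Sum.inl p)
    have e2 : ∀ p, Function.extend uToP x z (Sum.inr (Sum.inr p)) = x (Sum.inr p) :=
      fun p => e0 (Sum.inr p)
    have e3 : ∀ p, Function.extend uToP x z (Sum.inr (Sum.inl p)) = z (Sum.inr (Sum.inl p)) :=
      fun p => Function.extend_apply' _ _ _ (by rintro ⟨i | i, h⟩ <;> cases h)
    rw [slice_apply, shiftedState_apply, tensor_apply]
    simp only [e1, e2, e3]
  have h := norm_run_relabel_sub_sq_le (uToP_injective (n := n) (a := a)) (uqft n k a S)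
    (shiftedState a B) (shiftedState a fun x s => qft n (WithLp.toLp 2 fun x => B x s) x)
    (fun x => (fun p => x (Sum.inl p)) ∈ bad n k) (ε := 116 * (n / Real.sqrt (2 ^ k))) (δ := 116)
    fun z => by
      rw [hslice, hslice, norm_tensor, norm_zeroKet, mul_one, sum_filter_tensor_zeroKet]
      refine (norm_uqft_sub_sq_le hk hS _).trans (le_of_eq ?_)
      ring
  refine h.trans (le_of_eq ?_)
  congr 2
  have h2 := sum_filter_shiftedState (a := a) B fun x => x ∈ bad n k
  rw [Finset.filter_mem_eq_inter, Finset.univ_inter] at h2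
  rw [← h2]
  rfl

/-- The Fourier state of the shift. -/
theorem norm_shift_aqfs_sub_sq_le (k : ℕ) (B : (Fin n → Bool) → (Fin n → Bool) → ℂ) :
    ‖((aqfs n k).relabel (Sum.elim (fun p => Sum.inr (Sum.inl p) : Fin n → PWire n a)
      fun p => Sum.inr (Sum.inr (Sum.inl (Sum.inl p))))).run (shiftedState a B) -
        pState a fun x s y => B x s * fourier s y‖ ^ 2 ≤
      40 * (n / Real.sqrt (2 ^ k)) * ‖shiftedState a B‖ ^ 2 := by
  set sf : Fin n ⊕ Fin n → PWire n a := Sum.elim (fun p => Sum.inr (Sum.inl p))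
    fun p => Sum.inr (Sum.inr (Sum.inl (Sum.inl p))) with hsf
  have hinj : Function.Injective sf := shiftFirst_injective
  have hext : ∀ (x : Fin n ⊕ Fin n → Bool) z,
      (∀ p, Function.extend sf x z (Sum.inr (Sum.inl p)) = x (Sum.inl p)) ∧
      (∀ p, Function.extend sf x z (Sum.inr (Sum.inr (Sum.inl (Sum.inl p)))) = x (Sum.inr p)) ∧
      (∀ p, Function.extend sf x z (Sum.inl p) = z (Sum.inl p)) ∧
      (∀ p, Function.extend sf x z (Sum.inr (Sum.inr (Sum.inl (Sum.inr p)))) =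
        z (Sum.inr (Sum.inr (Sum.inl (Sum.inr p))))) ∧
      (∀ p, Function.extend sf x z (Sum.inr (Sum.inr (Sum.inr p))) =
        z (Sum.inr (Sum.inr (Sum.inr p)))) := fun x z =>
    ⟨fun p => hinj.extend_apply x z (Sum.inl p), fun p => hinj.extend_apply x z (Sum.inr p),
      fun p => Function.extend_apply' _ _ _ (by rintro ⟨i | i, h⟩ <;> cases h),
      fun p => Function.extend_apply' _ _ _ (by rintro ⟨i | i, h⟩ <;> cases h),
      fun p => Function.extend_apply' _ _ _ (by rintro ⟨i | i, h⟩ <;> cases h)⟩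
  have h := norm_run_relabel_sub_sq_le hinj (aqfs n k) (shiftedState a B)
    (pState a fun x s y => B x s * fourier s y) (fun _ => False)
    (ε := 40 * (n / Real.sqrt (2 ^ k))) (δ := 0) fun z => by
      set c : ℂ := (zeroKet : State (Fin n ⊕ Fin n))
        (fun w => z (Sum.inr (Sum.inr (Sum.inl (Sum.inr w))))) *
          (zeroKet : State (Fin a)) fun p => z (Sum.inr (Sum.inr (Sum.inr p))) with hc
      set γ : State (Fin n) := WithLp.toLp 2 (B fun p => z (Sum.inl p)) with hγ
      have e1 : slice sf (shiftedState a B) z = c • tensor γ zeroKet := by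
        ext x
        obtain ⟨x1, x2, x3, x4, x5⟩ := hext x z
        rw [shiftedState_eq_pState, slice_apply, pState_apply, PiLp.smul_apply, tensor_apply]
        simp only [x1, x2, x3, x4, x5, smul_eq_mul]
        rw [mul_comm]
      have e2 : slice sf (pState a fun x s y => B x s * fourier s y) z =
          c • ∑ s, γ s • tensor (ket s) (fourier s) := by
        ext x
        obtain ⟨x1, x2, x3, x4, x5⟩ := hext x z
        rw [slice_apply, pState_apply, PiLp.smul_apply, state_apply_sum,
          Finset.sum_eq_single fun p => x (Sum.inl p)]
        · rw [PiLp.smul_apply, tensor_apply, ket_apply, if_pos rfl]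
          simp only [x1, x2, x3, x4, x5, smul_eq_mul, one_mul]
          rw [mul_comm]
        · intro s _ hs
          rw [PiLp.smul_apply, tensor_apply, ket_apply, if_neg hs.symm, zero_mul, smul_zero]
        · exact fun h => absurd (Finset.mem_univ _) h
      rw [e1, e2, run_smul, ← smul_sub, norm_smul, norm_smul, norm_tensor, norm_zeroKet, mul_one,
        mul_pow, mul_pow, zero_mul, add_zero, mul_left_comm]
      exact mul_le_mul_of_nonneg_left (norm_aqfs_sub_sq_le k γ) (sq_nonneg _)
  rwa [zero_mul, add_zero] at h

theorem subBits_subBits (x s : Fin n → Bool) : subBits x (subBits x s) = s := by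
  conv_lhs => rw [← addBits_subBits x s]
  rw [subBits_addBits, addBits_comm, subBits_addBits]

theorem sum_subBits {M : Type*} [AddCommMonoid M] (x : Fin n → Bool) (F : (Fin n → Bool) → M) :
    ∑ s, F (subBits x s) = ∑ s, F s :=
  Equiv.sum_comp (Function.Involutive.toPerm (subBits x) (subBits_subBits x)) F

theorem norm_chi (x j : Fin n → Bool) : ‖chi x j‖ = 1 := norm_cis _

/-- The Fourier transform turns a shift of the input into phases. -/
theorem qft_shift (α : State (Fin n)) (s x : Fin n → Bool) :
    qft n (WithLp.toLp 2 fun x => α (subBits x s) * nrm n) x = nrm n * chi x s * qft n α x := by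
  rw [qft_apply, qft_apply, Finset.mul_sum, ← Equiv.sum_comp (addEquiv s)]
  refine Finset.sum_congr rfl fun j _ => ?_
  change α (subBits (addBits j s) s) * nrm n * fourier (addBits j s) x = _
  rw [subBits_addBits, fourier_eq_chi, fourier_eq_chi, chi_add_right]
  ring

/-- For each value `x` of the shifted input, the shifts `s` together give it the probability
`‖α‖ ^ 2 / 2 ^ n`. So the bad set has the probability `|B| / 2 ^ n` for every `α`, and the errors of
`uqft` and of the two uses of `aqfs` on the shift add up. -/
theorem norm_pqft_sub_sq_le {k : ℕ} (hk : 1 ≤ k) {S : Circuit (Fin n ⊕ (Fin n ⊕ Fin a))}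
    (hS : Subtracts S) (α : State (Fin n)) :
    ‖(pqft n k a S).run (tensor α zeroKet) - tensor (qft n α) zeroKet‖ ^ 2 ≤
      1980 * (n / Real.sqrt (2 ^ k)) * ‖α‖ ^ 2 := by
  set y : ℝ := n / Real.sqrt (2 ^ k) with hy
  set A : Circuit (PWire n a) := (aqfs n k).relabel
    (Sum.elim (fun p => Sum.inr (Sum.inl p) : Fin n → PWire n a)
      fun p => Sum.inr (Sum.inr (Sum.inl (Sum.inl p)))) with hA
  set U : Circuit (PWire n a) := (uqft n k a S).relabel uToP with hU
  set had : Circuit (PWire n a) := hadamards fun p => Sum.inr (Sum.inl p) with hhad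
  set B₂ : (Fin n → Bool) → (Fin n → Bool) → ℂ := fun x s => α (subBits x s) * nrm n with hB₂
  set B₃ : (Fin n → Bool) → (Fin n → Bool) → ℂ := fun x s => nrm n * chi x s * qft n α x with hB₃
  set B₆ : (Fin n → Bool) → (Fin n → Bool) → ℂ := fun x _ => nrm n * qft n α x with hB₆
  have hn2 := norm_nrm_sq n
  have hcard : (Finset.univ : Finset (Fin n → Bool)).card = 2 ^ n := by
    rw [Finset.card_univ, Fintype.card_fun, Fintype.card_bool, Fintype.card_fin]
  have h2n : (0 : ℝ) < 2 ^ n := by positivity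
  -- preparation of the superposition of shifted inputs
  have h2 : (S.reversed.relabel (place (Sum.inl : Fin n → PWire n a) (fun p => Sum.inr (Sum.inl p))
      fun p => Sum.inr (Sum.inr (Sum.inr p)))).run (had.run (tensor α zeroKet)) =
        shiftedState a B₂ := by
    rw [tensor_zeroKet_eq_pState, hhad, run_shift_hadamards, run_shift_add hS,
      run_hadamards_zeroKet, shiftedState_eq_pState]
    congr 1
    funext x s y
    rw [uniform_apply]
    ring
  -- each shifted input is uniformly distributed
  have hB₂sum : ∀ x, ∑ s, ‖B₂ x s‖ ^ 2 = ‖α‖ ^ 2 / 2 ^ n := by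
    intro x
    simp only [hB₂, norm_mul, mul_pow, hn2, ← Finset.sum_mul]
    rw [sum_subBits x fun s => ‖α s‖ ^ 2, ← norm_sq_eq_sum]
    ring
  have hB₂norm : ‖shiftedState a B₂‖ ^ 2 = ‖α‖ ^ 2 := by
    rw [norm_shiftedState_sq]
    simp only [hB₂sum, Finset.sum_const, hcard, nsmul_eq_mul]
    push_cast
    field_simp
  have h3 : ‖U.run (shiftedState a B₂) - shiftedState a B₃‖ ^ 2 ≤ 580 * y * ‖α‖ ^ 2 := by
    have h := norm_uqft_shifted_sub_sq_le hk hS B₂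
    simp only [hB₂sum, Finset.sum_const, nsmul_eq_mul] at h
    rw [hB₂norm] at h
    have e : (fun x s => qft n (WithLp.toLp 2 fun x => B₂ x s) x) = B₃ := by
      funext x s; exact qft_shift α s x
    rw [e] at h
    refine h.trans ?_
    have hb := card_bad_le hk n
    have h1 : ((bad n k).card : ℝ) * (‖α‖ ^ 2 / 2 ^ n) ≤ 4 * y * ‖α‖ ^ 2 := by
      rw [mul_div_assoc', div_le_iff₀ h2n]
      calc ((bad n k).card : ℝ) * ‖α‖ ^ 2 ≤ 4 * y * 2 ^ n * ‖α‖ ^ 2 := by gcongr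
        _ = _ := by ring
    linarith
  have hB₃norm : ‖shiftedState a B₃‖ ^ 2 = ‖α‖ ^ 2 := by
    rw [norm_shiftedState_sq, ← norm_qft α, norm_sq_eq_sum (qft n α)]
    simp only [hB₃, norm_mul, mul_pow, hn2, norm_chi, mul_one, Finset.sum_const, hcard,
      nsmul_eq_mul]
    push_cast
    refine Finset.sum_congr rfl fun x _ => ?_
    field_simp
  have hB₆norm : ‖shiftedState a B₆‖ ^ 2 = ‖α‖ ^ 2 := by
    rw [norm_shiftedState_sq, ← norm_qft α, norm_sq_eq_sum (qft n α)]
    simp only [hB₆, norm_mul, mul_pow, hn2, Finset.sum_const, hcard, nsmul_eq_mul]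
    push_cast
    refine Finset.sum_congr rfl fun x _ => ?_
    field_simp
  have h4 := norm_shift_aqfs_sub_sq_le (a := a) k B₃
  rw [hB₃norm, ← hA, ← hy] at h4
  -- the phases caused by the shift are cancelled
  have h5 : (S.reversed.relabel (place (fun p => Sum.inr (Sum.inr (Sum.inl (Sum.inl p))) :
      Fin n → PWire n a) Sum.inl fun p => Sum.inr (Sum.inr (Sum.inr p)))).run
        (pState a fun x s y => B₃ x s * fourier s y) =
      pState a fun x s y => B₆ x s * fourier s y := by
    rw [run_data_add hS]
    congr 1
    funext x s y
    have e : chi y s = chi (subBits y x) s * chi x s := by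
      rw [← chi_add_left, addBits_subBits]
    rw [fourier_eq_chi, fourier_eq_chi, e]
    ring
  have h6 := norm_shift_aqfs_sub_sq_le (a := a) k B₆
  rw [hB₆norm, ← hA, ← hy] at h6
  have h7 : had.run (shiftedState a B₆) = tensor (qft n α) zeroKet := by
    have e : shiftedState a B₆ =
        pState a fun x s y => qft n α x * (zeroKet : State (Fin n)) y * uniform n s := by
      rw [shiftedState_eq_pState]
      congr 1
      funext x s y
      rw [uniform_apply]
      ring
    rw [e, hhad, run_shift_hadamards, run_hadamards_uniform, tensor_zeroKet_eq_pState]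
  have htri : ‖(pqft n k a S).run (tensor α zeroKet) - tensor (qft n α) zeroKet‖ ≤
      ‖U.run (shiftedState a B₂) - shiftedState a B₃‖ +
      ‖A.run (shiftedState a B₃) - pState a fun x s y => B₃ x s * fourier s y‖ +
      ‖A.run (shiftedState a B₆) - pState a fun x s y => B₆ x s * fourier s y‖ := by
    have e : pqft n k a S = had ++ S.reversed.relabel (place Sum.inl (fun p => Sum.inr (Sum.inl p))
        fun p => Sum.inr (Sum.inr (Sum.inr p))) ++ U ++ A ++
        S.reversed.relabel (place (fun p => Sum.inr (Sum.inr (Sum.inl (Sum.inl p)))) Sum.inl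
          fun p => Sum.inr (Sum.inr (Sum.inr p))) ++ A.reversed ++ had := rfl
    rw [← h7, e]
    simp only [run_append]
    rw [h2, ← run_sub, norm_run]
    have e6 : shiftedState a B₆ = A.reversed.run (A.run (shiftedState a B₆)) :=
      (reversed_run _ _).symm
    rw [e6, ← run_sub, norm_run, ← e6]
    refine (norm_sub_le_norm_sub_add_norm_sub _
      (pState a fun x s y => B₆ x s * fourier s y) _).trans ?_
    rw [norm_sub_rev (pState a fun x s y => B₆ x s * fourier s y), ← h5, ← run_sub, norm_run, h5]
    refine add_le_add ((norm_sub_le_norm_sub_add_norm_sub _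
      (A.run (shiftedState a B₃)) _).trans ?_) le_rfl
    rw [← run_sub, norm_run]
  -- `(u + v + w) ^ 2 ≤ 3 (u ^ 2 + v ^ 2 + w ^ 2)`
  generalize ‖U.run (shiftedState a B₂) - shiftedState a B₃‖ = u at h3 htri
  generalize ‖A.run (shiftedState a B₃) - pState a fun x s y => B₃ x s * fourier s y‖ = v at h4 htri
  generalize ‖A.run (shiftedState a B₆) - pState a fun x s y => B₆ x s * fourier s y‖ = w at h6 htri
  have h8 := pow_le_pow_left₀ (norm_nonneg _) htri 2
  nlinarith [sq_nonneg (u - v), sq_nonneg (u - w), sq_nonneg (v - w)]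

theorem pqft_wellFormed (k : ℕ) {S : Circuit (Fin n ⊕ (Fin n ⊕ Fin a))} (hS : S.WellFormed) :
    (pqft n k a S).WellFormed := by
  have hA := (aqfs_wellFormed n k).relabel (shiftFirst_injective (n := n) (a := a))
  exact (((((((hadamards_wellFormed shift_injective).append
    (hS.reversed.relabel place_data_shift_injective)).append
      ((uqft_wellFormed k hS).relabel uToP_injective)).append hA).append
        (hS.reversed.relabel place_first_data_injective)).append hA.reversed).append
          (hadamards_wellFormed shift_injective))

theorem size_pqft_le {k : ℕ} (hk : 1 ≤ k) (S : Circuit (Fin n ⊕ (Fin n ⊕ Fin a))) :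
    (pqft n k a S).size ≤ 32 * (n * k) + 6 * S.size := by
  have h1 := size_aqfs_le n k
  have h2 := size_uqft_le hk S
  have h3 := Nat.le_mul_of_pos_right n hk
  rw [mul_add] at h1
  simp only [pqft, size_append, size_reversed, size_relabel, size_hadamards]
  omega

theorem depth_pqft_le {k : ℕ} (hk : 1 ≤ k) (S : Circuit (Fin n ⊕ (Fin n ⊕ Fin a))) :
    (pqft n k a S).depth ≤ 11 * k + 19 + 6 * S.depth := by
  have h2 := depth_uqft_le hk S
  simp only [pqft, depth_append, depth_reversed, depth_relabel, depth_hadamards, depth_aqfs]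
  omega

end PQFT

/-! ### The cut-off parameter for inverse polynomial precision -/

section Precision

theorem clog_le_log {n : ℕ} (hn : 2 ≤ n) : (Nat.clog 2 n : ℝ) ≤ 4 * Real.log n := by
  have h1 := Nat.pow_pred_clog_lt_self (b := 2) (by norm_num) (x := n) (by omega)
  have h2 : 1 ≤ Nat.clog 2 n := Nat.clog_pos (by norm_num) hn
  have h3 : Real.log ((2 : ℝ) ^ (Nat.clog 2 n).pred) ≤ Real.log n :=
    Real.log_le_log (by positivity) (by exact_mod_cast h1.le)
  rw [Real.log_pow, Nat.pred_eq_sub_one, Nat.cast_sub h2] at h3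
  have h4 := half_le_log n hn
  have h5 := Real.log_two_gt_d9
  have h6 : (1 : ℝ) ≤ Nat.clog 2 n := by exact_mod_cast h2
  push_cast at h3
  nlinarith

/-- With `A ⌈log₂ n⌉` rotations per qubit the error is polynomially small. -/
theorem error_le_inv_pow {n : ℕ} (hn : 2 ≤ n) (c : ℕ) :
    1980 * ((n : ℝ) / Real.sqrt (2 ^ (2 * (2 * c + 12) * Nat.clog 2 n))) ≤
      (1 / (n : ℝ) ^ c) ^ 2 := by
  have hn0 : (0 : ℝ) < n := by exact_mod_cast (by omega : 0 < n)
  have h1 : (n : ℝ) ≤ 2 ^ Nat.clog 2 n := by exact_mod_cast Nat.le_pow_clog (by norm_num) n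
  have h2 : (n : ℝ) ^ (2 * c + 12) ≤ Real.sqrt (2 ^ (2 * (2 * c + 12) * Nat.clog 2 n)) := by
    refine Real.le_sqrt_of_sq_le ?_
    have e : 2 * (2 * c + 12) * Nat.clog 2 n = Nat.clog 2 n * ((2 * c + 12) * 2) := by ring
    rw [e, pow_mul, ← pow_mul (n : ℝ)]
    exact pow_le_pow_left₀ hn0.le h1 _
  have h3 : (1980 : ℝ) ≤ (n : ℝ) ^ 11 :=
    calc (1980 : ℝ) ≤ 2 ^ 11 := by norm_num
      _ ≤ (n : ℝ) ^ 11 := pow_le_pow_left₀ (by norm_num) (by exact_mod_cast hn) 11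
  calc 1980 * ((n : ℝ) / Real.sqrt (2 ^ (2 * (2 * c + 12) * Nat.clog 2 n)))
      ≤ (n : ℝ) ^ 11 * (n / (n : ℝ) ^ (2 * c + 12)) := by gcongr
    _ = (1 / (n : ℝ) ^ c) ^ 2 := by
      field_simp
      ring

end Precision

end QFTCircuit
open QFTCircuit QFTCircuit.Circuit in
theorem mainTheorem10 :
    -- linear-size logarithmic-depth subtraction circuits exist
    (∃ (C : ℝ) (a : ℕ → ℕ) (S : ∀ n : ℕ, Circuit (Fin n ⊕ (Fin n ⊕ Fin (a n)))),
      IsSubtractionFamily C a S) ∧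
    -- approximate Fourier state computation
    (∃ C : ℝ, ∀ n k : ℕ, 1 ≤ n → 1 ≤ k →
      (aqfs n k).WellFormed ∧ (aqfs n k).size ≤ n * (k + 1) ∧ (aqfs n k).depth ≤ k + 1 ∧
      ∀ α : State (Fin n),
        ‖(aqfs n k).run (tensor α zeroKet) - ∑ j, α j • tensor (ket j) (fourier j)‖ ≤
          C * n / 2 ^ k * ‖α‖) ∧
    -- Fourier phase estimation from three copies
    (∃ C : ℝ, ∀ n k : ℕ, 1 ≤ n → 1 ≤ k →
      (fpe n k).WellFormed ∧ ((fpe n k).size : ℝ) ≤ C * (n * k) ∧ (fpe n k).depth ≤ 8 * k + 1 ∧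
      (∀ α : State (Fin n),
        ‖(fpe n k).run (∑ j, α j •
              tensor (ket j) (tensor (fourier j) (tensor (fourier j) (fourier j)))) -
            ∑ j, α j • tensor zeroKet (tensor (fourier j) (tensor (fourier j) (fourier j)))‖ ^ 2 ≤
          C * (n / Real.sqrt (2 ^ k) * ‖α‖ ^ 2 + ∑ j ∈ bad n k, ‖α j‖ ^ 2)) ∧
      ((bad n k).card : ℝ) ≤
        C * (n / Real.sqrt (2 ^ k)) * 2 ^ n) ∧
    -- the circuits built on any such subtraction circuits
    ∀ (C₀ : ℝ) (a : ℕ → ℕ) (S : ∀ n : ℕ, Circuit (Fin n ⊕ (Fin n ⊕ Fin (a n)))),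
      IsSubtractionFamily C₀ a S →
      -- exact copying of Fourier basis states
      (∃ C : ℝ, ∀ n : ℕ, 2 ≤ n →
        (copy n (a n) (S n)).WellFormed ∧ ((copy n (a n) (S n)).size : ℝ) ≤ C * n ∧
        ((copy n (a n) (S n)).depth : ℝ) ≤ C * Real.log n ∧
        ∀ j : Fin n → Bool,
          (copy n (a n) (S n)).run (tensor (fourier j) (tensor zeroKet zeroKet)) =
            tensor (fourier j) (tensor (fourier j) zeroKet)) ∧
      -- the QFT circuit without random shift, and with it, with cut-off parameter `k`
      (∃ C : ℝ, ∀ n k : ℕ, 2 ≤ n → 1 ≤ k →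
        ((uqft n k (a n) (S n)).WellFormed ∧
          ((uqft n k (a n) (S n)).size : ℝ) ≤ C * (n * k) ∧
          ((uqft n k (a n) (S n)).depth : ℝ) ≤ C * (k + Real.log n) ∧
          ∀ α : State (Fin n),
            ‖(uqft n k (a n) (S n)).run (tensor α zeroKet) - tensor (qft n α) zeroKet‖ ^ 2 ≤
              C * (n / Real.sqrt (2 ^ k) * ‖α‖ ^ 2 + ∑ j ∈ bad n k, ‖α j‖ ^ 2)) ∧
        ((pqft n k (a n) (S n)).WellFormed ∧
          ((pqft n k (a n) (S n)).size : ℝ) ≤ C * (n * k) ∧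
          ((pqft n k (a n) (S n)).depth : ℝ) ≤ C * (k + Real.log n) ∧
          ∀ α : State (Fin n),
            ‖(pqft n k (a n) (S n)).run (tensor α zeroKet) - tensor (qft n α) zeroKet‖ ^ 2 ≤
              C * (n / Real.sqrt (2 ^ k)) * ‖α‖ ^ 2)) ∧
      -- the QFT to within any inverse polynomial
      ∀ c : ℕ, ∃ (A : ℕ) (C : ℝ), ∀ n : ℕ, 2 ≤ n →
        let Q := pqft n (A * Nat.clog 2 n) (a n) (S n)
        Q.WellFormed ∧ (Q.size : ℝ) ≤ C * (n * Real.log n) ∧ (Q.depth : ℝ) ≤ C * Real.log n ∧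
        (Fintype.card (PWire n (a n)) : ℝ) ≤ C * n ∧
        ∀ α : State (Fin n),
          ‖Q.run (tensor α zeroKet) - tensor (qft n α) zeroKet‖ ≤ 1 / (n : ℝ) ^ c * ‖α‖ := by
  refine ⟨⟨300, _, subtraction, subtraction_isSubtractionFamily⟩,
    ⟨2 * Real.pi, fun n k _ _ => ⟨aqfs_wellFormed n k, size_aqfs_le n k, (depth_aqfs n k).le,
      norm_aqfs_sub_le k⟩⟩,
    ⟨18, fun n k _ hk => ⟨fpe_wellFormed n k, ?_, depth_fpe_le hk n, norm_fpe_sub_sq_le_bad hk,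
      ?_⟩⟩, fun C₀ a S hS => ?_⟩
  · have h : ((fpe n k).size : ℝ) ≤ 11 * (n * k) := by exact_mod_cast size_fpe_le hk n
    have h' : (0 : ℝ) ≤ n * k := by positivity
    linarith
  · refine (card_bad_le hk n).trans ?_
    have : (0 : ℝ) ≤ n / Real.sqrt (2 ^ k) * 2 ^ n := by positivity
    linarith
  have hC₀ : 0 ≤ C₀ := by
    have h1 := (hS.2 2 le_rfl).1
    have h2 : (0 : ℝ) ≤ a 2 := Nat.cast_nonneg _
    push_cast at h1
    linarith
  have hpsize : ∀ n k : ℕ, 2 ≤ n → 1 ≤ k →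
      ((pqft n k (a n) (S n)).size : ℝ) ≤ 32 * (n * k) + 6 * (C₀ * n) := by
    intro n k hn hk
    have h1 : ((pqft n k (a n) (S n)).size : ℝ) ≤ 32 * (n * k) + 6 * (S n).size := by
      exact_mod_cast size_pqft_le hk (S n)
    linarith [(hS.2 n hn).2.1]
  have hpdepth : ∀ n k : ℕ, 2 ≤ n → 1 ≤ k →
      ((pqft n k (a n) (S n)).depth : ℝ) ≤ 11 * k + 19 + 6 * (C₀ * Real.log n) := by
    intro n k hn hk
    have h1 : ((pqft n k (a n) (S n)).depth : ℝ) ≤ 11 * k + 19 + 6 * (S n).depth := by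
      exact_mod_cast depth_pqft_le hk (S n)
    linarith [(hS.2 n hn).2.2]
  refine ⟨⟨2 + C₀, fun n hn => ⟨copy_wellFormed (hS.1 n).1, ?_, ?_, run_copy (hS.subtracts n)⟩⟩,
    ⟨2000 + 6 * C₀, fun n k hn hk => ?_⟩, fun c => ?_⟩
  · have h1 := (hS.2 n hn).2.1
    have h2 : (0 : ℝ) ≤ n := Nat.cast_nonneg _
    rw [size_copy]
    push_cast
    linarith
  · have h1 := (hS.2 n hn).2.2
    have h2 := half_le_log n hn
    rw [depth_copy]
    push_cast
    linarith
  · have hk1 : (1 : ℝ) ≤ k := by exact_mod_cast hk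
    have hn0 : (0 : ℝ) ≤ n := Nat.cast_nonneg _
    have hnk : (n : ℝ) ≤ n * k := le_mul_of_one_le_right hn0 hk1
    have hCnk : C₀ * n ≤ C₀ * (n * k) := mul_le_mul_of_nonneg_left hnk hC₀
    have hlog := half_le_log n hn
    have hCk : 0 ≤ C₀ * k := by positivity
    have hClog : 0 ≤ C₀ * Real.log n := mul_nonneg hC₀ (by linarith)
    refine ⟨⟨uqft_wellFormed k (hS.1 n).1, ?_, ?_, fun α => ?_⟩,
      pqft_wellFormed k (hS.1 n).1, ?_, ?_, fun α => ?_⟩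
    · have h1 : ((uqft n k (a n) (S n)).size : ℝ) ≤ 26 * (n * k) + 4 * (S n).size := by
        exact_mod_cast size_uqft_le hk (S n)
      linarith [(hS.2 n hn).2.1]
    · have h1 : ((uqft n k (a n) (S n)).depth : ℝ) ≤ 9 * k + 15 + 4 * (S n).depth := by
        exact_mod_cast depth_uqft_le hk (S n)
      linarith [(hS.2 n hn).2.2]
    · refine (norm_uqft_sub_sq_le hk (hS.subtracts n) α).trans
        (mul_le_mul_of_nonneg_right (by linarith) ?_)
      exact add_nonneg (by positivity) (Finset.sum_nonneg fun _ _ => sq_nonneg _)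
    · linarith [hpsize n k hn hk]
    · linarith [hpdepth n k hn hk]
    · refine (norm_pqft_sub_sq_le hk (hS.subtracts n) α).trans ?_
      gcongr
      linarith
  · -- the error is at most `1980 n ^ (1 - A / 2)`, and `1980 ≤ n ^ 11`
    set A : ℕ := 2 * (2 * c + 12) with hA
    refine ⟨A, 128 * A + 43 + 12 * C₀, fun n hn => ?_⟩
    have hk : 1 ≤ A * Nat.clog 2 n :=
      Nat.mul_pos (by omega) (Nat.clog_pos (by norm_num) hn)
    have hclog := clog_le_log hn
    have hlog := half_le_log n hn
    have hn0 : (0 : ℝ) ≤ n := Nat.cast_nonneg _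
    have hA0 : (0 : ℝ) ≤ A := Nat.cast_nonneg _
    have hAlog : (A : ℝ) * Nat.clog 2 n ≤ A * (4 * Real.log n) :=
      mul_le_mul_of_nonneg_left hclog hA0
    have hnlog : (n : ℝ) ≤ n * (2 * Real.log n) := le_mul_of_one_le_right hn0 (by linarith)
    have hCn : C₀ * n ≤ C₀ * (n * (2 * Real.log n)) := mul_le_mul_of_nonneg_left hnlog hC₀
    have hAl : 0 ≤ (A : ℝ) * Real.log n := mul_nonneg hA0 (by linarith)
    have hCl : 0 ≤ C₀ * Real.log n := mul_nonneg hC₀ (by linarith)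
    refine ⟨pqft_wellFormed _ (hS.1 n).1, ?_, ?_, ?_, fun α => ?_⟩
    · have h1 := hpsize n _ hn hk
      push_cast at h1
      have h2 : (n : ℝ) * (A * Nat.clog 2 n) ≤ n * (A * (4 * Real.log n)) :=
        mul_le_mul_of_nonneg_left hAlog hn0
      linarith
    · have h1 := hpdepth n _ hn hk
      push_cast at h1
      linarith
    · have h1 := (hS.2 n hn).1
      have h2 : Fintype.card (PWire n (a n)) = 5 * n + a n := by
        simp only [Fintype.card_sum, Fintype.card_fin]
        ring
      have h3 : 0 ≤ (A : ℝ) * n := by positivity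
      have h4 : 0 ≤ C₀ * n := by positivity
      rw [h2]
      push_cast
      linarith
    · refine le_of_sq_le_sq ?_ (by positivity)
      rw [mul_pow]
      exact (norm_pqft_sub_sq_le hk (hS.subtracts n) α).trans
        (mul_le_mul_of_nonneg_right (error_le_inv_pow hn c) (sq_nonneg _))
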